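/- Let $k$ be an algebraically closed field of characteristic $3$, let $G$ be the simple algebraic group of type $E_8$ over $k$ and let $\mathfrak g=\mathrm{Lie}(G)$. Let $\mathcal O(A_2^2+A_1)\subset\mathfrak g$ be the nilpotent $G$-orbit of $e_{\alpha_1}+e_{\alpha_2}+e_{\alpha_3}+e_{\alpha_5}+e_{\alpha_6}$ (simple roots $\alpha_1,\dots,\alpha_8$ in Bourbaki's numbering, $e_\alpha$ the root vectors of a Chevalley basis), and let $e\in\mathcal O(A_2^2+A_1)$. Write $\mathfrak g_e=\{x\in\mathfrak g:[x,e]=0\}$ and $\mathfrak n_e=\{x\in\mathfrak g:[x,e]\in k e\}$ for the centraliser and the normaliser of $e$, $A=\mathrm{rad}(\mathfrak n_e)$ for the solvable radical of $\mathfrak n_e$, and $\mathfrak w=N_{\mathfrak g}(A)=\{x\in\mathfrak g:[x,A]\subseteq A\}$. Let $\mathcal O(2;\underline 1)=k[x_1,x_2]/(x_1^3,x_2^3)$ with partial derivatives $\partial_1,\partial_2$, let $W(2;\underline 1)=\mathrm{Der}_k\,\mathcal O(2;\underline 1)=\mathcal O(2;\underline 1)\partial_1\oplus\mathcal O(2;\underline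 1)\partial_2$, let $H(2;\underline 1)=\{f_1\partial_1+f_2\partial_2:\partial_1(f_1)+\partial_2(f_2)=0\}$, let $CH(2;\underline 1)=H(2;\underline 1)\oplus k(x_1\partial_1+x_2\partial_2)$, and let $\mathfrak{psl}(3)$ be the quotient of $\mathfrak{sl}(3)$ over $k$ by its centre. Then $A$ is an abelian Lie algebra of dimension $8$, and there is a $78$-dimensional subalgebra $J$ of $\mathfrak g$ with $A\subseteq J\subseteq\mathfrak g_e$ which is an ideal of $\mathfrak g_e$, of $\mathfrak n_e$ and of $\mathfrak w$, such that: (a) $A=\mathrm{rad}(\mathfrak g_e)$, and $\mathfrak g_e/J\cong H(2;\underline 1)$ as Lie algebras. (b) $A=\mathrm{rad}(\mathfrak n_e)$, and $\mathfrak n_e/J\cong CH(2;\underline 1)$ as Lie algebras. (c) $A=\mathrm{rad}(\mathfrak w)$, and $\mathfrak w$ is a maximal Lie subalgebra of $\mathfrak g$. (d) $\mathfrak w/A\cong (J/A)\rtimes W(2;\underline 1)$ as Lie algebras, for some action of $W(2;\underline 1)$ on $J/A$ by derivations and by an isomorphism that restricts to the identity on $J/A$. Moreover there is a short exact sequence of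 Lie algebras \[0\to\mathfrak{psl}(3)\otimes_k\mathcal O(2;\underline 1)\to J/A\to\mathfrak{psl}(3)\to 0\] that does not split, that is, no homomorphism of Lie algebras $\mathfrak{psl}(3)\to J/A$ is a section of the map $J/A\to\mathfrak{psl}(3)$. -/

import Mathlib

open scoped Matrix TensorProduct

noncomputable section

/-! ## The Lie algebra of type `E₈` -/

namespace E8

/-- The `E₈` bilinear form on the root lattice `ℤ⁸`, in coordinates with respect to the simple
roots `α₁, …, α₈` (Bourbaki numbering; `αᵢ` has index `i - 1` in `Fin 8`). -/
def form (u v : Fin 8 → ℤ) : ℤ := u ⬝ᵥ (CartanMatrix.E₈ *ᵥ v)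

/-- The roots: the `240` vectors of norm `2` in the `E₈` lattice. -/
abbrev Root : Type := {v : Fin 8 → ℤ // form v v = 2}

/-- The lower triangular half of the Cartan matrix: `halfMatrix + halfMatrixᵀ = E₈`. -/
def halfMatrix : Matrix (Fin 8) (Fin 8) ℤ :=
  Matrix.of fun i j => if i = j then 1 else if j < i then CartanMatrix.E₈ i j else 0

/-- The sign `ε(u, v) = (-1) ^ (uᵀ L v)` where `L` is the lower triangular half of the Cartan
matrix. It is bimultiplicative with `ε(u, v) ε(v, u) = (-1) ^ (u, v)` and
`ε(v, v) = (-1) ^ ((v, v) / 2)`. -/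
def sign (u v : Fin 8 → ℤ) : ℤ := ((u ⬝ᵥ (halfMatrix *ᵥ v)).negOnePow : ℤ)

theorem form_add_left (u v w) : form (u + v) w = form u w + form v w := by
  simp [form, add_dotProduct]

theorem form_add_right (u v w) : form u (v + w) = form u v + form u w := by
  simp [form, Matrix.mulVec_add, dotProduct_add]

theorem form_comm (u v) : form u v = form v u := by
  unfold form
  rw [Matrix.dotProduct_mulVec, ← Matrix.mulVec_transpose, CartanMatrix.E₈_transpose,
    dotProduct_comm]

theorem form_neg_left (u v) : form (-u) v = -form u v := by simp [form]

theorem form_neg_right (u v) : form u (-v) = -form u v := by simp [form, Matrix.mulVec_neg]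

theorem form_eq_half (u v) :
    form u v = u ⬝ᵥ (halfMatrix *ᵥ v) + v ⬝ᵥ (halfMatrix *ᵥ u) := by
  have h : CartanMatrix.E₈ = halfMatrix + halfMatrixᵀ := by decide
  unfold form
  rw [h, Matrix.add_mulVec, dotProduct_add, Matrix.dotProduct_mulVec u halfMatrixᵀ,
    Matrix.vecMul_transpose, dotProduct_comm (halfMatrix *ᵥ u)]

theorem sixty_form_self (x : Fin 8 → ℤ) : 60 * form x x =
    30 * (2 * x 7 - x 6) ^ 2 + 10 * (3 * x 6 - 2 * x 5) ^ 2 + 5 * (4 * x 5 - 3 * x 4) ^ 2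
      + 3 * (5 * x 4 - 4 * x 3) ^ 2 + 30 * (2 * x 0 - x 2) ^ 2 + 10 * (3 * x 2 - 2 * x 3) ^ 2
      + 30 * (2 * x 1 - x 3) ^ 2 + 2 * (x 3) ^ 2 := by
  simp [form, dotProduct, Matrix.mulVec, Fin.sum_univ_succ, CartanMatrix.E₈, Fin.succ_zero_eq_one]
  ring

theorem form_self_nonneg (x) : 0 ≤ form x x := by
  have := sixty_form_self x
  nlinarith [sq_nonneg (2 * x 7 - x 6), sq_nonneg (3 * x 6 - 2 * x 5),
    sq_nonneg (4 * x 5 - 3 * x 4), sq_nonneg (5 * x 4 - 4 * x 3), sq_nonneg (2 * x 0 - x 2),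
    sq_nonneg (3 * x 2 - 2 * x 3), sq_nonneg (2 * x 1 - x 3), sq_nonneg (x 3)]

theorem eq_zero_of_form_self {x} (h : form x x = 0) : x = 0 := by
  have h0 := sixty_form_self x
  rw [h] at h0
  have a1 := sq_nonneg (2 * x 7 - x 6)
  have a2 := sq_nonneg (3 * x 6 - 2 * x 5)
  have a3 := sq_nonneg (4 * x 5 - 3 * x 4)
  have a4 := sq_nonneg (5 * x 4 - 4 * x 3)
  have a5 := sq_nonneg (2 * x 0 - x 2)
  have a6 := sq_nonneg (3 * x 2 - 2 * x 3)
  have a7 := sq_nonneg (2 * x 1 - x 3)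
  have a8 := sq_nonneg (x 3)
  have b1 : 2 * x 7 - x 6 = 0 := pow_eq_zero_iff (two_ne_zero) |>.1 (by linarith)
  have b2 : 3 * x 6 - 2 * x 5 = 0 := pow_eq_zero_iff (two_ne_zero) |>.1 (by linarith)
  have b3 : 4 * x 5 - 3 * x 4 = 0 := pow_eq_zero_iff (two_ne_zero) |>.1 (by linarith)
  have b4 : 5 * x 4 - 4 * x 3 = 0 := pow_eq_zero_iff (two_ne_zero) |>.1 (by linarith)
  have b5 : 2 * x 0 - x 2 = 0 := pow_eq_zero_iff (two_ne_zero) |>.1 (by linarith)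
  have b6 : 3 * x 2 - 2 * x 3 = 0 := pow_eq_zero_iff (two_ne_zero) |>.1 (by linarith)
  have b7 : 2 * x 1 - x 3 = 0 := pow_eq_zero_iff (two_ne_zero) |>.1 (by linarith)
  have b8 : x 3 = 0 := pow_eq_zero_iff (two_ne_zero) |>.1 (by linarith)
  ext i
  fin_cases i <;> simp <;> omega

theorem sign_add_left (u v w) : sign (u + v) w = sign u w * sign v w := by
  simp [sign, add_dotProduct, Int.negOnePow_add]

theorem sign_add_right (u v w) : sign u (v + w) = sign u v * sign u w := by
  simp [sign, Matrix.mulVec_add, dotProduct_add, Int.negOnePow_add]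

theorem sign_mul_swap (u v) : sign u v * sign v u = ((form u v).negOnePow : ℤ) := by
  simp [sign, form_eq_half, Int.negOnePow_add]

theorem sign_mul_self (u v) : sign u v * sign u v = 1 := by
  simp [sign, ← Units.val_mul]

theorem sign_self (v : Root) : sign v.1 v.1 = -1 := by
  have h := form_eq_half v.1 v.1
  rw [v.2] at h
  have h' : v.1 ⬝ᵥ (halfMatrix *ᵥ v.1) = 1 := by omega
  simp [sign, h']

theorem sign_neg_right (u v) : sign u (-v) = sign u v := by
  simp [sign, Matrix.mulVec_neg, Int.negOnePow_neg]

theorem sign_neg_left (u v) : sign (-u) v = sign u v := by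
  simp [sign, Int.negOnePow_neg]

theorem form_root_bounds (u v : Root) : -2 ≤ form u.1 v.1 ∧ form u.1 v.1 ≤ 2 := by
  have h1 := form_self_nonneg (u.1 + v.1)
  have h2 := form_self_nonneg (u.1 + -v.1)
  simp only [form_add_left, form_add_right, form_neg_left, form_neg_right, u.2, v.2,
    form_comm v.1 u.1] at h1 h2
  omega

theorem add_eq_zero_iff (u v : Root) : u.1 + v.1 = 0 ↔ form u.1 v.1 = -2 := by
  have h : form (u.1 + v.1) (u.1 + v.1) = 4 + 2 * form u.1 v.1 := by
    simp only [form_add_left, form_add_right, u.2, v.2, form_comm v.1 u.1]; ring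
  constructor
  · intro h0
    rw [h0] at h
    simp [form] at h
    unfold form; omega
  · intro h0
    exact eq_zero_of_form_self (by omega)

theorem add_root_iff (u v : Root) : form (u.1 + v.1) (u.1 + v.1) = 2 ↔ form u.1 v.1 = -1 := by
  have h : form (u.1 + v.1) (u.1 + v.1) = 4 + 2 * form u.1 v.1 := by
    simp only [form_add_left, form_add_right, u.2, v.2, form_comm v.1 u.1]; ring
  omega

/-- Index set of the Chevalley basis: `Sum.inl i` for `hᵢ`, `Sum.inr α` for `e_α`. -/
abbrev Index : Type := Fin 8 ⊕ Root

variable (k : Type*) [Field k]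

end E8

/-- The Lie algebra of type `E₈` over `k`: the free `k`-module on the basis consisting of
`hᵢ` (`i = 1, …, 8`) and `e_α` (`α` a root). -/
def E8 (k : Type*) [Field k] : Type _ := E8.Index →₀ k

namespace E8

variable (k : Type*) [Field k]

instance : AddCommGroup (E8 k) := inferInstanceAs (AddCommGroup (E8.Index →₀ k))

instance : Module k (E8 k) := inferInstanceAs (Module k (E8.Index →₀ k))

/-- The basis of `E8 k`. -/
def basis : Module.Basis Index k (E8 k) := Finsupp.basisSingleOne

/-- The coroot `v^∨ = ∑ᵢ vᵢ hᵢ` attached to an element `v = ∑ᵢ vᵢ αᵢ` of the root lattice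
(the root system is simply laced). -/
def coroot (v : Fin 8 → ℤ) : E8 k := ∑ i, (v i : k) • basis k (Sum.inl i)

/-- The root vector `e_v` if `v` is a root, and `0` otherwise. -/
def rootVector (v : Fin 8 → ℤ) : E8 k :=
  if h : form v v = 2 then basis k (Sum.inr ⟨v, h⟩) else 0

/-- The structure constants:
`[hᵢ, hⱼ] = 0`, `[hᵢ, e_β] = ⟨β, αᵢ^∨⟩ e_β`, `[e_α, e_β] = ε(α, β) e_{α + β}` if `α + β` is a root,
`[e_α, e_{-α}] = -α^∨`, and `[e_α, e_β] = 0` in the remaining cases. After replacing `e_α` by `-e_α`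
for all negative roots `α` this is a Chevalley basis. -/
def bracketBasis : Index → Index → E8 k
  | .inl _, .inl _ => 0
  | .inl i, .inr β => ((CartanMatrix.E₈ *ᵥ β.1) i : k) • basis k (.inr β)
  | .inr α, .inl i => -(((CartanMatrix.E₈ *ᵥ α.1) i : k) • basis k (.inr α))
  | .inr α, .inr β =>
    if α.1 + β.1 = 0 then -coroot k α.1 else (sign α.1 β.1 : k) • rootVector k (α.1 + β.1)

/-- The Lie bracket as a bilinear map. -/
def bracket : E8 k →ₗ[k] E8 k →ₗ[k] E8 k :=
  (basis k).constr k fun i => (basis k).constr k fun j => bracketBasis k i j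

theorem bracket_basis (i j : Index) :
    bracket k (basis k i) (basis k j) = bracketBasis k i j := by
  simp [bracket]

theorem rootVector_of_root (α : Root) : rootVector k α.1 = basis k (.inr α) := by
  simp [rootVector, α.2]

theorem rootVector_of_not {v : Fin 8 → ℤ} (h : form v v ≠ 2) : rootVector k v = 0 := by
  simp [rootVector, h]

theorem bracket_h_root (i : Fin 8) (v : Fin 8 → ℤ) :
    bracket k (basis k (.inl i)) (rootVector k v) =
      ((CartanMatrix.E₈ *ᵥ v) i : k) • rootVector k v := by
  by_cases h : form v v = 2
  · have := rootVector_of_root k ⟨v, h⟩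
    simp only at this
    rw [this, bracket_basis]; rfl
  · simp [rootVector_of_not k h]

theorem bracket_root_h (i : Fin 8) (v : Fin 8 → ℤ) :
    bracket k (rootVector k v) (basis k (.inl i)) =
      -(((CartanMatrix.E₈ *ᵥ v) i : k) • rootVector k v) := by
  by_cases h : form v v = 2
  · have := rootVector_of_root k ⟨v, h⟩
    simp only at this
    rw [this, bracket_basis]; rfl
  · simp [rootVector_of_not k h]

theorem bracket_coroot_root (u v : Fin 8 → ℤ) :
    bracket k (coroot k u) (rootVector k v) = (form u v : k) • rootVector k v := by
  simp only [coroot, map_sum, map_smul, LinearMap.sum_apply, LinearMap.smul_apply,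
    bracket_h_root, smul_smul, ← Finset.sum_smul]
  simp [form, dotProduct]

theorem bracket_root_coroot (u v : Fin 8 → ℤ) :
    bracket k (rootVector k v) (coroot k u) = -((form u v : k) • rootVector k v) := by
  simp only [coroot, map_sum, map_smul, bracket_root_h, smul_neg, Finset.sum_neg_distrib,
    smul_smul, ← Finset.sum_smul]
  simp [form, dotProduct]

theorem bracket_h_coroot (i : Fin 8) (u : Fin 8 → ℤ) :
    bracket k (basis k (.inl i)) (coroot k u) = 0 := by
  simp [coroot, bracket_basis, bracketBasis]

theorem coroot_add (u v : Fin 8 → ℤ) : coroot k (u + v) = coroot k u + coroot k v := by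
  simp [coroot, add_smul, Finset.sum_add_distrib]

theorem coroot_neg (u : Fin 8 → ℤ) : coroot k (-u) = -coroot k u := by
  simp [coroot]

theorem bracket_root_opp {u v : Fin 8 → ℤ} (hu : form u u = 2) (hv : form v v = 2)
    (h : form u v = -2) : bracket k (rootVector k u) (rootVector k v) = -coroot k u := by
  have e1 := rootVector_of_root k ⟨u, hu⟩
  have e2 := rootVector_of_root k ⟨v, hv⟩
  simp only at e1 e2
  have := (add_eq_zero_iff ⟨u, hu⟩ ⟨v, hv⟩).2 h
  simp only at this
  rw [e1, e2, bracket_basis]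
  simp [bracketBasis, this]

theorem bracket_root_add {u v : Fin 8 → ℤ} (hu : form u u = 2) (hv : form v v = 2)
    (h : form u v ≠ -2) : bracket k (rootVector k u) (rootVector k v) =
      (sign u v : k) • rootVector k (u + v) := by
  have e1 := rootVector_of_root k ⟨u, hu⟩
  have e2 := rootVector_of_root k ⟨v, hv⟩
  simp only at e1 e2
  have := (add_eq_zero_iff ⟨u, hu⟩ ⟨v, hv⟩).not.2 h
  simp only at this
  rw [e1, e2, bracket_basis]
  simp [bracketBasis, this]

theorem bracket_root_zero {u v : Fin 8 → ℤ} (hu : form u u = 2) (hv : form v v = 2)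
    (h : form u v ≠ -2) (h' : form u v ≠ -1) :
    bracket k (rootVector k u) (rootVector k v) = 0 := by
  rw [bracket_root_add k hu hv h, rootVector_of_not, smul_zero]
  exact (add_root_iff ⟨u, hu⟩ ⟨v, hv⟩).not.2 h'

theorem bracketBasis_self (i : Index) : bracketBasis k i i = 0 := by
  rcases i with i | α
  · rfl
  · have h : form α.1 α.1 = 2 := α.2
    rw [← bracket_basis, ← rootVector_of_root]
    exact bracket_root_zero k h h (by omega) (by omega)

theorem bracketBasis_swap (i j : Index) : bracketBasis k i j = -bracketBasis k j i := by
  rcases i with i | α <;> rcases j with j | β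
  · simp [bracketBasis]
  · simp [bracketBasis]
  · simp [bracketBasis]
  · simp only [← bracket_basis, ← rootVector_of_root]
    have hc := form_comm α.1 β.1
    by_cases h2 : form α.1 β.1 = -2
    · rw [bracket_root_opp k α.2 β.2 h2, bracket_root_opp k β.2 α.2 (by omega)]
      have h0 := (add_eq_zero_iff α β).2 h2
      rw [eq_neg_of_add_eq_zero_left h0, coroot_neg]
    · by_cases h1 : form α.1 β.1 = -1
      · rw [bracket_root_add k α.2 β.2 h2, bracket_root_add k β.2 α.2 (by omega),
          add_comm β.1 α.1, ← neg_smul]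
        congr 1
        have := sign_mul_swap α.1 β.1
        rw [h1] at this
        have h3 := sign_mul_self α.1 β.1
        have : sign α.1 β.1 = - sign β.1 α.1 := by
          have h4 : ((-1 : ℤ).negOnePow : ℤ) = -1 := by decide
          rw [h4] at this
          calc sign α.1 β.1 = - (sign α.1 β.1 * -1) := by ring
            _ = -(sign α.1 β.1 * sign α.1 β.1 * sign β.1 α.1) := by rw [← this]; ring
            _ = _ := by rw [h3]; ring
        rw [this]; push_cast; rfl
      · rw [bracket_root_zero k α.2 β.2 h2 h1,
          bracket_root_zero k β.2 α.2 (by omega) (by omega), neg_zero]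

theorem bracket_swap (x y : E8 k) : bracket k x y = -bracket k y x := by
  have : bracket k = -(bracket k).flip := by
    refine (basis k).ext fun i => (basis k).ext fun j => ?_
    simp [bracket_basis, bracketBasis_swap k i j]
  exact congrArg (fun f => f x y) this

theorem basis_induction {p : E8 k → Prop} (h0 : p 0) (ha : ∀ x y, p x → p y → p (x + y))
    (hs : ∀ (c : k) x, p x → p (c • x)) (hb : ∀ i, p (basis k i)) (x : E8 k) : p x := by
  refine Submodule.span_induction (p := fun y _ => p y) ?_ h0 (fun x y _ _ => ha x y)
    (fun c x _ => hs c x) ((basis k).mem_span x)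
  rintro _ ⟨i, rfl⟩
  exact hb i

theorem bracket_self (x : E8 k) : bracket k x x = 0 := by
  induction x using basis_induction with
  | h0 => simp
  | ha f g hf hg =>
    simp only [map_add, LinearMap.add_apply, hf, hg, bracket_swap k f g]
    simp
  | hs c x hx => simp [hx]
  | hb i => rw [bracket_basis, bracketBasis_self]

section Jacobi

variable {u v w : Fin 8 → ℤ}

theorem form_bounds (hu : form u u = 2) (hv : form v v = 2) :
    -2 ≤ form u v ∧ form u v ≤ 2 := form_root_bounds ⟨u, hu⟩ ⟨v, hv⟩

theorem add_root (hu : form u u = 2) (hv : form v v = 2) (h : form u v = -1) :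
    form (u + v) (u + v) = 2 := (add_root_iff ⟨u, hu⟩ ⟨v, hv⟩).2 h

theorem eq_neg_of_form (hu : form u u = 2) (hv : form v v = 2) (h : form u v = -2) : v = -u :=
  eq_neg_of_add_eq_zero_right ((add_eq_zero_iff ⟨u, hu⟩ ⟨v, hv⟩).2 h)

theorem sign_swap_odd (h : form u v = -1 ∨ form u v = 1) : sign v u = -sign u v := by
  have h1 := sign_mul_swap u v
  have h2 : ((form u v).negOnePow : ℤ) = -1 := by rcases h with h | h <;> rw [h] <;> decide
  have h3 := sign_mul_self u v
  calc sign v u = (sign u v * sign u v) * sign v u := by rw [h3, one_mul]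
    _ = sign u v * (sign u v * sign v u) := by ring
    _ = _ := by rw [h1, h2]; ring

theorem sign_swap_even (h : form u v = 0) : sign v u = sign u v := by
  have h1 := sign_mul_swap u v
  have h2 : ((form u v).negOnePow : ℤ) = 1 := by rw [h]; decide
  have h3 := sign_mul_self u v
  calc sign v u = (sign u v * sign u v) * sign v u := by rw [h3, one_mul]
    _ = sign u v * (sign u v * sign v u) := by ring
    _ = _ := by rw [h1, h2]; ring

/-- The double brackets `[e_u, [e_v, e_w]]`, case by case. -/
theorem right_opp (hv : form v v = 2) (hw : form w w = 2) (h : form v w = -2) :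
    bracket k (rootVector k u) (bracket k (rootVector k v) (rootVector k w)) =
      (form v u : k) • rootVector k u := by
  rw [bracket_root_opp k hv hw h, map_neg, bracket_root_coroot, neg_neg]

theorem right_add (hu : form u u = 2) (hv : form v v = 2) (hw : form w w = 2)
    (h : form v w = -1) (h' : form u v + form u w = -1) :
    bracket k (rootVector k u) (bracket k (rootVector k v) (rootVector k w)) =
      ((sign v w * (sign u v * sign u w) : ℤ) : k) • rootVector k (u + v + w) := by
  rw [bracket_root_add k hv hw (by omega), map_smul,
    bracket_root_add k hu (add_root hv hw h) (by rw [form_add_right]; omega), smul_smul,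
    sign_add_right, add_assoc]
  simp only [Int.cast_mul]

theorem right_coroot (hu : form u u = 2) (hv : form v v = 2) (hw : form w w = 2)
    (h : form v w = -1) (h' : form u v + form u w = -2) :
    bracket k (rootVector k u) (bracket k (rootVector k v) (rootVector k w)) =
      -((sign v w : ℤ) : k) • coroot k u := by
  rw [bracket_root_add k hv hw (by omega), map_smul,
    bracket_root_opp k hu (add_root hv hw h) (by rw [form_add_right]; omega), smul_neg, neg_smul]

theorem right_zero (hu : form u u = 2) (hv : form v v = 2) (hw : form w w = 2)
    (h : 0 ≤ form v w ∨ form v w = -1 ∧ 0 ≤ form u v + form u w) :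
    bracket k (rootVector k u) (bracket k (rootVector k v) (rootVector k w)) = 0 := by
  rcases h with h | ⟨h, h'⟩
  · rw [bracket_root_zero k hv hw (by omega) (by omega), map_zero]
  · rw [bracket_root_add k hv hw (by omega), map_smul,
      bracket_root_zero k hu (add_root hv hw h) (by rw [form_add_right]; omega)
        (by rw [form_add_right]; omega), smul_zero]

/-- The double brackets `[[e_u, e_v], e_w]`, case by case. -/
theorem left_opp (hu : form u u = 2) (hv : form v v = 2) (h : form u v = -2) :
    bracket k (bracket k (rootVector k u) (rootVector k v)) (rootVector k w) =
      -((form u w : k) • rootVector k w) := by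
  rw [bracket_root_opp k hu hv h, map_neg, LinearMap.neg_apply, bracket_coroot_root]

theorem left_add (hu : form u u = 2) (hv : form v v = 2) (hw : form w w = 2)
    (h : form u v = -1) (h' : form u w + form v w = -1) :
    bracket k (bracket k (rootVector k u) (rootVector k v)) (rootVector k w) =
      ((sign u v * (sign u w * sign v w) : ℤ) : k) • rootVector k (u + v + w) := by
  rw [bracket_root_add k hu hv (by omega), map_smul, LinearMap.smul_apply,
    bracket_root_add k (add_root hu hv h) hw (by rw [form_add_left]; omega), smul_smul,
    sign_add_left]
  simp only [Int.cast_mul]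

theorem left_coroot (hu : form u u = 2) (hv : form v v = 2) (hw : form w w = 2)
    (h : form u v = -1) (h' : form u w + form v w = -2) :
    bracket k (bracket k (rootVector k u) (rootVector k v)) (rootVector k w) =
      -((sign u v : ℤ) : k) • coroot k (u + v) := by
  rw [bracket_root_add k hu hv (by omega), map_smul, LinearMap.smul_apply,
    bracket_root_opp k (add_root hu hv h) hw (by rw [form_add_left]; omega), smul_neg, neg_smul]

theorem left_zero (hu : form u u = 2) (hv : form v v = 2) (hw : form w w = 2)
    (h : 0 ≤ form u v ∨ form u v = -1 ∧ 0 ≤ form u w + form v w) :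
    bracket k (bracket k (rootVector k u) (rootVector k v)) (rootVector k w) = 0 := by
  rcases h with h | ⟨h, h'⟩
  · rw [bracket_root_zero k hu hv (by omega) (by omega), map_zero, LinearMap.zero_apply]
  · rw [bracket_root_add k hu hv (by omega), map_smul, LinearMap.smul_apply,
      bracket_root_zero k (add_root hu hv h) hw (by rw [form_add_left]; omega)
        (by rw [form_add_left]; omega), smul_zero]

/-- The Jacobi identity for `e_u, e_v, e_w`. -/
def JacobiAt (u v w : Fin 8 → ℤ) : Prop :=
  bracket k (rootVector k u) (bracket k (rootVector k v) (rootVector k w)) =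
    bracket k (bracket k (rootVector k u) (rootVector k v)) (rootVector k w) +
    bracket k (rootVector k v) (bracket k (rootVector k u) (rootVector k w))

theorem form_neg_self (hu : form u u = 2) : form (-u) (-u) = 2 := by
  rw [form_neg_left, form_neg_right, hu]; rfl

theorem sign_self' (hu : form u u = 2) : sign u u = -1 := sign_self ⟨u, hu⟩

theorem jacobi_opp_left (hu : form u u = 2) (hw : form w w = 2) : JacobiAt k u (-u) w := by
  have hv := form_neg_self hu
  have hb := form_bounds hu hw
  have hl := form_neg_left u w
  have hr : form u (-u) = -2 := by rw [form_neg_right, hu]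
  have hs : u + -u + w = w := by abel
  have q := sign_mul_self u w
  unfold JacobiAt
  rw [left_opp k hu hv hr]
  obtain hc | hc | hc | hc | hc : form u w = -2 ∨ form u w = -1 ∨ form u w = 0 ∨
      form u w = 1 ∨ form u w = 2 := by omega
  · rw [right_zero k hu hv hw (by omega), right_opp k hu hw hc, hr, hc, eq_neg_of_form hu hw hc]
    simp
  · rw [right_zero k hu hv hw (by omega), right_add k hv hu hw hc (by rw [form_comm, hr]; omega),
      hc, sign_neg_left, sign_neg_left, sign_self' hu, add_comm (-u) u, hs]
    have : sign u w * (-1 * sign u w) = -1 := by linear_combination -q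
    rw [this]; simp
  · rw [right_zero k hu hv hw (by omega), right_zero k hv hu hw (by omega), hc]; simp
  · rw [right_add k hu hv hw (by omega) (by omega), right_zero k hv hu hw (by omega), hc,
      sign_neg_left, sign_neg_right, sign_self' hu, hs]
    have : sign u w * (-1 * sign u w) = -1 := by linear_combination -q
    rw [this]; simp
  · have hw' := eq_neg_of_form hv hw (by omega)
    rw [right_opp k hv hw (by omega), right_zero k hv hu hw (by omega), hc, form_neg_left, hu, hw']
    simp

theorem jacobi_opp_right (hu : form u u = 2) (hv : form v v = 2) (h2 : form u v ≠ -2) :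
    JacobiAt k u v (-v) := by
  have hw := form_neg_self hv
  have hb := form_bounds hu hv
  have hl := form_neg_right u v
  have hc := form_comm v u
  have hr : form v (-v) = -2 := by rw [form_neg_right, hv]
  have hs : u + v + -v = u := by abel
  unfold JacobiAt
  rw [right_opp k hv hw hr]
  obtain ha | ha | ha | ha : form u v = -1 ∨ form u v = 0 ∨ form u v = 1 ∨ form u v = 2 := by
    omega
  · rw [left_add k hu hv hw ha (by omega), right_zero k hv hu hw (by omega), hc, ha, hs,
      sign_neg_right, sign_neg_right, sign_self' hv]
    have : sign u v * (sign u v * -1) = -1 := by linear_combination -(sign_mul_self u v)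
    rw [this]; simp
  · rw [left_zero k hu hv hw (by omega), right_zero k hv hu hw (by omega), hc, ha]; simp
  · rw [left_zero k hu hv hw (by omega), right_add k hv hu hw (by omega) (by omega), hc, ha,
      add_comm v u, hs, sign_neg_right, sign_neg_right, sign_self' hv,
      sign_swap_odd (Or.inr ha)]
    have : sign u v * (-sign u v * -1) = 1 := by linear_combination sign_mul_self u v
    rw [this]; simp
  · have hw' := eq_neg_of_form hu hw (by omega)
    rw [left_zero k hu hv hw (by omega), right_opp k hu hw (by omega), hc, neg_injective hw']
    simp

theorem jacobi_opp_outer (hu : form u u = 2) (hv : form v v = 2) (h2 : form u v ≠ -2)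
    (h2' : form u v ≠ 2) : JacobiAt k u v (-u) := by
  have hw := form_neg_self hu
  have hb := form_bounds hu hv
  have hl := form_neg_right v u
  have hc := form_comm v u
  have hr : form u (-u) = -2 := by rw [form_neg_right, hu]
  have hs : u + v + -u = v := by abel
  have q := sign_mul_self u v
  unfold JacobiAt
  rw [right_opp k hu hw hr]
  obtain ha | ha | ha : form u v = -1 ∨ form u v = 0 ∨ form u v = 1 := by omega
  · rw [right_zero k hu hv hw (by omega), left_add k hu hv hw ha (by omega), ha, hs,
      sign_neg_right, sign_neg_right, sign_self' hu, sign_swap_odd (Or.inl ha)]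
    have : sign u v * (-1 * -sign u v) = 1 := by linear_combination q
    rw [this]; simp
  · rw [right_zero k hu hv hw (by omega), left_zero k hu hv hw (by omega), ha]; simp
  · rw [right_add k hu hv hw (by omega) (by omega), left_zero k hu hv hw (by omega), ha, hs,
      sign_neg_right, sign_neg_right, sign_self' hu, sign_swap_odd (Or.inr ha)]
    have : -sign u v * (sign u v * -1) = 1 := by linear_combination q
    rw [this]; simp

theorem jacobi_generic (hu : form u u = 2) (hv : form v v = 2) (hw : form w w = 2)
    (ha2 : form u v ≠ -2) (hb2 : form v w ≠ -2) (hc2 : form u w ≠ -2) : JacobiAt k u v w := by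
  have bab := form_bounds hu hv
  have bbc := form_bounds hv hw
  have bac := form_bounds hu hw
  have cab := form_comm u v
  have hsum : form (u + v + w) (u + v + w) = 6 + 2 * (form u v + form v w + form u w) := by
    simp only [form_add_left, form_add_right, hu, hv, hw, ← cab, form_comm w v, form_comm w u]
    ring
  have hpos := form_self_nonneg (u + v + w)
  have q := sign_mul_self u v
  unfold JacobiAt
  obtain hS | hS | hS : form u v + form v w + form u w = -3 ∨
      form u v + form v w + form u w = -2 ∨ -1 ≤ form u v + form v w + form u w := by omega
  · have ha : form u v = -1 := by omega
    have hb : form v w = -1 := by omega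
    have hc : form u w = -1 := by omega
    have h0 : u + v + w = 0 := eq_zero_of_form_self (by omega)
    have hw' : w = -(u + v) := eq_neg_of_add_eq_zero_right h0
    rw [right_coroot k hu hv hw hb (by omega), left_coroot k hu hv hw ha (by omega),
      right_coroot k hv hu hw hc (by omega), coroot_add]
    have e1 : sign v w = sign u v := by
      rw [hw', sign_neg_right, sign_add_right, sign_self' hv, sign_swap_odd (Or.inl ha)]; ring
    have e2 : sign u w = -sign u v := by
      rw [hw', sign_neg_right, sign_add_right, sign_self' hu]; ring
    rw [e1, e2]
    push_cast
    module
  · obtain ⟨ha, hb, hc⟩ | ⟨ha, hb, hc⟩ | ⟨ha, hb, hc⟩ :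
        (form u v = 0 ∧ form v w = -1 ∧ form u w = -1) ∨
        (form u v = -1 ∧ form v w = 0 ∧ form u w = -1) ∨
        (form u v = -1 ∧ form v w = -1 ∧ form u w = 0) := by omega
    · rw [right_add k hu hv hw hb (by omega), left_zero k hu hv hw (by omega),
        right_add k hv hu hw hc (by omega), zero_add, sign_swap_even ha, add_comm v u]
      congr 2
      ring
    · rw [right_zero k hu hv hw (by omega), left_add k hu hv hw ha (by omega),
        right_add k hv hu hw hc (by omega), sign_swap_odd (Or.inl ha), add_comm v u,
        ← add_smul, ← Int.cast_add]
      have : sign u v * (sign u w * sign v w) + sign u w * (-sign u v * sign v w) = 0 := by ring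
      rw [this]; simp
    · rw [right_add k hu hv hw hb (by omega), left_add k hu hv hw ha (by omega),
        right_zero k hv hu hw (by omega), add_zero]
      congr 2
      ring
  · rw [right_zero k hu hv hw (by omega), left_zero k hu hv hw (by omega),
      right_zero k hv hu hw (by omega), add_zero]

theorem jacobi_root (α β γ : Root) : JacobiAt k α.1 β.1 γ.1 := by
  obtain ⟨u, hu⟩ := α
  obtain ⟨v, hv⟩ := β
  obtain ⟨w, hw⟩ := γ
  simp only
  by_cases ha : form u v = -2
  · rw [eq_neg_of_form hu hv ha]
    exact jacobi_opp_left k hu hw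
  by_cases hb : form v w = -2
  · rw [eq_neg_of_form hv hw hb]
    exact jacobi_opp_right k hu hv ha
  by_cases hc : form u w = -2
  · have hw' := eq_neg_of_form hu hw hc
    rw [hw']
    refine jacobi_opp_outer k hu hv ha fun h => hb ?_
    rw [hw', form_neg_right, form_comm, h]
  · exact jacobi_generic k hu hv hw ha hb hc

end Jacobi

theorem bracket_h_h (i j : Fin 8) : bracket k (basis k (.inl i)) (basis k (.inl j)) = 0 :=
  bracket_basis k _ _

/-- `hᵢ` acts as a derivation on products of root vectors. -/
theorem jacobi_h_root_root (i : Fin 8) (α β : Root) :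
    bracket k (basis k (.inl i)) (bracket k (rootVector k α.1) (rootVector k β.1)) =
      bracket k (bracket k (basis k (.inl i)) (rootVector k α.1)) (rootVector k β.1) +
      bracket k (rootVector k α.1) (bracket k (basis k (.inl i)) (rootVector k β.1)) := by
  simp only [bracket_h_root, map_smul, LinearMap.smul_apply, ← add_smul]
  by_cases h : form α.1 β.1 = -2
  · rw [bracket_root_opp k α.2 β.2 h, map_neg, bracket_h_coroot,
      eq_neg_of_add_eq_zero_right ((add_eq_zero_iff α β).2 h)]
    simp [Matrix.mulVec_neg]
  · rw [bracket_root_add k α.2 β.2 h, map_smul, bracket_h_root, smul_comm, Matrix.mulVec_add]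
    simp

theorem jacobi_basis (i j l : Index) :
    bracket k (basis k i) (bracket k (basis k j) (basis k l)) =
      bracket k (bracket k (basis k i) (basis k j)) (basis k l) +
      bracket k (basis k j) (bracket k (basis k i) (basis k l)) := by
  rcases i with i | α <;> rcases j with j | β <;> rcases l with l | γ
  · simp [bracket_h_h]
  · simp only [← rootVector_of_root, bracket_h_h, bracket_h_root, map_smul, map_zero,
      LinearMap.zero_apply, zero_add]
    rw [smul_comm]
  · simp only [← rootVector_of_root, bracket_h_h, bracket_h_root, bracket_root_h, map_smul,
      map_zero, map_neg, add_zero, LinearMap.smul_apply, smul_neg]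
    rw [smul_comm]
  · simpa only [← rootVector_of_root] using jacobi_h_root_root k i β γ
  · simp only [← rootVector_of_root, bracket_h_h, bracket_h_root, bracket_root_h, map_smul,
      map_zero, map_neg, LinearMap.smul_apply, LinearMap.neg_apply, smul_neg]
    rw [smul_comm]; simp
  · have h := jacobi_h_root_root k j α γ
    simp only [← rootVector_of_root]
    rw [h, bracket_swap k (basis k (.inl j)) (rootVector k α.1)]
    simp
  · have h := jacobi_h_root_root k l α β
    simp only [← rootVector_of_root]
    rw [bracket_swap k (rootVector k β.1) (basis k (.inl l)),
      bracket_swap k (rootVector k α.1) (basis k (.inl l)),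
      bracket_swap k (bracket k (rootVector k α.1) (rootVector k β.1)) (basis k (.inl l)),
      map_neg, map_neg, h, bracket_swap k (bracket k (basis k (.inl l)) (rootVector k α.1))]
    abel
  · simp only [← rootVector_of_root]
    exact jacobi_root k α β γ

theorem jacobi (x y z : E8 k) :
    bracket k x (bracket k y z) = bracket k (bracket k x y) z + bracket k y (bracket k x z) := by
  induction x using basis_induction with
  | h0 => simp
  | ha x x' hx hx' => simp only [map_add, LinearMap.add_apply, hx, hx']; abel
  | hs c x hx => simp only [map_smul, LinearMap.smul_apply, hx, smul_add]
  | hb i =>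
  induction y using basis_induction with
  | h0 => simp
  | ha x x' hx hx' => simp only [map_add, LinearMap.add_apply, hx, hx']; abel
  | hs c x hx => simp only [map_smul, LinearMap.smul_apply, hx, smul_add]
  | hb j =>
  induction z using basis_induction with
  | h0 => simp
  | ha x x' hx hx' => simp only [map_add, hx, hx']; abel
  | hs c x hx => simp only [map_smul, hx, smul_add]
  | hb l => exact jacobi_basis k i j l

instance : LieRing (E8 k) where
  bracket x y := bracket k x y
  add_lie x y z := by simp
  lie_add x y z := by simp
  lie_self := bracket_self k
  leibniz_lie := jacobi k

instance : LieAlgebra k (E8 k) where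
  lie_smul t x y := map_smul (bracket k x) t y

/-- The action on the Lie algebra of the element `x_α(t)` of the root subgroup of `α`, that is,
`exp (t ad e_α) = 1 + t ad e_α + t² (ad e_α)² / 2` (the higher divided powers of `ad e_α` vanish,
and the characteristic is not `2`). -/
def rootElement (α : Root) (t : k) : Module.End k (E8 k) :=
  1 + t • LieAlgebra.ad k (E8 k) (rootVector k α.1) +
    (t ^ 2 / 2) • LieAlgebra.ad k (E8 k) (rootVector k α.1) ^ 2

/-- The group `G(k)` of type `E₈` in its adjoint representation on `Lie(G)`: for an algebraically
closed field `k` it is generated by the root subgroups. -/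
def adjointGroup : Subgroup (E8 k ≃ₗ[k] E8 k) :=
  Subgroup.closure {φ | ∃ (α : Root) (t : k), (φ : E8 k →ₗ[k] E8 k) = rootElement k α t}

/-- The root vector of the simple root with index `i`. -/
def simpleRootVector (i : Fin 8) : E8 k := rootVector k (Pi.single i 1)

/-- The nilpotent orbit with label `A₂² + A₁`, that is, the `G(k)`-orbit of the regular nilpotent
element `e_{α₁} + e_{α₂} + e_{α₃} + e_{α₅} + e_{α₆}` of the Levi subalgebra of type `A₂² + A₁`
with simple roots `α₁, α₃ | α₅, α₆ | α₂`. -/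
def orbitA2A2A1 : Set (E8 k) :=
  {e | ∃ g ∈ adjointGroup k, e = g (simpleRootVector k 0 + simpleRootVector k 1 +
    simpleRootVector k 2 + simpleRootVector k 4 + simpleRootVector k 5)}

end E8

/-! ## Truncated polynomials and Lie algebras of Cartan type -/

section CartanType

variable (k : Type*) [Field k]

/-- The ideal `(x₁³, x₂³)`. -/
def truncIdeal : Ideal (MvPolynomial (Fin 2) k) :=
  Ideal.span (Set.range fun i => MvPolynomial.X i ^ 3)

/-- The truncated polynomial ring `𝒪(2; 1) = k[x₁, x₂] / (x₁³, x₂³)` (for `k` of characteristic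
`3`). -/
abbrev TruncPoly : Type _ := MvPolynomial (Fin 2) k ⧸ truncIdeal k

/-- The Witt algebra `W(2; 1) = Der 𝒪(2; 1)`, free over `𝒪(2; 1)` with basis `∂₁, ∂₂`. -/
abbrev Witt : Type _ := Derivation k (TruncPoly k) (TruncPoly k)

namespace TruncPoly

/-- The generators `x₁, x₂`. -/
def x (i : Fin 2) : TruncPoly k := Ideal.Quotient.mk (truncIdeal k) (MvPolynomial.X i)

variable [CharP k 3]

theorem pderiv_mem (i : Fin 2) {f : MvPolynomial (Fin 2) k} (hf : f ∈ truncIdeal k) :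
    MvPolynomial.pderiv i f ∈ truncIdeal k := by
  have h3 : (3 : MvPolynomial (Fin 2) k) = 0 := by
    have := CharP.cast_eq_zero (MvPolynomial (Fin 2) k) 3
    exact_mod_cast this
  refine Submodule.span_induction ?_ ?_ ?_ ?_ hf
  · rintro _ ⟨j, rfl⟩
    have : MvPolynomial.pderiv i ((MvPolynomial.X j : MvPolynomial (Fin 2) k) ^ 3) = 0 := by
      rw [Derivation.leibniz_pow]
      simp [nsmul_eq_mul, h3]
    simp [this]
  · simp
  · intro f g _ _ hf hg
    rw [map_add]
    exact add_mem hf hg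
  · intro a f hfm hf
    rw [smul_eq_mul, Derivation.leibniz]
    exact add_mem (Ideal.mul_mem_left _ _ hf) (Ideal.mul_mem_right _ _ hfm)

/-- The partial derivative `∂ᵢ` of `𝒪(2; 1)`. -/
def partialDeriv (i : Fin 2) : Witt k :=
  Derivation.mk'
    (Submodule.liftQ ((truncIdeal k).restrictScalars k)
      ((Ideal.Quotient.mkₐ k (truncIdeal k)).toLinearMap ∘ₗ
        (MvPolynomial.pderiv i).toLinearMap)
      (fun f hf => by
        simpa [Ideal.Quotient.eq_zero_iff_mem] using pderiv_mem k i hf))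
    (by
      intro a b
      obtain ⟨a, rfl⟩ := Ideal.Quotient.mk_surjective a
      obtain ⟨b, rfl⟩ := Ideal.Quotient.mk_surjective b
      change Ideal.Quotient.mk _ (MvPolynomial.pderiv i (a * b)) =
        Ideal.Quotient.mk _ a • Ideal.Quotient.mk _ (MvPolynomial.pderiv i b) +
        Ideal.Quotient.mk _ b • Ideal.Quotient.mk _ (MvPolynomial.pderiv i a)
      simp [Derivation.leibniz])

theorem partialDeriv_mk (i : Fin 2) (f : MvPolynomial (Fin 2) k) :
    partialDeriv k i (Ideal.Quotient.mk (truncIdeal k) f) =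
      Ideal.Quotient.mk (truncIdeal k) (MvPolynomial.pderiv i f) := rfl

theorem partialDeriv_x (i j : Fin 2) : partialDeriv k i (x k j) = if i = j then 1 else 0 := by
  rw [x, partialDeriv_mk, MvPolynomial.pderiv_X]
  by_cases h : i = j
  · subst h; simp
  · simp [h, Ne.symm h]

end TruncPoly

namespace Witt

open TruncPoly

theorem ext_x {D E : Witt k} (h : ∀ i, D (x k i) = E (x k i)) : D = E := by
  ext f
  obtain ⟨f, rfl⟩ := Ideal.Quotient.mk_surjective f
  induction f using MvPolynomial.induction_on with
  | C a =>
    have h1 : ∀ F : Witt k, F (Ideal.Quotient.mk (truncIdeal k) (MvPolynomial.C a)) = 0 :=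
      fun F => F.map_algebraMap a
    rw [h1, h1]
  | add f g hf hg => simp only [map_add, hf, hg]
  | mul_X f i hf =>
    have := h i
    simp only [x] at this
    simp only [map_mul, Derivation.leibniz, hf, this]

variable [CharP k 3]

/-- Every element of the Witt algebra is `D = ∑ fᵢ ∂ᵢ` with `fᵢ = D xᵢ`. -/
theorem eq_sum (D : Witt k) : D = ∑ i, D (x k i) • partialDeriv k i := by
  refine ext_x k fun j => ?_
  fin_cases j <;> simp [Fin.sum_univ_two, partialDeriv_x]

theorem apply_eq_sum (D : Witt k) (f : TruncPoly k) :
    D f = ∑ i, D (x k i) * partialDeriv k i f := by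
  conv_lhs => rw [eq_sum k D]
  simp [Fin.sum_univ_two]

theorem partialDeriv_comm (i j : Fin 2) (f : TruncPoly k) :
    partialDeriv k i (partialDeriv k j f) = partialDeriv k j (partialDeriv k i f) := by
  have : ⁅partialDeriv k i, partialDeriv k j⁆ = 0 := by
    refine ext_x k fun l => ?_
    rw [Derivation.commutator_apply]
    simp only [partialDeriv_x]
    split_ifs <;> simp
  have h := congrArg (fun D : Witt k => D f) this
  simp only [Derivation.commutator_apply, Derivation.coe_zero, Pi.zero_apply] at h
  exact sub_eq_zero.1 h

/-- The divergence `div (∑ fᵢ ∂ᵢ) = ∑ ∂ᵢ(fᵢ)`. -/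
def divergence : Witt k →ₗ[k] TruncPoly k where
  toFun D := ∑ i, partialDeriv k i (D (x k i))
  map_add' D E := by simp [Finset.sum_add_distrib]
  map_smul' c D := by simp

theorem divergence_apply (D : Witt k) :
    divergence k D = ∑ i, partialDeriv k i (D (x k i)) := rfl

theorem divergence_lie (D E : Witt k) :
    divergence k ⁅D, E⁆ = D (divergence k E) - E (divergence k D) := by
  have hc := partialDeriv_comm k 0 1
  simp only [divergence_apply, Fin.sum_univ_two, Derivation.commutator_apply]
  simp only [apply_eq_sum k D (E _), apply_eq_sum k E (D _), apply_eq_sum k D (_ + _),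
    apply_eq_sum k E (_ + _), Fin.sum_univ_two, map_add, map_sub, Derivation.leibniz,
    smul_eq_mul, hc]
  ring

/-- The degree derivation `𝒟 = x₁ ∂₁ + x₂ ∂₂`. -/
def euler : Witt k := ∑ i, x k i • partialDeriv k i

theorem divergence_euler : divergence k (euler k) = 2 := by
  simp [divergence_apply, euler, Fin.sum_univ_two, partialDeriv_x, one_add_one_eq_two]

/-- The Hamiltonian Lie algebra `H(2; 1)`: the derivations `f₁ ∂₁ + f₂ ∂₂` of `𝒪(2; 1)` with
`∂₁(f₁) = -∂₂(f₂)`, that is, those annihilating the form `dx₁ ∧ dx₂`. -/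
def hamiltonian : LieSubalgebra k (Witt k) where
  toSubmodule := LinearMap.ker (divergence k)
  lie_mem' {D E} hD hE := by
    have hD' : divergence k D = 0 := hD
    have hE' : divergence k E = 0 := hE
    change divergence k ⁅D, E⁆ = 0
    rw [divergence_lie, hD', hE']
    simp

theorem mem_hamiltonian (D : Witt k) : D ∈ hamiltonian k ↔
    partialDeriv k 0 (D (x k 0)) = -partialDeriv k 1 (D (x k 1)) := by
  rw [← add_eq_zero_iff_eq_neg, ← Fin.sum_univ_two (fun i => partialDeriv k i (D (x k i)))]
  rfl

/-- The Lie algebra `CH(2; 1) = H(2; 1) ⊕ k 𝒟`. -/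
def conformalHamiltonian : LieSubalgebra k (Witt k) where
  toSubmodule := (hamiltonian k).toSubmodule ⊔ Submodule.span k {euler k}
  lie_mem' {D E} hD hE := by
    obtain ⟨D, hD', _, hc, rfl⟩ := Submodule.mem_sup.1 hD
    obtain ⟨E, hE', _, hd, rfl⟩ := Submodule.mem_sup.1 hE
    obtain ⟨c, rfl⟩ := Submodule.mem_span_singleton.1 hc
    obtain ⟨d, rfl⟩ := Submodule.mem_span_singleton.1 hd
    refine Submodule.mem_sup_left ?_
    replace hD' : divergence k D = 0 := hD'
    replace hE' : divergence k E = 0 := hE'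
    change divergence k _ = 0
    have h2 : ∀ F : Witt k, F 2 = 0 := fun F => by exact_mod_cast F.map_natCast 2
    rw [divergence_lie]
    simp [hD', hE', divergence_euler, h2]

end Witt

end CartanType

/-! ## The Lie algebra `𝔭𝔰𝔩(3)` -/

/-- `𝔭𝔰𝔩(3)`, the quotient of `𝔰𝔩(3)` by its centre. -/
abbrev PSL3 (k : Type*) [Field k] : Type _ :=
  LieAlgebra.SpecialLinear.sl (Fin 3) k ⧸
    LieAlgebra.center k (LieAlgebra.SpecialLinear.sl (Fin 3) k)

/-! ## Subalgebras of a Lie algebra -/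

namespace LieSubalgebra

variable {k : Type*} [Field k] {L : Type*} [LieRing L] [LieAlgebra k L]

variable (k) in
/-- The centraliser `L_e` of an element `e`. -/
def elementCentralizer (e : L) : LieSubalgebra k L where
  carrier := {x | ⁅x, e⁆ = 0}
  zero_mem' := by simp
  add_mem' {x y} hx hy := by
    simp only [Set.mem_ofPred_eq] at *
    simp [hx, hy]
  smul_mem' c x hx := by
    simp only [Set.mem_ofPred_eq] at *
    simp [hx]
  lie_mem' {x y} hx hy := by
    change ⁅x, e⁆ = 0 at hx
    change ⁅y, e⁆ = 0 at hy
    change ⁅⁅x, y⁆, e⁆ = 0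
    rw [lie_lie, hx, hy]
    simp

variable (k) in
/-- The normaliser `𝔫_e = {x | [x, e] ∈ k e}` of an element `e`. -/
def elementNormalizer (e : L) : LieSubalgebra k L where
  carrier := {x | ∃ c : k, ⁅x, e⁆ = c • e}
  zero_mem' := ⟨0, by simp⟩
  add_mem' {x y} hx hy := by
    obtain ⟨c, hc⟩ := hx
    obtain ⟨d, hd⟩ := hy
    exact ⟨c + d, by rw [add_lie, hc, hd, add_smul]⟩
  smul_mem' a x hx := by
    obtain ⟨c, hc⟩ := hx
    exact ⟨a * c, by rw [smul_lie, hc, mul_smul]⟩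
  lie_mem' {x y} hx hy := by
    obtain ⟨c, hc⟩ := hx
    obtain ⟨d, hd⟩ := hy
    exact ⟨0, by rw [lie_lie, hc, hd, lie_smul, lie_smul, hc, hd, smul_comm]; simp⟩

/-- The radical `rad(K)` of a subalgebra `K` of `L`, as a subalgebra of `L`. -/
def rad (K : LieSubalgebra k L) : LieSubalgebra k L :=
  (LieAlgebra.radical k K).toLieSubalgebra.map K.incl

/-- `J` is an ideal of the subalgebra `K`. -/
def IsIdealIn (J K : LieSubalgebra k L) : Prop :=
  J ≤ K ∧ ∀ x ∈ K, ∀ y ∈ J, ⁅x, y⁆ ∈ J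

/-- An ideal `J` of `K`, as a `LieIdeal`. -/
def IsIdealIn.toLieIdeal {J K : LieSubalgebra k L} (h : IsIdealIn J K) : LieIdeal k K where
  toSubmodule := J.toSubmodule.comap K.toSubmodule.subtype
  lie_mem {x y} hy := h.2 x x.2 y hy

/-- The quotient Lie algebra `K / J` of a subalgebra `K` by an ideal `J` of `K`. -/
abbrev IsIdealIn.Quotient {J K : LieSubalgebra k L} (h : IsIdealIn J K) : Type _ :=
  K ⧸ h.toLieIdeal

/-- The projection `K → K / J`. -/
def IsIdealIn.mk {J K : LieSubalgebra k L} (h : IsIdealIn J K) (x : K) : h.Quotient :=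
  LieSubmodule.Quotient.mk x

end LieSubalgebra

end

/-! Every element of the orbit is the image of the standard representative under `adjointGroup`,
which acts by automorphisms; all constructions are carried along such an automorphism `φ`, so only
one nilpotent element has to be understood. For it there is a basis `vec 0, …, vec 247` of short
combinations of Chevalley basis vectors that displays the structure of the algebra. Let m < 9 stand
for the monomial x₁^(m/3) x₂^(m%3). The indices 0–7 span A, one vector for each monomial except
x₁²x₂²; 8 + 9a + m is U(a, m), the monomial m times the a-th basis vector of 𝔭𝔰𝔩(3); 71 + a is B_a,
lifting the quotient 𝔭𝔰𝔩(3) of J/A; 78 + 9i + m lifts the monomial m times the i-th partial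
derivative, i = 0, 1. Then come Y(a, m) = 96 + 9a + m and Z(a, m) = 159 + 9a + m, and finally 18 + 8
vectors dual, under the invariant form, to the lift of W(2; 1) and to A. `low φ n` is the span of
the first n vectors, and A, J, 𝔴 are `low φ 8`, `low φ 78`, `low φ 96`.

The key is `lie_abel`: `low φ 96` acts on A as W(2; 1) acts on volume forms, D sending f to D f +
div(D) f on the f without top term, J acts by zero, and e is the form 1. Hence [x, e] = div D
(`lie_nilpotent`). The invariant form shows that the centraliser of e lies in `low φ 96`
(`centralizer_le`), and since div maps W(2; 1) onto the functions without top term, `low φ 96`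
consists of all x with [x, e] ∈ A (`mem_low_iff_lie_nilpotent`). It follows formally that this space
is a subalgebra, that it is the normaliser of A, and, as W(2; 1) acts faithfully on A, that it maps
homomorphically onto W(2; 1) with kernel J. The centraliser and normaliser of e are the preimages of
the derivations of zero and of constant divergence, that is, of H(2; 1) and CH(2; 1).

Radicals and maximality follow one pattern. If a subspace V is stable under an algebra, so is its
orthogonal space. If the latter contained one well chosen basis vector, it would contain so many
that V would be small. Otherwise some element of V has a nonzero coordinate at a vector with
monomial x₁²x₂²; the operator (ad ∂₁)²(ad ∂₂)² followed by weight projections turns it into a single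
basis vector, and this generates the rest. For ideals this yields all U(a, m) modulo A, a perfect
algebra, so solvable ideals lie in A (`mem_rad_iff`); for subalgebras strictly above 𝔴 it yields
everything (`eq_top_of_normalizer_lt`).

The lift of W(2; 1) closes under brackets modulo A (`ofWitt_lie`), which splits 𝔴/A over J/A. For
the failure of splitting of J/A, divide further by the U(a, m) with m > 0: a 14-dimensional algebra
remains, and a section would solve a system of quadratic equations in 49 unknowns. `certificate`
expresses 1 as a combination of these equations.

The finite verifications run in the kernel on lists of natural numbers modulo 3, whose meaning is
fixed by `bracket_sound`, `eval_eq_zero` and `form_sound`. -/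

noncomputable section

/-! ### Arithmetic in E₈ modulo 3 on coded roots, and the data of the adapted basis. -/

namespace E8

/-- Generators of `E8 k`: `h n` is the coroot of the lattice vector whose coordinates are the eight
decimal digits of `n`, and `p n`, `m n` are the root vectors of this lattice vector and of its
negative. -/
inductive Gen : Type
  | h (n : ℕ)
  | p (n : ℕ)
  | m (n : ℕ)

/-- Formal linear combinations of generators. -/
abbrev Vec : Type := List (ℕ × Gen)

/-- The `i`-th of eight decimal digits. -/
def digit (n i : ℕ) : ℕ := n / 10 ^ (7 - i) % 10

/-- The sum of products of equal digits. -/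
def dotDiag (a b : ℕ) : ℕ :=
  digit a 0 * digit b 0 + digit a 1 * digit b 1 + digit a 2 * digit b 2 + digit a 3 * digit b 3 +
    digit a 4 * digit b 4 + digit a 5 * digit b 5 + digit a 6 * digit b 6 + digit a 7 * digit b 7

/-- The sum of products of digits over the directed edges of the Dynkin diagram. -/
def dotEdge (a b : ℕ) : ℕ :=
  digit a 2 * digit b 0 + digit a 3 * digit b 1 + digit a 3 * digit b 2 + digit a 4 * digit b 3 +
    digit a 5 * digit b 4 + digit a 6 * digit b 5 + digit a 7 * digit b 6

/-- The form modulo `3`. -/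
def formMod (a b : ℕ) : ℕ := 2 * (dotDiag a b + dotEdge a b + dotEdge b a)

/-- The sign modulo `3`. -/
def signMod (a b : ℕ) : ℕ := 1 + (dotDiag a b + dotEdge a b) % 2

/-- The root vector of a difference. -/
def genSub (a b : ℕ) : Gen := bif Nat.ble b a then .p (a - b) else .m (b - a)

/-- The bracket of two generators. -/
def genBracket : Gen → Gen → Vec
  | .h _, .h _ => []
  | .h a, .p b => [(formMod a b, .p b)]
  | .h a, .m b => [(2 * formMod a b, .m b)]
  | .p a, .h b => [(2 * formMod b a, .p a)]
  | .m a, .h b => [(formMod b a, .m a)]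
  -- The test says that the form is -1; the value -2 cannot occur for two positive roots.
  | .p a, .p b =>
    bif Nat.beq (2 * dotDiag a b + 1) (dotEdge a b + dotEdge b a) then
      [(signMod a b, .p (a + b))] else []
  | .m a, .m b =>
    bif Nat.beq (2 * dotDiag a b + 1) (dotEdge a b + dotEdge b a) then
      [(signMod a b, .m (a + b))] else []
  | .p a, .m b =>
    -- The coefficient 2 is the sign of [e_α, e_{-α}] = -α^∨; since 2 = -1 in characteristic 3, no
    -- negative coefficients are needed.
    bif Nat.beq a b then [(2, .h a)] else
    bif Nat.beq (2 * dotDiag a b) (dotEdge a b + dotEdge b a + 1) then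
      [(signMod a b, genSub a b)] else []
  | .m a, .p b =>
    bif Nat.beq a b then [(1, .h a)] else
    bif Nat.beq (2 * dotDiag a b) (dotEdge a b + dotEdge b a + 1) then
      [(signMod a b, genSub b a)] else []

/-- The generator lies in the algebra: the root vectors belong to roots. -/
def Gen.valid : Gen → Bool
  | .h _ => true
  | .p a | .m a => Nat.beq (2 * dotDiag a a) (2 * dotEdge a a + 2) && Nat.ble a 99999999

namespace Vec

/-- The sum of the values of a function on the terms. -/
def sumMap (f : ℕ × Gen → ℕ) (u : Vec) : ℕ :=
  List.rec (motive := fun _ => ℕ) 0 (fun t _ n => Nat.add (f t) n) u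

/-- Scalar multiplication. -/
def smul (c : ℕ) (u : Vec) : Vec := u.map fun t => (c * t.1, t.2)

/-- The bracket. -/
def bracket (u v : Vec) : Vec :=
  u.flatMap fun s => v.flatMap fun t => smul (s.1 * t.1) (genBracket s.2 t.2)

/-- Equality of root vectors. -/
def sameRoot : Gen → Gen → Bool
  | .p a, .p b => Nat.beq a b
  | .m a, .m b => Nat.beq a b
  | _, _ => false

/-- The coefficient of a root vector. -/
def coeff (g : Gen) (u : Vec) : ℕ := sumMap (fun t => bif sameRoot t.2 g then t.1 else 0) u

/-- The contribution of a generator to the coefficient of a simple coroot. -/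
def cartanDigit (i : ℕ) : Gen → ℕ
  | .h a => digit a i
  | _ => 0

/-- The coefficient of a simple coroot. -/
def cartanCoeff (i : ℕ) (u : Vec) : ℕ := sumMap (fun t => t.1 * cartanDigit i t.2) u

/-- The vanishing of a vector in characteristic `3`. -/
def isZero (u : Vec) : Bool :=
  (u.all fun t => Nat.beq (coeff t.2 u % 3) 0) &&
    (List.range 8).all fun i => Nat.beq (cartanCoeff i u % 3) 0

/-- The invariant form on generators. -/
def genForm : Gen → Gen → ℕ
  | .h a, .h b => formMod a b
  | .p a, .m b => bif Nat.beq a b then 2 else 0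
  | .m a, .p b => bif Nat.beq a b then 2 else 0
  | _, _ => 0

/-- The invariant form modulo `3`. -/
def form (u v : Vec) : ℕ :=
  sumMap (fun s => sumMap (fun t => s.1 * t.1 * genForm s.2 t.2) v) u % 3

end Vec

/-- The positive roots. -/
def positiveRoots : List ℕ :=
  [1, 10, 100, 1000, 10000, 100000, 1000000, 10000000, 11, 110, 1100, 11000, 110000, 1010000,
    10100000, 111, 1110, 11100, 111000, 1011000, 1110000, 10110000, 1111, 11110, 111100, 1011100,
    1111000, 10111000, 11110000, 11111, 111110, 1011110, 1111100, 1121000, 10111100, 11111000,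
    111111, 1011111, 1111110, 1121100, 10111110, 11111100, 11121000, 1111111, 1121110, 1122100,
    10111111, 11111110, 11121100, 11221000, 1121111, 1122110, 11111111, 11121110, 11122100,
    11221100, 1122111, 1122210, 11121111, 11122110, 11221110, 11222100, 1122211, 11122111,
    11122210, 11221111, 11222110, 11232100, 1122221, 11122211, 11222111, 11222210, 11232110,
    12232100, 11122221, 11222211, 11232111, 11232210, 12232110, 11222221, 11232211, 11233210,
    12232111, 12232210, 11232221, 11233211, 12232211, 12233210, 11233221, 12232221, 12233211,
    12243210, 11233321, 12233221, 12243211, 12343210, 12233321, 12243221, 12343211, 22343210,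
    12243321, 12343221, 22343211, 12244321, 12343321, 22343221, 12344321, 22343321, 12354321,
    22344321, 13354321, 22354321, 22454321, 23354321, 23454321, 23464321, 23465321, 23465421,
    23465431, 23465432]

/-- The adapted basis. -/
def table : List Vec :=
 [[(1, .p 100), (1, .p 1000), (1, .p 100000), (1, .p 1000000), (1, .p 10000000)],
   [(2, .p 1111100), (2, .p 10111100), (1, .p 11111000)], [(1, .p 11222100)],
   [(1, .m 11000), (2, .m 110000), (2, .m 1010000)], [(1, .p 1100), (2, .p 10100000)],
   [(2, .p 11111100)], [(1, .m 1121000)], [(2, .m 10000)],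
   [(1, .p 1122210), (1, .p 11122110), (1, .p 11221110)], [(1, .p 11233210), (2, .p 12232210)],
   [(1, .p 22343210)], [(2, .p 1111110), (1, .p 10111110)], [(2, .p 11122210), (2, .p 11222110)],
   [(2, .p 12233210)], [(2, .p 1110)], [(2, .p 11111110)], [(1, .p 11222210)],
   [(1, .p 1122211), (1, .p 11122111), (1, .p 11221111)], [(1, .p 11233211), (2, .p 12232211)],
   [(1, .p 22343211)], [(2, .p 1111111), (1, .p 10111111)], [(2, .p 11122211), (2, .p 11222111)],
   [(2, .p 12233211)], [(2, .p 1111)], [(2, .p 11111111)], [(1, .p 11222211)],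
   [(2, .m 12244321), (1, .m 12343321), (2, .m 22343221)], [(1, .m 11233221), (2, .m 12232221)],
   [(2, .m 1122221)], [(2, .m 13354321), (2, .m 22354321)], [(2, .m 12243321), (1, .m 12343221)],
   [(2, .m 11232221)], [(2, .m 23464321)], [(2, .m 12354321)], [(2, .m 12243221)],
   [(2, .m 1122210), (2, .m 11122110), (2, .m 11221110)], [(2, .m 111110), (1, .m 1011110)],
   [(1, .m 10)], [(2, .m 11232210), (1, .m 12232110)], [(1, .m 1122110), (1, .m 11121110)],
   [(2, .m 11110)], [(2, .m 12243210)], [(2, .m 11232110)], [(2, .m 1121110)],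
   [(2, .m 1122211), (2, .m 11122111), (2, .m 11221111)], [(2, .m 111111), (1, .m 1011111)],
   [(1, .m 11)], [(2, .m 11232211), (1, .m 12232111)], [(1, .m 1122111), (1, .m 11121111)],
   [(2, .m 11111)], [(2, .m 12243211)], [(2, .m 11232111)], [(2, .m 1121111)],
   [(1, .p 12244321), (2, .p 12343321), (1, .p 22343221)], [(1, .p 22454321), (1, .p 23354321)],
   [(1, .p 23465421)], [(1, .p 11233321), (2, .p 12233221)], [(2, .p 12344321), (1, .p 22343321)],
   [(1, .p 23454321)], [(1, .p 11222221)], [(1, .p 12233321)], [(1, .p 22344321)],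
   [(1, .h 20102100)], [(2, .p 111100), (1, .p 1011100), (2, .p 10111000), (2, .p 11110000)],
   [(2, .p 11122100), (2, .p 11221100)],
   [(2, .m 11100), (2, .m 1011000), (2, .m 1110000), (1, .m 10110000)],
   [(1, .p 100), (1, .p 1000), (2, .p 100000), (2, .p 10000000)],
   [(2, .p 1111100), (2, .p 11111000)], [(2, .m 1121100), (2, .m 11121000)],
   [(2, .m 11000), (2, .m 110000)], [(2, .p 1100), (2, .p 10100000)], [(1, .m 1)],
   [(1, .p 23465432)], [(1, .m 23465431)], [(2, .p 1)], [(2, .m 23465432)], [(2, .p 23465431)],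
   [(1, .h 20102102)],
   [(1, .p 11100), (1, .p 111000), (1, .p 1011000), (2, .p 1110000), (1, .p 10110000)],
   [(1, .p 1122100), (1, .p 11121100), (1, .p 11221000)], [(2, .p 12232100)], [(1, .h 2202000)],
   [(2, .p 111100), (2, .p 1011100), (1, .p 10111000), (2, .p 11110000)],
   [(1, .p 11122100), (2, .p 11221100)], [(1, .m 111000), (1, .m 1011000), (2, .m 1110000)],
   [(1, .p 100), (1, .p 10000000)], [(2, .p 10111100)],
   [(1, .m 111100), (2, .m 1011100), (2, .m 1111000), (2, .m 10111000), (2, .m 11110000)],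
   [(1, .h 22000200)], [(1, .p 111100), (2, .p 1111000), (2, .p 10111000)],
   [(2, .m 1122100), (2, .m 11121100), (2, .m 11221000)],
   [(1, .m 11100), (2, .m 1011000), (1, .m 1110000), (1, .m 10110000)],
   [(2, .p 1000), (2, .p 100000)], [(1, .m 11232100)], [(1, .m 1121100), (2, .m 11121000)],
   [(1, .m 1010000)], [(1, .p 1122110), (2, .p 11121110)], [(1, .p 11232210), (1, .p 12232110)],
   [(1, .p 12343210)], [(2, .p 111110), (2, .p 1011110)], [(1, .p 1122210), (2, .p 11221110)],
   [(2, .p 12232210)], [(1, .p 110)], [(1, .p 1111110)], [(1, .p 11122210), (2, .p 11222110)],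
   [(1, .p 1122111), (2, .p 11121111)], [(1, .p 11232211), (1, .p 12232111)], [(1, .p 12343211)],
   [(2, .p 111111), (2, .p 1011111)], [(1, .p 1122211), (2, .p 11221111)], [(2, .p 12232211)],
   [(1, .p 111)], [(1, .p 1111111)], [(1, .p 11122211), (2, .p 11222111)],
   [(1, .m 12344321), (1, .m 22343321)], [(1, .m 11233321), (1, .m 12233221)], [(2, .m 11122221)],
   [(2, .m 22454321), (1, .m 23354321)], [(1, .m 12244321), (2, .m 22343221)], [(1, .m 11233221)],
   [(2, .m 23465321)], [(1, .m 22354321)], [(2, .m 12243321), (2, .m 12343221)],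
   [(2, .m 11122210), (1, .m 11222110)], [(1, .m 1111110), (1, .m 10111110)], [(1, .m 110)],
   [(2, .m 11233210), (2, .m 12232210)], [(2, .m 1122210), (1, .m 11221110)], [(2, .m 111110)],
   [(1, .m 12343210)], [(1, .m 11232210)], [(2, .m 1122110), (1, .m 11121110)],
   [(2, .m 11122211), (1, .m 11222111)], [(1, .m 1111111), (1, .m 10111111)], [(1, .m 111)],
   [(2, .m 11233211), (2, .m 12232211)], [(2, .m 1122211), (1, .m 11221111)], [(2, .m 111111)],
   [(1, .m 12343211)], [(1, .m 11232211)], [(2, .m 1122111), (1, .m 11121111)],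
   [(1, .p 12243321), (1, .p 12343221)], [(2, .p 13354321), (1, .p 22354321)], [(2, .p 23465321)],
   [(1, .p 11233221), (1, .p 12232221)], [(2, .p 12244321), (1, .p 22343221)], [(1, .p 23354321)],
   [(2, .p 11122221)], [(1, .p 12233221)], [(2, .p 12344321), (2, .p 22343321)],
   [(1, .m 100), (2, .m 1000), (1, .m 100000), (2, .m 10000000)],
   [(1, .p 11100), (2, .p 1011000), (2, .p 1110000), (2, .p 10110000)],
   [(1, .p 1122100), (2, .p 11221000)],
   [(1, .m 111100), (1, .m 1011100), (1, .m 10111000), (2, .m 11110000)], [(1, .h 20201100)],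
   [(1, .p 1011100), (2, .p 11110000)], [(1, .m 1122100), (2, .m 11221000)],
   [(1, .m 11100), (2, .m 10110000)], [(2, .p 100), (1, .p 1000), (2, .p 100000), (1, .p 10000000)],
   [(1, .p 1121110)], [(1, .p 11232110)], [(1, .p 12243210)], [(1, .p 11110)],
   [(1, .p 1122110), (1, .p 11121110)], [(2, .p 12232110)], [(2, .p 10)], [(2, .p 1011110)],
   [(1, .p 1122210), (2, .p 11122110), (1, .p 11221110)], [(1, .p 1121111)], [(1, .p 11232111)],
   [(1, .p 12243211)], [(1, .p 11111)], [(1, .p 1122111), (1, .p 11121111)], [(2, .p 12232111)],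
   [(2, .p 11)], [(2, .p 1011111)], [(2, .p 1122211), (2, .p 11221111)], [(2, .m 22344321)],
   [(2, .m 12233321)], [(2, .m 11222221)], [(2, .m 23454321)], [(2, .m 12344321), (1, .m 22343321)],
   [(2, .m 11233321)], [(2, .m 23465421)], [(2, .m 22454321)], [(1, .m 12244321), (1, .m 22343221)],
   [(2, .m 11222210)], [(1, .m 11111110)], [(1, .m 1110)], [(1, .m 12233210)],
   [(2, .m 11122210), (2, .m 11222110)], [(2, .m 10111110)], [(2, .m 22343210)], [(2, .m 11233210)],
   [(2, .m 1122210), (1, .m 11122110), (2, .m 11221110)], [(2, .m 11222211)], [(1, .m 11111111)],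
   [(1, .m 1111)], [(1, .m 12233211)], [(2, .m 11122211), (2, .m 11222111)], [(2, .m 10111111)],
   [(2, .m 22343211)], [(2, .m 11233211)], [(2, .m 11122111)], [(1, .p 12243221)],
   [(1, .p 12354321)], [(1, .p 23464321)], [(1, .p 11232221)], [(2, .p 12243321), (1, .p 12343221)],
   [(1, .p 13354321)], [(1, .p 1122221)], [(1, .p 12232221)], [(2, .p 12343321)],
   [(1, .m 1100), (1, .m 10100000)], [(1, .p 11000), (1, .p 110000)],
   [(1, .p 1121100), (1, .p 11121000)], [(1, .m 1111100), (1, .m 11111000)],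
   [(1, .m 100), (1, .m 1000), (2, .m 100000), (2, .m 10000000)], [(1, .p 1011000), (1, .p 1110000)],
   [(1, .m 11122100), (1, .m 11221100)], [(1, .m 111100), (1, .m 10111000)], [(1, .h 1221210)],
   [(2, .m 111000)], [(2, .m 11121100)], [(1, .m 12232100)], [(1, .h 1020000)],
   [(2, .m 1011100), (2, .m 11110000)], [(1, .m 11122100), (2, .m 11221100)],
   [(1, .p 11100), (1, .p 1011000), (2, .p 1110000), (1, .p 10110000)],
   [(1, .m 100), (1, .m 1000000), (1, .m 10000000)],
   [(1, .m 1111100), (1, .m 10111100), (2, .m 11111000)], [(1, .p 1111000)], [(1, .h 11010100)],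
   [(1, .m 111100), (2, .m 1011100), (2, .m 10111000), (2, .m 11110000)],
   [(2, .p 1122100), (2, .p 11221000)], [(1, .p 11100), (1, .p 10110000)],
   [(2, .m 1000), (2, .m 100000), (2, .m 1000000)], [(2, .p 11232100)],
   [(1, .p 1121100), (2, .p 11121000)], [(1, .p 11000), (2, .p 110000), (2, .p 1010000)],
   [(2, .m 1000000)], [(2, .m 1111100), (1, .m 11111000)], [(2, .m 11222100)],
   [(1, .p 11000), (2, .p 110000)], [(1, .m 1100), (2, .m 10100000)], [(1, .m 11111100)],
   [(2, .p 1121000)], [(1, .p 10000)]]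

/-- The adapted basis. -/
def vec (j : ℕ) : Vec := table.getD j []

end E8

namespace E8

/-! ### The roots -/

/-- The vector of decimal digits. -/
def digits (n : ℕ) : Fin 8 → ℤ := fun i => (digit n i : ℤ)

theorem form_digits (a b : ℕ) :
    form (digits a) (digits b) = 2 * dotDiag a b - (dotEdge a b + dotEdge b a) := by
  simp [form, dotProduct, Matrix.mulVec, Fin.sum_univ_succ, CartanMatrix.E₈, digits, dotDiag,
    dotEdge]
  ring

theorem half_digits (a b : ℕ) :
    digits a ⬝ᵥ (halfMatrix *ᵥ digits b) = dotDiag a b - dotEdge a b := by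
  have h : halfMatrix = !![1, 0, 0, 0, 0, 0, 0, 0; 0, 1, 0, 0, 0, 0, 0, 0;
    -1, 0, 1, 0, 0, 0, 0, 0; 0, -1, -1, 1, 0, 0, 0, 0; 0, 0, 0, -1, 1, 0, 0, 0;
    0, 0, 0, 0, -1, 1, 0, 0; 0, 0, 0, 0, 0, -1, 1, 0; 0, 0, 0, 0, 0, 0, -1, 1] := by
    ext i j; fin_cases i <;> fin_cases j <;> rfl
  rw [h]
  simp [dotProduct, Matrix.mulVec, Fin.sum_univ_succ, digits, dotDiag, dotEdge]
  ring

/-- Candidates for an integer `x` for which `b * x - a` is small. -/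
def window (a b : ℤ) : List ℤ := [a / b - 1, a / b, a / b + 1, a / b + 2]

/-- x lies within 1 + 2/b ≤ 2 of a/b, so four consecutive integers around the floor suffice. In the
search the bound (b + 2)² is available at every stage because the weighted squares of
`sixty_form_self` add up to 120. -/
theorem mem_window {a b x : ℤ} (hb : 2 ≤ b) (h : (b * x - a) ^ 2 < (b + 2) ^ 2) :
    x ∈ window a b := by
  obtain ⟨h2, h1⟩ := abs_lt.1 (abs_lt_of_sq_lt_sq h (by omega))
  have h3 := Int.emod_add_mul_ediv a b
  have h4 := Int.emod_nonneg a (by omega : b ≠ 0)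
  have h5 := Int.emod_lt_of_pos a (by omega : 0 < b)
  have h6 : x < a / b + 3 := by nlinarith
  have h7 : a / b - 2 < x := by nlinarith
  simp only [window, List.mem_cons, List.not_mem_nil, or_false]
  omega

/-- Some positive root has the given coordinates up to a common sign. -/
def isPositiveRoot (x0 x1 x2 x3 x4 x5 x6 x7 : ℤ) : Bool :=
  let n := x0 * 10000000 + x1 * 1000000 + x2 * 100000 + x3 * 10000 + x4 * 1000 + x5 * 100 + x6 * 10
    + x7
  positiveRoots.any (Nat.beq n.natAbs) &&
    (((x0 == digit n.natAbs 0) && (x1 == digit n.natAbs 1) && (x2 == digit n.natAbs 2) &&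
      (x3 == digit n.natAbs 3) && (x4 == digit n.natAbs 4) && (x5 == digit n.natAbs 5) &&
      (x6 == digit n.natAbs 6) && (x7 == digit n.natAbs 7)) ||
    ((-x0 == digit n.natAbs 0) && (-x1 == digit n.natAbs 1) && (-x2 == digit n.natAbs 2) &&
      (-x3 == digit n.natAbs 3) && (-x4 == digit n.natAbs 4) && (-x5 == digit n.natAbs 5) &&
      (-x6 == digit n.natAbs 6) && (-x7 == digit n.natAbs 7)))

/-- All vectors of norm `2` are found in the table of positive roots. -/
def rootSearch : Bool :=
  [-7, -6, -5, -4, -3, -2, -1, 0, 1, 2, 3, 4, 5, 6, 7].all fun x3 : ℤ =>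
  let r3 := 120 - 2 * x3 ^ 2
  (window (4 * x3) 5).all fun x4 =>
  let r4 := r3 - 3 * (5 * x4 - 4 * x3) ^ 2
  r4 < 0 || (window (3 * x4) 4).all fun x5 =>
  let r5 := r4 - 5 * (4 * x5 - 3 * x4) ^ 2
  r5 < 0 || (window (2 * x5) 3).all fun x6 =>
  let r6 := r5 - 10 * (3 * x6 - 2 * x5) ^ 2
  r6 < 0 || (window x6 2).all fun x7 =>
  let r7 := r6 - 30 * (2 * x7 - x6) ^ 2
  r7 < 0 || (window x3 2).all fun x1 =>
  let r1 := r7 - 30 * (2 * x1 - x3) ^ 2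
  r1 < 0 || (window (2 * x3) 3).all fun x2 =>
  let r2 := r1 - 10 * (3 * x2 - 2 * x3) ^ 2
  r2 < 0 || (window x2 2).all fun x0 =>
  !(r2 - 30 * (2 * x0 - x2) ^ 2 == 0) || isPositiveRoot x0 x1 x2 x3 x4 x5 x6 x7

-- The coordinates of α₄, α₅, α₆, α₇, α₈, α₂, α₃, α₁ are chosen in this order, in which each square
-- of `sixty_form_self` brings in exactly one new coordinate; `r3`, `r4`, … is what remains of 60 ·
-- 2 = 120.
set_option maxRecDepth 100000 in
theorem rootSearch_eq : rootSearch = true := by decide +kernel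

/-- Each square is at most what the earlier ones leave of 120, so the branch that follows x is never
pruned and reaches the test at the leaf. -/
theorem isPositiveRoot_of_form {x : Fin 8 → ℤ} (h : form x x = 2) :
    isPositiveRoot (x 0) (x 1) (x 2) (x 3) (x 4) (x 5) (x 6) (x 7) = true := by
  have h0 := sixty_form_self x
  rw [h] at h0
  have a1 := sq_nonneg (2 * x 7 - x 6)
  have a2 := sq_nonneg (3 * x 6 - 2 * x 5)
  have a3 := sq_nonneg (4 * x 5 - 3 * x 4)
  have a4 := sq_nonneg (5 * x 4 - 4 * x 3)
  have a5 := sq_nonneg (2 * x 0 - x 2)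
  have a6 := sq_nonneg (3 * x 2 - 2 * x 3)
  have a7 := sq_nonneg (2 * x 1 - x 3)
  have a8 := sq_nonneg (x 3)
  have h3 : x 3 ∈ [-7, -6, -5, -4, -3, -2, -1, 0, 1, 2, 3, 4, 5, 6, 7] := by
    obtain ⟨h2, h1⟩ := abs_lt.1 (abs_lt_of_sq_lt_sq (by linarith : x 3 ^ 2 < 8 ^ 2) (by norm_num))
    simp only [List.mem_cons, List.not_mem_nil, or_false]
    omega
  have H := rootSearch_eq
  unfold rootSearch at H
  have H := List.all_eq_true.1 H _ h3
  have H := List.all_eq_true.1 H (x 4) (mem_window (by norm_num) (by linarith))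
  have H := (Bool.or_eq_true_iff.1 H).resolve_left (by simp; linarith)
  have H := List.all_eq_true.1 H (x 5) (mem_window (by norm_num) (by linarith))
  have H := (Bool.or_eq_true_iff.1 H).resolve_left (by simp; linarith)
  have H := List.all_eq_true.1 H (x 6) (mem_window (by norm_num) (by linarith))
  have H := (Bool.or_eq_true_iff.1 H).resolve_left (by simp; linarith)
  have H := List.all_eq_true.1 H (x 7) (mem_window (by norm_num) (by linarith))
  have H := (Bool.or_eq_true_iff.1 H).resolve_left (by simp; linarith)
  have H := List.all_eq_true.1 H (x 1) (mem_window (by norm_num) (by linarith))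
  have H := (Bool.or_eq_true_iff.1 H).resolve_left (by simp; linarith)
  have H := List.all_eq_true.1 H (x 2) (mem_window (by norm_num) (by linarith))
  have H := (Bool.or_eq_true_iff.1 H).resolve_left (by simp; linarith)
  have H := List.all_eq_true.1 H (x 0) (mem_window (by norm_num) (by linarith))
  exact (Bool.or_eq_true_iff.1 H).resolve_left (by simp; linarith)

theorem le_of_mem_positiveRoots {n : ℕ} (h : n ∈ positiveRoots) : n ≤ 99999999 := by
  have : (positiveRoots.all fun n => Nat.ble n 99999999) = true := by decide +kernel
  exact Nat.le_of_ble_eq_true (List.all_eq_true.1 this n h)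

/-- The integer whose decimal digits are the coordinates of a vector. -/
def encode (x : Fin 8 → ℤ) : ℤ :=
  x 0 * 10000000 + x 1 * 1000000 + x 2 * 100000 + x 3 * 10000 + x 4 * 1000 + x 5 * 100 + x 6 * 10
    + x 7

theorem encode_add (x y) : encode (x + y) = encode x + encode y := by
  simp only [encode, Pi.add_apply]; ring

theorem encode_neg (x) : encode (-x) = -encode x := by
  simp only [encode, Pi.neg_apply]; ring

theorem encode_digits {n : ℕ} (h : n ≤ 99999999) : encode (digits n) = n := by
  simp only [encode, digits, digit]
  norm_num
  omega

/-- The classification of the roots. -/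
theorem root_cases {x : Fin 8 → ℤ} (h : form x x = 2) :
    (encode x).natAbs ∈ positiveRoots ∧
      (x = digits (encode x).natAbs ∨ x = -digits (encode x).natAbs) := by
  have H := isPositiveRoot_of_form h
  simp only [isPositiveRoot, Bool.and_eq_true, Bool.or_eq_true, List.any_eq_true, beq_iff_eq,
    Nat.beq_eq] at H
  rw [show x 0 * 10000000 + x 1 * 1000000 + x 2 * 100000 + x 3 * 10000 + x 4 * 1000 + x 5 * 100
    + x 6 * 10 + x 7 = encode x from rfl] at H
  obtain ⟨⟨n, hn, hn'⟩, H⟩ := H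
  refine ⟨hn' ▸ hn, ?_⟩
  generalize (encode x).natAbs = n at H ⊢
  rcases H with ⟨⟨⟨⟨⟨⟨⟨h0, h1⟩, h2⟩, h3⟩, h4⟩, h5⟩, h6⟩, h7⟩ | ⟨⟨⟨⟨⟨⟨⟨h0, h1⟩, h2⟩, h3⟩, h4⟩, h5⟩, h6⟩, h7⟩
  · left; ext i; fin_cases i <;> assumption
  · right; ext i
    rw [Pi.neg_apply, ← neg_eq_iff_eq_neg]
    fin_cases i <;> assumption

theorem digits_zero : digits 0 = 0 := by
  ext i; simp [digits, digit]

/-- The validity of a code. -/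
def IsRootCode (n : ℕ) : Prop := form (digits n) (digits n) = 2 ∧ n ≤ 99999999

theorem isRootCode_of_mem {x : Fin 8 → ℤ} (h : form x x = 2) : IsRootCode (encode x).natAbs := by
  obtain ⟨h1, h2⟩ := root_cases h
  refine ⟨?_, le_of_mem_positiveRoots h1⟩
  rcases h2 with h2 | h2
  · rw [← h2, h]
  · rw [eq_neg_iff_add_eq_zero, add_comm, ← eq_neg_iff_add_eq_zero] at h2
    rw [h2, form_neg_left, form_neg_right, neg_neg, h]

theorem encode_ne_zero {x : Fin 8 → ℤ} (h : form x x = 2) : encode x ≠ 0 := by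
  intro h0
  have := (isRootCode_of_mem h).1
  rw [h0, Int.natAbs_zero, digits_zero] at this
  simp [form] at this

/-- By the classification the coordinates of a root have one common sign, and the sign of the code
decides which one. -/
theorem eq_digits_of_nonneg {x : Fin 8 → ℤ} (h : form x x = 2) {n : ℕ} (hn : encode x = n) :
    x = digits n := by
  have h1 := le_of_mem_positiveRoots (root_cases h).1
  have h0 := encode_ne_zero h
  rcases (root_cases h).2 with h2 | h2
  · rwa [hn, Int.natAbs_natCast] at h2
  · have h3 := congrArg encode h2
    rw [encode_neg, encode_digits h1] at h3
    omega

/-- The coordinate sum is again a root, so it is recovered from its code; hence no carry occurs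
between the decimal digits, and roots can be added as plain numbers. -/
theorem add_digits {a b : ℕ} (ha : IsRootCode a) (hb : IsRootCode b)
    (h : form (digits a) (digits b) = -1) :
    digits a + digits b = digits (a + b) ∧ IsRootCode (a + b) := by
  have h1 := add_root ha.1 hb.1 h
  have h2 : encode (digits a + digits b) = (a + b : ℕ) := by
    rw [encode_add, encode_digits ha.2, encode_digits hb.2]; simp
  have h3 := isRootCode_of_mem h1
  rw [h2, Int.natAbs_natCast] at h3
  exact ⟨eq_digits_of_nonneg h1 h2, h3⟩

theorem sub_digits {a b : ℕ} (ha : IsRootCode a) (hb : IsRootCode b)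
    (h : form (digits a) (digits b) = 1) (hab : b ≤ a) :
    digits a - digits b = digits (a - b) ∧ IsRootCode (a - b) := by
  have h0 : form (digits a) (-digits b) = -1 := by rw [form_neg_right, h]
  have hb' : form (-digits b) (-digits b) = 2 := by
    rw [form_neg_left, form_neg_right, neg_neg, hb.1]
  have h1 := add_root ha.1 hb' h0
  rw [← sub_eq_add_neg] at h1
  have h2 : encode (digits a - digits b) = (a - b : ℕ) := by
    rw [sub_eq_add_neg, encode_add, encode_neg, encode_digits ha.2, encode_digits hb.2]
    omega
  have h3 := isRootCode_of_mem h1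
  rw [h2, Int.natAbs_natCast] at h3
  exact ⟨eq_digits_of_nonneg h1 h2, h3⟩

end E8

namespace E8

/-! ### Correctness of the symbolic bracket. -/

section Soundness

variable (k : Type*) [Field k]

theorem lie_def (x y : E8 k) : ⁅x, y⁆ = bracket k x y := rfl

/-- The value of a generator. -/
def genEval : Gen → E8 k
  | .h n => coroot k (digits n)
  | .p n => rootVector k (digits n)
  | .m n => rootVector k (-digits n)

/-- The value of a formal linear combination. -/
def eval (u : Vec) : E8 k := (u.map fun t => (t.1 : k) • genEval k t.2).sum

@[simp] theorem eval_nil : eval k [] = 0 := rfl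

@[simp] theorem eval_cons (t : ℕ × Gen) (u : Vec) :
    eval k (t :: u) = (t.1 : k) • genEval k t.2 + eval k u := rfl

theorem eval_append (u v : Vec) : eval k (u ++ v) = eval k u + eval k v := by
  simp [eval]

theorem eval_smul (c : ℕ) (u : Vec) : eval k (u.smul c) = (c : k) • eval k u := by
  induction u with
  | nil => simp [Vec.smul]
  | cons t u ih =>
    have : Vec.smul c (t :: u) = (c * t.1, t.2) :: Vec.smul c u := rfl
    rw [this, eval_cons, eval_cons, ih, smul_add, smul_smul, Nat.cast_mul]

/-- The validity of a formal linear combination. -/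
def Vec.valid (u : Vec) : Prop := ∀ t ∈ u, t.2.valid = true

theorem valid_p {a : ℕ} : (Gen.p a).valid = true ↔ IsRootCode a := by
  have := form_digits a a
  simp only [Gen.valid, Bool.and_eq_true, Nat.beq_eq, Nat.ble_eq, IsRootCode]
  refine and_congr_left fun _ => ?_
  omega

theorem valid_m {a : ℕ} : (Gen.m a).valid = true ↔ IsRootCode a := valid_p

theorem IsRootCode.neg {a : ℕ} (h : IsRootCode a) : form (-digits a) (-digits a) = 2 := by
  rw [form_neg_left, form_neg_right, neg_neg, h.1]

theorem IsRootCode.pos {a : ℕ} (h : IsRootCode a) : 0 < a := by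
  rcases Nat.eq_zero_or_pos a with h0 | h0
  · have := h.1
    rw [h0, digits_zero] at this
    simp [form] at this
  · exact h0

/-- The value -2 would make the two roots opposite, but both codes are positive. -/
theorem form_ne_of_codes {a b : ℕ} (ha : IsRootCode a) (hb : IsRootCode b) :
    form (digits a) (digits b) ≠ -2 := by
  intro h
  have h1 := congrArg encode (eq_neg_of_form ha.1 hb.1 h)
  rw [encode_neg, encode_digits ha.2, encode_digits hb.2] at h1
  have := ha.pos
  omega

theorem eq_of_form_eq_two {a b : ℕ} (ha : IsRootCode a) (hb : IsRootCode b)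
    (h : form (digits a) (digits b) = 2) : a = b := by
  have h1 := congrArg encode (eq_neg_of_form ha.neg hb.1 (by rw [form_neg_left, h]))
  rw [neg_neg, encode_digits ha.2, encode_digits hb.2] at h1
  omega

theorem lie_coroot_coroot (u v : Fin 8 → ℤ) : ⁅coroot k u, coroot k v⁆ = 0 := by
  rw [lie_def]
  conv_lhs => enter [1, 2]; unfold coroot
  simp [bracket_h_coroot]

theorem rootVector_sub {a b : ℕ} (ha : IsRootCode a) (hb : IsRootCode b)
    (h : form (digits a) (digits b) = 1) :
    rootVector k (digits a - digits b) = genEval k (genSub a b) ∧ (genSub a b).valid = true := by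
  unfold genSub
  by_cases hab : b ≤ a
  · rw [Nat.ble_eq_true_of_le hab]
    obtain ⟨h1, h2⟩ := sub_digits ha hb h hab
    rw [h1]
    exact ⟨rfl, valid_p.2 h2⟩
  · have h0 : Nat.ble b a = false := by
      rw [Bool.eq_false_iff]; exact fun h => hab (Nat.le_of_ble_eq_true h)
    rw [h0]
    obtain ⟨h1, h2⟩ := sub_digits hb ha (by rw [form_comm, h]) (by omega)
    rw [← neg_sub, h1]
    exact ⟨rfl, valid_m.2 h2⟩

variable [CharP k 3]

theorem three_eq_zero : (3 : k) = 0 := by exact_mod_cast CharP.cast_eq_zero k 3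

/-- The edge terms enter the form with coefficient -1, which `formMod` replaces by 2. -/
theorem formMod_cast (a b : ℕ) : (formMod a b : k) = ((form (digits a) (digits b) : ℤ) : k) := by
  rw [form_digits, formMod]
  push_cast
  linear_combination (dotEdge a b + dotEdge b a : k) * three_eq_zero k

theorem signMod_cast (a b : ℕ) : (signMod a b : k) = ((sign (digits a) (digits b) : ℤ) : k) := by
  rw [sign, half_digits, signMod]
  rcases Nat.even_or_odd (dotDiag a b + dotEdge a b) with h | h
  · rw [Int.negOnePow_even _ (by rw [Int.even_sub]; rw [Nat.even_add] at h; exact_mod_cast h),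
      Nat.even_iff.1 h]
    simp
  · rw [Int.negOnePow_odd _ (by
      rw [← Int.not_even_iff_odd, Int.even_sub]
      rw [← Nat.not_even_iff_odd, Nat.even_add] at h; exact_mod_cast h), Nat.odd_iff.1 h]
    push_cast
    linear_combination three_eq_zero k

/-- Value and validity are proved together: codes may be added or subtracted only when they belong
to roots, so validity must survive iterated brackets. -/
theorem genBracket_sound {g g' : Gen} (hg : g.valid = true) (hg' : g'.valid = true) :
    ⁅genEval k g, genEval k g'⁆ = eval k (genBracket g g') ∧ (genBracket g g').valid := by
  have h3 := three_eq_zero k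
  have single : ∀ (c : ℕ) (g : Gen), eval k [(c, g)] = (c : k) • genEval k g := fun c g => by simp
  have vsingle : ∀ (c : ℕ) (g : Gen), g.valid = true → Vec.valid [(c, g)] := fun c g h t ht => by
    rw [List.mem_singleton.1 ht]; exact h
  have vnil : Vec.valid [] := fun t ht => by simp at ht
  rcases g with a | a | a <;> rcases g' with b | b | b
  · exact ⟨lie_coroot_coroot k _ _, vnil⟩
  · refine ⟨?_, vsingle _ _ hg'⟩
    change bracket k (coroot k (digits a)) (rootVector k (digits b)) = eval k [(formMod a b, .p b)]
    rw [bracket_coroot_root, single, formMod_cast]; rfl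
  · refine ⟨?_, vsingle _ _ hg'⟩
    change bracket k (coroot k (digits a)) (rootVector k (-digits b)) =
      eval k [(2 * formMod a b, .m b)]
    rw [bracket_coroot_root, single, Nat.cast_mul, formMod_cast, form_neg_right]
    change _ = _ • rootVector k (-digits b)
    congr 1
    push_cast
    linear_combination -((form (digits a) (digits b) : ℤ) : k) * h3
  · refine ⟨?_, vsingle _ _ hg⟩
    change bracket k (rootVector k (digits a)) (coroot k (digits b)) =
      eval k [(2 * formMod b a, .p a)]
    rw [bracket_root_coroot, single, Nat.cast_mul, formMod_cast, ← neg_smul]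
    change _ = _ • rootVector k (digits a)
    congr 1
    push_cast
    linear_combination -((form (digits b) (digits a) : ℤ) : k) * h3
  · rw [valid_p] at hg hg'
    have hf := form_digits a b
    change bracket k (rootVector k (digits a)) (rootVector k (digits b)) = eval k (bif _ then _ else _)
      ∧ Vec.valid (bif _ then _ else _)
    cases h : Nat.beq (2 * dotDiag a b + 1) (dotEdge a b + dotEdge b a)
    · replace h := Nat.ne_of_beq_eq_false h
      refine ⟨?_, vnil⟩
      rw [bracket_root_zero k hg.1 hg'.1 (form_ne_of_codes hg hg') (by omega)]; rfl
    · replace h := Nat.eq_of_beq_eq_true h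
      obtain ⟨h1, h2⟩ := add_digits hg hg' (by omega)
      refine ⟨?_, vsingle _ _ (valid_p.2 h2)⟩
      rw [bracket_root_add k hg.1 hg'.1 (by omega), h1, ← signMod_cast]
      exact (single (signMod a b) (.p (a + b))).symm
  · rw [valid_p] at hg; rw [valid_m] at hg'
    have hf := form_digits a b
    have hn := form_neg_right (digits a) (digits b)
    change bracket k (rootVector k (digits a)) (rootVector k (-digits b)) =
      eval k (bif _ then _ else bif _ then _ else _)
      ∧ Vec.valid (bif _ then _ else bif _ then _ else _)
    cases h : Nat.beq a b
    · replace h := Nat.ne_of_beq_eq_false h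
      have h2 := mt (eq_of_form_eq_two hg hg') h
      cases h' : Nat.beq (2 * dotDiag a b) (dotEdge a b + dotEdge b a + 1)
      · replace h' := Nat.ne_of_beq_eq_false h'
        refine ⟨?_, vnil⟩
        rw [bracket_root_zero k hg.1 hg'.neg (by omega) (by omega)]; rfl
      · replace h' := Nat.eq_of_beq_eq_true h'
        obtain ⟨h4, h5⟩ := rootVector_sub k hg hg' (by omega)
        refine ⟨?_, vsingle _ _ h5⟩
        rw [bracket_root_add k hg.1 hg'.neg (by omega), ← sub_eq_add_neg, h4, sign_neg_right,
          ← signMod_cast]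
        exact (single (signMod a b) (genSub a b)).symm
    · replace h := Nat.eq_of_beq_eq_true h
      subst h
      refine ⟨?_, vsingle _ _ rfl⟩
      have h4 := hg.1
      rw [bracket_root_opp k hg.1 hg'.neg (by omega)]
      refine Eq.trans ?_ (single 2 (.h a)).symm
      change _ = ((2 : ℕ) : k) • coroot k (digits a)
      rw [← neg_one_smul k (coroot k (digits a))]
      congr 1
      push_cast
      linear_combination -h3
  · refine ⟨?_, vsingle _ _ hg⟩
    change bracket k (rootVector k (-digits a)) (coroot k (digits b)) =
      eval k [(formMod b a, .m a)]
    rw [bracket_root_coroot, single, formMod_cast, ← neg_smul, form_neg_right]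
    change _ = _ • rootVector k (-digits a)
    congr 1
    push_cast
    ring
  · rw [valid_m] at hg; rw [valid_p] at hg'
    have hf := form_digits a b
    have hn := form_neg_left (digits a) (digits b)
    change bracket k (rootVector k (-digits a)) (rootVector k (digits b)) =
      eval k (bif _ then _ else bif _ then _ else _)
      ∧ Vec.valid (bif _ then _ else bif _ then _ else _)
    cases h : Nat.beq a b
    · replace h := Nat.ne_of_beq_eq_false h
      have h2 := mt (eq_of_form_eq_two hg hg') h
      cases h' : Nat.beq (2 * dotDiag a b) (dotEdge a b + dotEdge b a + 1)
      · replace h' := Nat.ne_of_beq_eq_false h'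
        refine ⟨?_, vnil⟩
        rw [bracket_root_zero k hg.neg hg'.1 (by omega) (by omega)]; rfl
      · replace h' := Nat.eq_of_beq_eq_true h'
        obtain ⟨h4, h5⟩ := rootVector_sub k hg' hg (by rw [form_comm]; omega)
        refine ⟨?_, vsingle _ _ h5⟩
        rw [bracket_root_add k hg.neg hg'.1 (by omega), neg_add_eq_sub, h4, sign_neg_left,
          ← signMod_cast]
        exact (single (signMod a b) (genSub b a)).symm
    · replace h := Nat.eq_of_beq_eq_true h
      subst h
      refine ⟨?_, vsingle _ _ rfl⟩
      have h4 := hg.1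
      rw [bracket_root_opp k hg.neg hg'.1 (by omega), coroot_neg, neg_neg]
      refine Eq.trans ?_ (single 1 (.h a)).symm
      change _ = ((1 : ℕ) : k) • coroot k (digits a)
      simp
  · rw [valid_m] at hg hg'
    have hf := form_digits a b
    have hn : form (-digits a) (-digits b) = form (digits a) (digits b) := by
      rw [form_neg_left, form_neg_right, neg_neg]
    change bracket k (rootVector k (-digits a)) (rootVector k (-digits b)) = eval k (bif _ then _ else _)
      ∧ Vec.valid (bif _ then _ else _)
    have h2 := form_ne_of_codes hg hg'
    cases h : Nat.beq (2 * dotDiag a b + 1) (dotEdge a b + dotEdge b a)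
    · replace h := Nat.ne_of_beq_eq_false h
      refine ⟨?_, vnil⟩
      rw [bracket_root_zero k hg.neg hg'.neg (by omega) (by omega)]; rfl
    · replace h := Nat.eq_of_beq_eq_true h
      obtain ⟨h1, h2⟩ := add_digits hg hg' (by omega)
      refine ⟨?_, vsingle _ _ (valid_m.2 h2)⟩
      rw [bracket_root_add k hg.neg hg'.neg (by omega), ← neg_add, h1, sign_neg_left,
        sign_neg_right, ← signMod_cast]
      exact (single (signMod a b) (.m (a + b))).symm

theorem bracket_sound {u v : Vec} (hu : u.valid) (hv : v.valid) :
    ⁅eval k u, eval k v⁆ = eval k (u.bracket v) ∧ (u.bracket v).valid := by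
  induction u with
  | nil => exact ⟨by simp [Vec.bracket], fun t ht => by simp [Vec.bracket] at ht⟩
  | cons s u ih =>
    have hs : s.2.valid = true := hu s (by simp)
    obtain ⟨ih1, ih2⟩ := ih fun t ht => hu t (by simp [ht])
    have h : Vec.bracket (s :: u) v =
        (v.flatMap fun t => Vec.smul (s.1 * t.1) (genBracket s.2 t.2)) ++ Vec.bracket u v := by
      simp [Vec.bracket]
    have key : ⁅(s.1 : k) • genEval k s.2, eval k v⁆ =
        eval k (v.flatMap fun t => Vec.smul (s.1 * t.1) (genBracket s.2 t.2)) ∧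
        Vec.valid (v.flatMap fun t => Vec.smul (s.1 * t.1) (genBracket s.2 t.2)) := by
      clear ih1 ih2 h ih
      induction v with
      | nil => exact ⟨by simp, fun t ht => by simp at ht⟩
      | cons t v ih =>
        obtain ⟨ih1, ih2⟩ := ih fun t ht => hv t (by simp [ht])
        obtain ⟨h1, h2⟩ := genBracket_sound k hs (hv t (by simp))
        constructor
        · rw [List.flatMap_cons, eval_append, eval_cons, lie_add, ih1, lie_smul, smul_lie, h1,
            eval_smul, smul_smul, Nat.cast_mul, mul_comm]
        · intro r hr
          rw [List.flatMap_cons, List.mem_append] at hr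
          rcases hr with hr | hr
          · simp only [Vec.smul, List.mem_map] at hr
            obtain ⟨r, hr, rfl⟩ := hr
            exact h2 r hr
          · exact ih2 r hr
    rw [h, eval_append, eval_cons, add_lie, ih1, key.1]
    refine ⟨rfl, fun t ht => ?_⟩
    rcases List.mem_append.1 ht with ht | ht
    · exact key.2 t ht
    · exact ih2 t ht

theorem smul_valid {u : Vec} (hu : u.valid) (c : ℕ) : (u.smul c).valid := by
  intro t ht
  simp only [Vec.smul, List.mem_map] at ht
  obtain ⟨t, ht, rfl⟩ := ht
  exact hu t ht

theorem append_valid {u v : Vec} (hu : u.valid) (hv : v.valid) : Vec.valid (u ++ v) := by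
  intro t ht
  rcases List.mem_append.1 ht with ht | ht
  · exact hu t ht
  · exact hv t ht

end Soundness

/-! ### The vanishing test for formal combinations. -/

section Zero

variable (k : Type*) [Field k]

theorem repr_rootVector_inr (v : Fin 8 → ℤ) (α : Root) :
    (basis k).repr (rootVector k v) (.inr α) = if v = α.1 then 1 else 0 := by
  by_cases h : form v v = 2
  · rw [rootVector, dif_pos h, Module.Basis.repr_self, Finsupp.single_apply]
    simp [Subtype.ext_iff]
  · rw [rootVector_of_not k h, if_neg (show ¬v = α.1 from fun h' => h (h' ▸ α.2))]
    simp

theorem repr_rootVector_inl (v : Fin 8 → ℤ) (i : Fin 8) :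
    (basis k).repr (rootVector k v) (.inl i) = 0 := by
  by_cases h : form v v = 2
  · rw [rootVector, dif_pos h, Module.Basis.repr_self, Finsupp.single_apply]
    simp
  · rw [rootVector_of_not k h]
    simp

theorem repr_coroot_inr (v : Fin 8 → ℤ) (α : Root) :
    (basis k).repr (coroot k v) (.inr α) = 0 := by
  simp [coroot]

theorem repr_coroot_inl (v : Fin 8 → ℤ) (i : Fin 8) :
    (basis k).repr (coroot k v) (.inl i) = v i := by
  simp [coroot, Finsupp.single_apply]

theorem sumMap_cons (f : ℕ × Gen → ℕ) (t : ℕ × Gen) (u : Vec) :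
    Vec.sumMap f (t :: u) = f t + Vec.sumMap f u := rfl

theorem sumMap_cast (f : ℕ × Gen → ℕ) (u : Vec) :
    (Vec.sumMap f u : k) = (u.map fun t => (f t : k)).sum := by
  induction u with
  | nil => simp [Vec.sumMap]
  | cons t u ih => rw [sumMap_cons, Nat.cast_add, ih]; rfl

theorem repr_eval (u : Vec) (i : Index) :
    (basis k).repr (eval k u) i = (u.map fun t => (t.1 : k) * (basis k).repr (genEval k t.2) i).sum := by
  induction u with
  | nil => simp
  | cons t u ih => simp [ih]

/-- The root of a generator. -/
def Gen.root : Gen → Fin 8 → ℤ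
  | .h _ => 0
  | .p a => digits a
  | .m a => -digits a

theorem digits_injective {a b : ℕ} (ha : a ≤ 99999999) (hb : b ≤ 99999999)
    (h : digits a = digits b) : a = b := by
  have := congrArg encode h
  rw [encode_digits ha, encode_digits hb] at this
  exact_mod_cast this

theorem sameRoot_eq {g g' : Gen} (hg : g.valid = true) (hg' : g'.valid = true) (α : Root)
    (h : g'.root = α.1) :
    ((bif Vec.sameRoot g g' then 1 else 0 : ℕ) : k) = (basis k).repr (genEval k g) (.inr α) := by
  have hα : α.1 ≠ 0 := fun h0 => by have := α.2; rw [h0] at this; simp [form] at this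
  rcases g' with b | b | b
  · exact absurd h.symm hα
  all_goals
    simp only [Gen.root] at h
    rcases g with a | a | a
  · change ((bif false then 1 else 0 : ℕ) : k) = (basis k).repr (coroot k _) _
    rw [repr_coroot_inr]; simp
  · change ((bif Nat.beq a b then 1 else 0 : ℕ) : k) = (basis k).repr (rootVector k _) _
    rw [repr_rootVector_inr, ← h]
    rw [valid_p] at hg hg'
    cases h : Nat.beq a b
    · rw [if_neg (fun h' => Nat.ne_of_beq_eq_false h (digits_injective hg.2 hg'.2 h'))]; simp
    · rw [Nat.eq_of_beq_eq_true h]; simp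
  · change ((bif false then 1 else 0 : ℕ) : k) = (basis k).repr (rootVector k _) _
    rw [repr_rootVector_inr, ← h]
    rw [valid_p] at hg'; rw [valid_m] at hg
    rw [if_neg]
    · simp
    · intro h'
      have := congrArg encode h'
      rw [encode_neg, encode_digits hg.2, encode_digits hg'.2] at this
      have := hg.pos
      omega
  · change ((bif false then 1 else 0 : ℕ) : k) = (basis k).repr (coroot k _) _
    rw [repr_coroot_inr]; simp
  · change ((bif false then 1 else 0 : ℕ) : k) = (basis k).repr (rootVector k _) _
    rw [repr_rootVector_inr, ← h]
    rw [valid_m] at hg'; rw [valid_p] at hg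
    rw [if_neg]
    · simp
    · intro h'
      have := congrArg encode h'
      rw [encode_neg, encode_digits hg.2, encode_digits hg'.2] at this
      have := hg.pos
      omega
  · change ((bif Nat.beq a b then 1 else 0 : ℕ) : k) = (basis k).repr (rootVector k _) _
    rw [repr_rootVector_inr, ← h]
    rw [valid_m] at hg hg'
    cases h : Nat.beq a b
    · rw [if_neg (fun h' => Nat.ne_of_beq_eq_false h
        (digits_injective hg.2 hg'.2 (neg_injective h')))]; simp
    · rw [Nat.eq_of_beq_eq_true h]; simp

variable [CharP k 3]

theorem cast_mod_three (n : ℕ) : ((n % 3 : ℕ) : k) = n := by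
  conv_rhs => rw [← Nat.mod_add_div n 3]
  push_cast
  rw [three_eq_zero k]; ring

/-- A root that does not occur in the list has coefficient zero termwise, so it suffices to test the
roots that occur and the eight simple coroots. -/
theorem eval_eq_zero {u : Vec} (hu : u.valid) (h : u.isZero = true) : eval k u = 0 := by
  simp only [Vec.isZero, Bool.and_eq_true, List.all_eq_true, Nat.beq_eq, List.mem_range] at h
  obtain ⟨h1, h2⟩ := h
  refine (basis k).repr.injective ?_
  rw [map_zero]
  ext i
  rw [Finsupp.zero_apply]
  rcases i with i | α
  · have h3 := congrArg (Nat.cast (R := k)) (h2 i i.2)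
    rw [cast_mod_three, Vec.cartanCoeff, sumMap_cast, Nat.cast_zero] at h3
    rw [repr_eval, ← h3]
    congr 1
    refine List.map_congr_left fun t _ => ?_
    rw [Nat.cast_mul]
    congr 1
    rcases t with ⟨c, a | a | a⟩
    · exact (repr_coroot_inl k _ _).trans (by simp [Vec.cartanDigit, digits])
    · exact (repr_rootVector_inl k _ _).trans (by simp [Vec.cartanDigit])
    · exact (repr_rootVector_inl k _ _).trans (by simp [Vec.cartanDigit])
  · by_cases hα : ∃ t ∈ u, t.2.root = α.1
    · obtain ⟨t, ht, htα⟩ := hα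
      have h3 := congrArg (Nat.cast (R := k)) (h1 t ht)
      rw [cast_mod_three, Vec.coeff, sumMap_cast, Nat.cast_zero] at h3
      rw [repr_eval, ← h3]
      congr 1
      refine List.map_congr_left fun s hs => ?_
      rw [← sameRoot_eq k (hu s hs) (hu t ht) α htα]
      cases Vec.sameRoot s.2 t.2 <;> simp
    · push Not at hα
      rw [repr_eval]
      refine List.sum_eq_zero fun x hx => ?_
      obtain ⟨t, ht, rfl⟩ := List.mem_map.1 hx
      have h4 := hα t ht
      rcases t with ⟨c, a | a | a⟩
      · simp [genEval, repr_coroot_inr]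
      · exact mul_eq_zero_of_right _ ((repr_rootVector_inr k _ _).trans (if_neg h4))
      · exact mul_eq_zero_of_right _ ((repr_rootVector_inr k _ _).trans (if_neg h4))

end Zero

/-! ### The normalised invariant form; the Killing form, 60 times this one, is zero in
characteristic 3. -/

section InvariantForm

variable (k : Type*) [Field k]

/-- The invariant form on the Chevalley basis. -/
def invFormBasis : Index → Index → k
  | .inl i, .inl j => (CartanMatrix.E₈ i j : ℤ)
  | .inr α, .inr β => if α.1 + β.1 = 0 then -1 else 0
  | _, _ => 0

/-- The invariant symmetric bilinear form. -/
def invForm : LinearMap.BilinForm k (E8 k) :=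
  (basis k).constr k fun i => (basis k).constr k fun j => invFormBasis k i j

theorem invForm_basis (i j : Index) : invForm k (basis k i) (basis k j) = invFormBasis k i j := by
  simp [invForm]

theorem invForm_coroot_coroot (u v : Fin 8 → ℤ) :
    invForm k (coroot k u) (coroot k v) = (form u v : ℤ) := by
  simp only [coroot, map_sum, map_smul, LinearMap.sum_apply, LinearMap.smul_apply, invForm_basis,
    invFormBasis, smul_eq_mul, form, dotProduct, Matrix.mulVec, Int.cast_sum, Int.cast_mul,
    Finset.mul_sum]
  rw [Finset.sum_comm]
  refine Finset.sum_congr rfl fun i _ => Finset.sum_congr rfl fun j _ => ?_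
  ring

theorem invForm_h_root (i : Fin 8) (v : Fin 8 → ℤ) :
    invForm k (basis k (.inl i)) (rootVector k v) = 0 := by
  unfold rootVector
  split_ifs
  · rw [invForm_basis]; rfl
  · simp

theorem invForm_root_h (i : Fin 8) (v : Fin 8 → ℤ) :
    invForm k (rootVector k v) (basis k (.inl i)) = 0 := by
  unfold rootVector
  split_ifs
  · rw [invForm_basis]; rfl
  · simp

theorem invForm_coroot_root (u v : Fin 8 → ℤ) :
    invForm k (coroot k u) (rootVector k v) = 0 := by
  simp [coroot, invForm_h_root]

theorem invForm_root_coroot (u v : Fin 8 → ℤ) :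
    invForm k (rootVector k v) (coroot k u) = 0 := by
  simp [coroot, invForm_root_h]

theorem invForm_root_root {u v : Fin 8 → ℤ} (hu : form u u = 2) (hv : form v v = 2) :
    invForm k (rootVector k u) (rootVector k v) = if u + v = 0 then -1 else 0 := by
  rw [rootVector, rootVector, dif_pos hu, dif_pos hv, invForm_basis]; rfl

theorem invForm_comm (x y : E8 k) : invForm k x y = invForm k y x := by
  induction x using basis_induction with
  | h0 => simp
  | ha x x' hx hx' => simp only [map_add, LinearMap.add_apply, hx, hx']
  | hs c x hx => simp only [map_smul, LinearMap.smul_apply, hx]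
  | hb i =>
  induction y using basis_induction with
  | h0 => simp
  | ha x x' hx hx' => simp only [map_add, LinearMap.add_apply, hx, hx']
  | hs c x hx => simp only [map_smul, LinearMap.smul_apply, hx]
  | hb j =>
  rw [invForm_basis, invForm_basis]
  rcases i with i | α <;> rcases j with j | β <;> simp only [invFormBasis]
  · rw [← Matrix.transpose_apply CartanMatrix.E₈, CartanMatrix.E₈_transpose]
  · rw [add_comm]

/-- The case with content is that of three roots of sum zero, where invariance amounts to ε(β, γ) =
ε(α, β). With γ = -(α + β) this follows from bimultiplicativity, ε(β, β) = -1 and ε(β, α) = -ε(α,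
β). -/
theorem invForm_lie_basis (i j l : Index) :
    invForm k (bracket k (basis k i) (basis k j)) (basis k l) =
      invForm k (basis k i) (bracket k (basis k j) (basis k l)) := by
  rcases i with i | α <;> rcases j with j | β <;> rcases l with l | γ <;>
    simp only [← rootVector_of_root, bracket_h_h, bracket_h_root, bracket_root_h, map_smul,
      map_neg, map_zero, LinearMap.smul_apply, LinearMap.neg_apply, LinearMap.zero_apply,
      invForm_h_root, invForm_root_h, smul_zero, neg_zero]
  · rw [invForm_root_root k β.2 γ.2]
    by_cases h : β.1 + γ.1 = 0
    · rw [if_pos h, bracket_root_opp k β.2 γ.2 ((add_eq_zero_iff β γ).1 h), map_neg]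
      have : invForm k (basis k (.inl i)) (coroot k β.1) = ((CartanMatrix.E₈ *ᵥ β.1) i : ℤ) := by
        simp [coroot, invForm_basis, invFormBasis, Matrix.mulVec, dotProduct, mul_comm]
      rw [this]; simp
    · rw [if_neg h, bracket_root_add k β.2 γ.2 ((add_eq_zero_iff β γ).not.1 h), map_smul,
        invForm_h_root, smul_zero, smul_zero]
  · rw [invForm_root_root k α.2 γ.2]
    by_cases h : α.1 + γ.1 = 0
    · rw [eq_neg_of_add_eq_zero_right h]; simp [Matrix.mulVec_neg]
    · simp [h]
  · by_cases h : α.1 + β.1 = 0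
    · rw [bracket_root_opp k α.2 β.2 ((add_eq_zero_iff α β).1 h), map_neg, LinearMap.neg_apply,
        invForm_root_root k α.2 β.2, if_pos h, eq_neg_of_add_eq_zero_right h, invForm_comm]
      have : invForm k (basis k (.inl l)) (coroot k α.1) = ((CartanMatrix.E₈ *ᵥ α.1) l : ℤ) := by
        simp [coroot, invForm_basis, invFormBasis, Matrix.mulVec, dotProduct, mul_comm]
      rw [this]; simp [Matrix.mulVec_neg]
    · rw [invForm_root_root k α.2 β.2, if_neg h,
        bracket_root_add k α.2 β.2 ((add_eq_zero_iff α β).not.1 h), map_smul,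
        LinearMap.smul_apply, invForm_root_h]
      simp
  · have hl : invForm k (bracket k (rootVector k α.1) (rootVector k β.1)) (rootVector k γ.1) =
        if α.1 + β.1 + γ.1 = 0 then -(sign α.1 β.1 : k) else 0 := by
      by_cases h : α.1 + β.1 = 0
      · rw [bracket_root_opp k α.2 β.2 ((add_eq_zero_iff α β).1 h), map_neg, LinearMap.neg_apply,
          invForm_coroot_root, neg_zero, h, zero_add, if_neg]
        intro h0
        have := γ.2
        rw [h0] at this; simp [form] at this
      · rw [bracket_root_add k α.2 β.2 ((add_eq_zero_iff α β).not.1 h), map_smul,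
          LinearMap.smul_apply]
        by_cases h1 : form α.1 β.1 = -1
        · rw [invForm_root_root k (add_root α.2 β.2 h1) γ.2]
          split_ifs <;> simp
        · rw [rootVector_of_not k ((add_root_iff α β).not.2 h1), if_neg]
          · simp
          · intro h0
            refine (add_root_iff α β).not.2 h1 ?_
            rw [eq_neg_of_add_eq_zero_left h0, form_neg_left, form_neg_right, neg_neg, γ.2]
    have hr : invForm k (rootVector k α.1) (bracket k (rootVector k β.1) (rootVector k γ.1)) =
        if α.1 + β.1 + γ.1 = 0 then -(sign β.1 γ.1 : k) else 0 := by
      by_cases h : β.1 + γ.1 = 0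
      · rw [bracket_root_opp k β.2 γ.2 ((add_eq_zero_iff β γ).1 h), map_neg,
          invForm_root_coroot, neg_zero, add_assoc, h, add_zero, if_neg]
        intro h0
        have := α.2
        rw [h0] at this; simp [form] at this
      · rw [bracket_root_add k β.2 γ.2 ((add_eq_zero_iff β γ).not.1 h), map_smul]
        by_cases h1 : form β.1 γ.1 = -1
        · rw [invForm_root_root k α.2 (add_root β.2 γ.2 h1), ← add_assoc]
          split_ifs <;> simp
        · rw [rootVector_of_not k ((add_root_iff β γ).not.2 h1), add_assoc, if_neg]
          · simp
          · intro h0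
            refine (add_root_iff β γ).not.2 h1 ?_
            rw [eq_neg_of_add_eq_zero_right h0, form_neg_left, form_neg_right, neg_neg, α.2]
    rw [hl, hr]
    by_cases h0 : α.1 + β.1 + γ.1 = 0
    · rw [if_pos h0, if_pos h0]
      have hγ : γ.1 = -(α.1 + β.1) := eq_neg_of_add_eq_zero_right h0
      have h1 : form α.1 β.1 = -1 := by
        rw [← add_root_iff, ← neg_neg (α.1 + β.1), ← hγ, form_neg_left, form_neg_right, neg_neg,
          γ.2]
      rw [hγ, sign_neg_right, sign_add_right, sign_self, sign_swap_odd (Or.inl h1)]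
      simp
    · rw [if_neg h0, if_neg h0]

/-- The form is invariant. -/
theorem invForm_lie (x y z : E8 k) : invForm k ⁅x, y⁆ z = invForm k x ⁅y, z⁆ := by
  rw [lie_def, lie_def]
  induction x using basis_induction with
  | h0 => simp
  | ha x x' hx hx' => simp only [map_add, LinearMap.add_apply, hx, hx']
  | hs c x hx => simp only [map_smul, LinearMap.smul_apply, hx]
  | hb i =>
  induction y using basis_induction with
  | h0 => simp
  | ha x x' hx hx' => simp only [map_add, LinearMap.add_apply, hx, hx']
  | hs c x hx => simp only [map_smul, LinearMap.smul_apply, hx]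
  | hb j =>
  induction z using basis_induction with
  | h0 => simp
  | ha x x' hx hx' => simp only [map_add, hx, hx']
  | hs c x hx => simp only [map_smul, hx]
  | hb l => exact invForm_lie_basis k i j l

variable [CharP k 3]

theorem genForm_sound {g g' : Gen} (hg : g.valid = true) (hg' : g'.valid = true) :
    invForm k (genEval k g) (genEval k g') = (Vec.genForm g g' : k) := by
  rcases g with a | a | a <;> rcases g' with b | b | b
  · exact (invForm_coroot_coroot k _ _).trans (formMod_cast k a b).symm
  · exact (invForm_coroot_root k _ _).trans Nat.cast_zero.symm
  · exact (invForm_coroot_root k _ _).trans Nat.cast_zero.symm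
  · exact (invForm_root_coroot k _ _).trans Nat.cast_zero.symm
  · rw [valid_p] at hg hg'
    refine (invForm_root_root k hg.1 hg'.1).trans ((if_neg fun h => ?_).trans Nat.cast_zero.symm)
    have := congrArg encode h
    rw [encode_add, encode_digits hg.2, encode_digits hg'.2] at this
    simp [encode] at this
    have := hg.pos
    omega
  · rw [valid_p] at hg; rw [valid_m] at hg'
    refine (invForm_root_root k hg.1 hg'.neg).trans ?_
    change _ = ((bif Nat.beq a b then 2 else 0 : ℕ) : k)
    cases h : Nat.beq a b
    · rw [if_neg]
      · simp
      · rw [← sub_eq_add_neg, sub_eq_zero]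
        exact fun h' => Nat.ne_of_beq_eq_false h (digits_injective hg.2 hg'.2 h')
    · rw [Nat.eq_of_beq_eq_true h, if_pos (by simp), cond_true]
      push_cast
      linear_combination -three_eq_zero k
  · exact (invForm_root_coroot k _ _).trans Nat.cast_zero.symm
  · rw [valid_m] at hg; rw [valid_p] at hg'
    refine (invForm_root_root k hg.neg hg'.1).trans ?_
    change _ = ((bif Nat.beq a b then 2 else 0 : ℕ) : k)
    cases h : Nat.beq a b
    · rw [if_neg]
      · simp
      · rw [neg_add_eq_zero]
        exact fun h' => Nat.ne_of_beq_eq_false h (digits_injective hg.2 hg'.2 h')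
    · rw [Nat.eq_of_beq_eq_true h, if_pos (by simp), cond_true]
      push_cast
      linear_combination -three_eq_zero k
  · rw [valid_m] at hg hg'
    refine (invForm_root_root k hg.neg hg'.neg).trans ((if_neg fun h => ?_).trans Nat.cast_zero.symm)
    have := congrArg encode h
    rw [encode_add, encode_neg, encode_neg, encode_digits hg.2, encode_digits hg'.2] at this
    simp [encode] at this
    have := hg.pos
    omega

theorem form_sound {u v : Vec} (hu : u.valid) (hv : v.valid) :
    invForm k (eval k u) (eval k v) = (Vec.form u v : k) := by
  rw [Vec.form, cast_mod_three]
  induction u with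
  | nil => simp [Vec.sumMap]
  | cons s u ih =>
    rw [sumMap_cons, Nat.cast_add, ← ih fun t ht => hu t (by simp [ht]), eval_cons, map_add,
      LinearMap.add_apply, map_smul, LinearMap.smul_apply]
    congr 1
    clear ih
    induction v with
    | nil => simp [Vec.sumMap]
    | cons t v ih =>
      rw [sumMap_cons, Nat.cast_add, ← ih fun t ht => hv t (by simp [ht]), eval_cons, map_add,
        map_smul, genForm_sound k (hu s (by simp)) (hv t (by simp))]
      simp only [smul_eq_mul, Nat.cast_mul]
      ring

end InvariantForm

end E8

namespace E8

/-! ### The dimension bound 248. -/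

section Dimension

theorem encode_injective_root {x y : Fin 8 → ℤ} (hx : form x x = 2) (hy : form y y = 2)
    (h : encode x = encode y) : x = y := by
  have h0 := encode_ne_zero hx
  have h1 := le_of_mem_positiveRoots (root_cases hx).1
  have hx' := (root_cases hx).2
  have hy' := (root_cases hy).2
  rw [← h] at hy'
  have h2 := encode_digits h1
  rcases hx' with hx' | hx' <;> rcases hy' with hy' | hy'
  · rw [hx', hy']
  · have h3 := congrArg encode hx'
    have h4 := congrArg encode hy'
    rw [encode_neg] at h4
    omega
  · have h3 := congrArg encode hx'
    have h4 := congrArg encode hy'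
    rw [encode_neg] at h3
    omega
  · rw [hx', hy']

/-- The codes of the roots. -/
def rootCodes : Finset ℤ :=
  (positiveRoots.map (fun n : ℕ => (n : ℤ)) ++ positiveRoots.map (fun n : ℕ => -(n : ℤ))).toFinset

theorem card_rootCodes_le : rootCodes.card ≤ 240 := by
  refine (List.toFinset_card_le _).trans ?_
  rw [List.length_append, List.length_map, List.length_map]
  exact le_of_eq rfl

/-- The code of a root. -/
def rootCode (α : Root) : rootCodes := ⟨encode α.1, by
  have h := (root_cases α.2).1
  simp only [rootCodes, List.mem_toFinset, List.mem_append, List.mem_map]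
  rcases Int.natAbs_eq (encode α.1) with h1 | h1
  · exact Or.inl ⟨_, h, h1.symm⟩
  · exact Or.inr ⟨_, h, h1.symm⟩⟩

theorem rootCode_injective : Function.Injective rootCode := fun α β h =>
  Subtype.ext (encode_injective_root α.2 β.2 (congrArg Subtype.val h))

instance : Finite Root := Finite.of_injective rootCode rootCode_injective

variable (k : Type*) [Field k]

instance : Module.Finite k (E8 k) := Module.Finite.of_basis (basis k)

/-- The upper bound is enough: the Gram matrix of the adapted basis exhibits 248 independent
vectors. -/
theorem finrank_le : Module.finrank k (E8 k) ≤ 248 := by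
  have := Fintype.ofFinite Root
  rw [Module.finrank_eq_card_basis (basis k), Fintype.card_sum, Fintype.card_fin]
  have h := Fintype.card_le_of_injective _ rootCode_injective
  rw [Fintype.card_coe] at h
  have := card_rootCodes_le
  omega

end Dimension

/-! ### The adjoint group acts by Lie algebra automorphisms. -/

section Automorphisms

variable (k : Type*) [Field k]

/-- In a simply laced system β + 2α is a root only for β = -α: if α + β is a root, then (α, α + β) =
1. -/
theorem ad_rootVector_sq (α : Root) (y : E8 k) :
    ∃ c : k, ⁅rootVector k α.1, ⁅rootVector k α.1, y⁆⁆ = c • rootVector k α.1 := by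
  simp only [lie_def]
  induction y using basis_induction with
  | h0 => exact ⟨0, by simp⟩
  | ha x y hx hy =>
    obtain ⟨c, hc⟩ := hx
    obtain ⟨d, hd⟩ := hy
    exact ⟨c + d, by rw [map_add, map_add, hc, hd, add_smul]⟩
  | hs a x hx =>
    obtain ⟨c, hc⟩ := hx
    exact ⟨a * c, by rw [map_smul, map_smul, hc, mul_smul]⟩
  | hb i =>
  rcases i with i | β
  · refine ⟨0, ?_⟩
    rw [bracket_root_h, map_neg, map_smul, bracket_self, smul_zero, neg_zero, zero_smul]
  · rw [← rootVector_of_root]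
    by_cases h : form α.1 β.1 = -2
    · rw [bracket_root_opp k α.2 β.2 h, map_neg, bracket_root_coroot, neg_neg]
      exact ⟨_, rfl⟩
    · refine ⟨0, ?_⟩
      rw [bracket_root_add k α.2 β.2 h, map_smul, zero_smul]
      by_cases h1 : form α.1 β.1 = -1
      · have h2 : form α.1 (α.1 + β.1) = 1 := by rw [form_add_right, α.2, h1]; rfl
        rw [bracket_root_zero k α.2 (add_root α.2 β.2 h1) (by omega) (by omega), smul_zero]
      · rw [rootVector_of_not k ((add_root_iff α β).not.2 h1), map_zero, smul_zero]

theorem rootElement_apply (α : Root) (t : k) (x : E8 k) :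
    rootElement k α t x = x + t • ⁅rootVector k α.1, x⁆ +
      (t ^ 2 / 2) • ⁅rootVector k α.1, ⁅rootVector k α.1, x⁆⁆ := by
  simp [rootElement, pow_two]

/-- Put (ad e)²x = c e and (ad e)²y = d e. In the bracket of the two exponentials the t³ terms are
opposite multiples of e and the t⁴ term is a multiple of [e, e] = 0, so no division by 3 is needed.
-/
theorem rootElement_lie (h2 : (2 : k) ≠ 0) (α : Root) (t : k) (x y : E8 k) :
    rootElement k α t ⁅x, y⁆ = ⁅rootElement k α t x, rootElement k α t y⁆ := by
  simp only [rootElement_apply]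
  obtain ⟨c, hc⟩ := ad_rootVector_sq k α x
  obtain ⟨d, hd⟩ := ad_rootVector_sq k α y
  set e := rootVector k α.1
  have h1 : ⁅e, ⁅x, y⁆⁆ = ⁅⁅e, x⁆, y⁆ + ⁅x, ⁅e, y⁆⁆ := leibniz_lie e x y
  have h3 : ⁅e, ⁅e, ⁅x, y⁆⁆⁆ =
      c • ⁅e, y⁆ + (2 : k) • ⁅⁅e, x⁆, ⁅e, y⁆⁆ - d • ⁅e, x⁆ := by
    rw [h1, lie_add, leibniz_lie e ⁅e, x⁆ y, leibniz_lie e x ⁅e, y⁆, hc, hd, smul_lie, lie_smul,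
      ← lie_skew x e, smul_neg, two_smul]
    abel
  have h4 : ⁅⁅e, x⁆, e⁆ = -(c • e) := by rw [← lie_skew, hc]
  rw [h3, h1, hc, hd]
  simp only [add_lie, lie_add, smul_lie, lie_smul, lie_self, h4, hd, ← lie_skew x e, smul_zero]
  have h5 : t ^ 2 / 2 * 2 = t ^ 2 := by field_simp
  match_scalars <;> first | ring1 | linear_combination h5

theorem lie_of_mem_adjointGroup (h2 : (2 : k) ≠ 0) {g : E8 k ≃ₗ[k] E8 k} (hg : g ∈ adjointGroup k)
    (x y : E8 k) : g ⁅x, y⁆ = ⁅g x, g y⁆ := by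
  induction hg using Subgroup.closure_induction generalizing x y with
  | mem g hg =>
    obtain ⟨α, t, h⟩ := hg
    have h' : ∀ z, g z = rootElement k α t z := fun z => congrArg (fun f => f z) h
    simp only [h']
    exact rootElement_lie k h2 α t x y
  | one => rfl
  | mul g h _ _ ihg ihh => rw [LinearEquiv.mul_apply, ihh, ihg]; rfl
  | inv g _ ih =>
    have h1 : ∀ z, g (g⁻¹ z) = z := fun z => g.apply_symm_apply z
    refine g.injective ?_
    rw [h1, ih, h1, h1]

/-- The elements of the adjoint group as automorphisms of the Lie algebra. -/
theorem exists_lieEquiv (h2 : (2 : k) ≠ 0) {g : E8 k ≃ₗ[k] E8 k} (hg : g ∈ adjointGroup k) :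
    ∃ φ : E8 k ≃ₗ⁅k⁆ E8 k, ∀ x, φ x = g x :=
  ⟨{ g with map_lie' := fun {x y} => lie_of_mem_adjointGroup k h2 hg x y }, fun _ => rfl⟩

end Automorphisms

/-! ### The adapted basis -/

/-- The permutation of `0, …, 6` that takes a matrix unit to its transpose. -/
def starIndex (a : ℕ) : ℕ := [3, 4, 5, 0, 1, 2, 6].getD a 0

/-- The index of the dual basis vector, up to sign. -/
def dualIndex (j : ℕ) : ℕ :=
  bif Nat.blt j 8 then 240 + j else
  bif Nat.blt j 71 then 159 + 9 * starIndex ((j - 8) / 9) + (8 - (j - 8) % 9) else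
  bif Nat.blt j 78 then 71 + starIndex (j - 71) else
  bif Nat.blt j 96 then j + 144 else
  bif Nat.blt j 159 then 96 + 9 * starIndex ((j - 96) / 9) + (8 - (j - 96) % 9) else
  bif Nat.blt j 222 then 8 + 9 * starIndex ((j - 159) / 9) + (8 - (j - 159) % 9) else
  bif Nat.blt j 240 then j - 144 else j - 240

/-- The sign of a basis vector in the dual basis. -/
def dualSign (j : ℕ) : ℕ :=
  bif Nat.beq ((j - 8) / 9) 6 && Nat.blt j 71 || Nat.beq j 77 || Nat.ble 96 j && Nat.blt j 150 ||
    Nat.ble 213 j && Nat.blt j 222 then 2 else 1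

/-- The Gram matrix of the adapted basis is a signed permutation matrix. -/
def gramCheck : Bool :=
  (List.range 248).all fun i => (List.range 248).all fun j =>
    Nat.beq (Vec.form (vec (dualIndex i)) (vec j)) (bif Nat.beq i j then dualSign i else 0)

-- The invariant form thus supplies the coordinate functionals. `dualIndex` pairs A with the last 8
-- vectors, U(a, m) with Z(a*, 8 - m), B_a with B_{a*}, the lift of W(2; 1) with the 18 vectors from
-- 222 on, and Y(a, m) with Y(a*, 8 - m), where * transposes matrix units.
set_option maxRecDepth 100000 in
theorem gramCheck_eq : gramCheck = true := by decide +kernel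

def tableValid : Bool := (List.range 248).all fun i =>
  (vec i).all (fun t => t.2.valid) && Nat.blt (dualIndex i) 248 &&
    Nat.beq (dualIndex (dualIndex i)) i

set_option maxRecDepth 100000 in
theorem tableValid_eq : tableValid = true := by decide +kernel

end E8

namespace E8

theorem valid_vec (j : ℕ) : (vec j).valid := by
  intro t ht
  by_cases hj : j < 248
  · have h := List.all_eq_true.1 tableValid_eq j (List.mem_range.2 hj)
    simp only [Bool.and_eq_true] at h
    exact List.all_eq_true.1 h.1.1 t ht
  · have : vec j = [] := List.getD_eq_default _ _ (by
      have : table.length = 248 := by decide +kernel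
      omega)
    rw [this] at ht
    simp at ht

/-! ### Coordinates in the adapted basis, transported by an automorphism. -/

section Adapted

variable {k : Type*} [Field k] [CharP k 3] (φ : E8 k ≃ₗ⁅k⁆ E8 k)

/-- The value of a formal linear combination, twisted by an automorphism. -/
def ev (u : Vec) : E8 k := φ (eval k u)

omit [CharP k 3] in
theorem ev_append (u v : Vec) : ev φ (u ++ v) = ev φ u + ev φ v := by
  rw [ev, eval_append, map_add]; rfl

omit [CharP k 3] in
theorem ev_smul (c : ℕ) (u : Vec) : ev φ (u.smul c) = (c : k) • ev φ u := by
  rw [ev, eval_smul, map_smul]; rfl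

theorem lie_ev {u v : Vec} (hu : u.valid) (hv : v.valid) :
    ⁅ev φ u, ev φ v⁆ = ev φ (u.bracket v) := by
  rw [ev, ev, ← LieEquiv.map_lie, (bracket_sound k hu hv).1]; rfl

theorem ev_eq_zero {u : Vec} (hu : u.valid) (h : u.isZero = true) : ev φ u = 0 := by
  rw [ev, eval_eq_zero k hu h, map_zero]

/-- The adapted basis vectors. -/
def bv (j : ℕ) : E8 k := ev φ (vec j)

/-- The invariant form, twisted by an automorphism. -/
def kap : LinearMap.BilinForm k (E8 k) :=
  (invForm k).compl₁₂ φ.symm.toLinearEquiv.toLinearMap φ.symm.toLinearEquiv.toLinearMap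

omit [CharP k 3] in
theorem kap_apply (x y : E8 k) : kap φ x y = invForm k (φ.symm x) (φ.symm y) := rfl

omit [CharP k 3] in
theorem kap_comm (x y : E8 k) : kap φ x y = kap φ y x := invForm_comm k _ _

omit [CharP k 3] in
theorem kap_lie (x y z : E8 k) : kap φ ⁅x, y⁆ z = kap φ x ⁅y, z⁆ := by
  simp only [kap_apply, LieEquiv.map_lie, invForm_lie]

theorem kap_ev {u v : Vec} (hu : u.valid) (hv : v.valid) :
    kap φ (ev φ u) (ev φ v) = (Vec.form u v : k) := by
  rw [kap_apply, ev, ev, LieEquiv.symm_apply_apply, LieEquiv.symm_apply_apply,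
    form_sound k hu hv]

/-- The coordinates with respect to the adapted basis. -/
def coord (j : ℕ) : E8 k →ₗ[k] k := (dualSign j : k) • kap φ (bv φ (dualIndex j))

omit [CharP k 3] in
theorem coord_apply (j : ℕ) (x : E8 k) :
    coord φ j x = dualSign j * kap φ (bv φ (dualIndex j)) x := rfl

theorem dualSign_sq (j : ℕ) : (dualSign j : k) * dualSign j = 1 := by
  unfold dualSign
  cases _ : (Nat.beq ((j - 8) / 9) 6 && Nat.blt j 71 || Nat.beq j 77 ||
    Nat.ble 96 j && Nat.blt j 150 || Nat.ble 213 j && Nat.blt j 222)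
  · simp
  · simp only [cond_true]
    push_cast
    linear_combination three_eq_zero k

theorem dualSign_ne_zero (j : ℕ) : (dualSign j : k) ≠ 0 := fun h => by
  have := dualSign_sq (k := k) j
  rw [h] at this
  simp at this

theorem coord_bv {i j : ℕ} (hi : i < 248) (hj : j < 248) :
    coord φ i (bv φ j) = if i = j then 1 else 0 := by
  have h := List.all_eq_true.1 (List.all_eq_true.1 gramCheck_eq i (List.mem_range.2 hi)) j
    (List.mem_range.2 hj)
  rw [coord_apply, bv, bv, kap_ev φ (valid_vec _) (valid_vec _), Nat.eq_of_beq_eq_true h]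
  by_cases hij : i = j
  · subst hij
    simp [dualSign_sq]
  · have : Nat.beq i j = false := by
      rw [Bool.eq_false_iff]; exact fun h => hij (Nat.eq_of_beq_eq_true h)
    simp [this, hij]

/-- The coordinate functionals make the 248 vectors independent, and `finrank_le` makes them span.
-/
theorem sum_coord (x : E8 k) : ∑ j ∈ Finset.range 248, coord φ j x • bv φ j = x := by
  have hli : LinearIndependent k fun j : Fin 248 => bv φ j := by
    rw [Fintype.linearIndependent_iff]
    intro g hg i
    have := congrArg (coord φ i) hg
    simpa [coord_bv, Fin.val_inj] using this
  have hspan : ⊤ ≤ Submodule.span k (Set.range fun j : Fin 248 => bv φ j) := by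
    refine le_of_eq (Submodule.eq_top_of_finrank_eq ?_).symm
    have h := finrank_span_eq_card hli
    refine le_antisymm (Submodule.finrank_le _) ?_
    rw [h, Fintype.card_fin]
    exact finrank_le k
  have hx := hspan (Submodule.mem_top (x := x))
  induction hx using Submodule.span_induction with
  | mem x h =>
    obtain ⟨j, rfl⟩ := h
    rw [Finset.sum_eq_single (j : ℕ)]
    · rw [coord_bv φ j.2 j.2, if_pos rfl, one_smul]
    · intro i hi hij
      rw [coord_bv φ (Finset.mem_range.1 hi) j.2, if_neg hij, zero_smul]
    · intro h; exact absurd (Finset.mem_range.2 j.2) h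
  | zero => simp
  | add x y _ _ hx hy => simp only [map_add, add_smul, Finset.sum_add_distrib, hx, hy]
  | smul c x _ hx => simp only [map_smul, smul_assoc, ← Finset.smul_sum, hx]

theorem coord_eq_zero_iff {j : ℕ} {x : E8 k} : coord φ j x = 0 ↔ kap φ (bv φ (dualIndex j)) x = 0 := by
  rw [coord_apply, mul_eq_zero, or_iff_right (dualSign_ne_zero j)]

theorem mem_of_coord {S : Submodule k (E8 k)} {x : E8 k}
    (h : ∀ j < 248, coord φ j x ≠ 0 → bv φ j ∈ S) : x ∈ S := by
  rw [← sum_coord φ x]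
  refine S.sum_mem fun j hj => ?_
  by_cases h0 : coord φ j x = 0
  · rw [h0, zero_smul]; exact S.zero_mem
  · exact S.smul_mem _ (h j (Finset.mem_range.1 hj) h0)

/-- The span of the first `n` basis vectors. -/
def low (n : ℕ) : Submodule k (E8 k) where
  carrier := {x | ∀ j, n ≤ j → j < 248 → coord φ j x = 0}
  zero_mem' := by simp
  add_mem' hx hy j h1 h2 := by rw [map_add, hx j h1 h2, hy j h1 h2, add_zero]
  smul_mem' c x hx j h1 h2 := by rw [map_smul, hx j h1 h2, smul_zero]

theorem bv_mem_low {n j : ℕ} (hj : j < n) : bv φ j ∈ low φ n := fun i h1 h2 => by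
  rw [coord_bv φ h2 (by omega), if_neg (by omega)]

omit [CharP k 3] in
theorem low_mono {m n : ℕ} (h : m ≤ n) : low φ m ≤ low φ n := fun _ hx j h1 h2 =>
  hx j (h.trans h1) h2

theorem low_le_iff {n : ℕ} {S : Submodule k (E8 k)} :
    low φ n ≤ S ↔ ∀ j < n, bv φ j ∈ S := by
  refine ⟨fun h j hj => h (bv_mem_low φ hj), fun h x hx => mem_of_coord φ fun j hj h0 => ?_⟩
  refine h j ?_
  by_contra hjn
  exact h0 (hx j (by omega) hj)

theorem sum_coord_low {n : ℕ} (hn : n ≤ 248) {x : E8 k} (hx : x ∈ low φ n) :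
    ∑ j ∈ Finset.range n, coord φ j x • bv φ j = x := by
  conv_rhs => rw [← sum_coord φ x]
  refine Finset.sum_subset (Finset.range_mono hn) fun j h1 h2 => ?_
  rw [hx j (by simpa using h2) (Finset.mem_range.1 h1), zero_smul]

theorem finrank_low {n : ℕ} (hn : n ≤ 248) : Module.finrank k (low φ n) = n := by
  have hli : LinearIndependent k fun j : Fin n => bv φ j := by
    rw [Fintype.linearIndependent_iff]
    intro g hg i
    have := congrArg (coord φ i) hg
    have h1 : ∀ a : Fin n, (a : ℕ) < 248 := fun a => by omega
    simpa [coord_bv, h1, Fin.val_inj] using this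
  have h := finrank_span_eq_card hli
  rw [Fintype.card_fin] at h
  have : low φ n = Submodule.span k (Set.range fun j : Fin n => bv φ j) := by
    refine le_antisymm ((low_le_iff φ).2 fun j hj => Submodule.subset_span ⟨⟨j, hj⟩, rfl⟩) ?_
    rw [Submodule.span_le]
    rintro _ ⟨j, rfl⟩
    exact bv_mem_low φ j.2
  rw [this, h]

/-! ### Closure under brackets -/

/-- Evaluates the terms of a formal linear combination before passing it to a function. -/
def force (u : Vec) (f : Vec → Bool) : Bool :=
  match u with
  | [] => f []
  | (c, g) :: u => bif Nat.beq (c % 3) 0 then force u f else bif Nat.beq (c % 3) 1 then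
      force u fun u => f ((1, g) :: u) else force u fun u => f ((2, g) :: u)

-- `force` passes on a list in which every coefficient is the numeral 1 or 2 and vanishing terms are
-- gone; the kernel then computes a bracket once instead of unfolding it again in every coordinate
-- test.
omit [CharP k 3] in
theorem force_sound {u : Vec} (hu : u.valid) {f : Vec → Bool} (h : force u f = true)
    [CharP k 3] : ∃ u' : Vec, u'.valid ∧ ev φ u' = ev φ u ∧ f u' = true := by
  induction u generalizing f with
  | nil => exact ⟨[], hu, rfl, h⟩
  | cons t u ih =>
    obtain ⟨c, g⟩ := t
    have hg : g.valid = true := hu (c, g) (by simp)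
    have hu' : Vec.valid u := fun t ht => hu t (by simp [ht])
    have cons : ∀ (c : ℕ) (u : Vec), ev φ ((c, g) :: u) = (c : k) • φ (genEval k g) + ev φ u :=
      fun c u => by rw [ev, eval_cons, map_add, map_smul]; rfl
    have hc := cast_mod_three k c
    rw [force] at h
    cases h0 : Nat.beq (c % 3) 0
    · rw [h0, cond_false] at h
      cases h1 : Nat.beq (c % 3) 1
      · rw [h1, cond_false] at h
        obtain ⟨u', h2, h3, h4⟩ := ih hu' h
        refine ⟨_, ?_, ?_, h4⟩
        · intro t ht
          rcases List.mem_cons.1 ht with rfl | ht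
          · exact hg
          · exact h2 t ht
        · have h5 : c % 3 = 2 := by
            have := Nat.ne_of_beq_eq_false h0
            have := Nat.ne_of_beq_eq_false h1
            omega
          rw [cons, cons, h3, ← hc, h5]
      · rw [h1, cond_true] at h
        obtain ⟨u', h2, h3, h4⟩ := ih hu' h
        refine ⟨_, ?_, ?_, h4⟩
        · intro t ht
          rcases List.mem_cons.1 ht with rfl | ht
          · exact hg
          · exact h2 t ht
        · rw [cons, cons, h3, ← hc, Nat.eq_of_beq_eq_true h1]
    · rw [h0, cond_true] at h
      obtain ⟨u', h2, h3, h4⟩ := ih hu' h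
      refine ⟨u', h2, ?_, h4⟩
      rw [cons, h3, ← hc, Nat.eq_of_beq_eq_true h0]
      simp

/-- The coordinate at `t` is nonzero, and all other nonzero coordinates are at known places. -/
def isUnitStep (known : List ℕ) (t : ℕ) (u : Vec) : Bool :=
  Vec.isZero (u ++ vec t) || Vec.isZero (u ++ (vec t).smul 2) ||
    !Nat.beq (Vec.form (vec (dualIndex t)) u) 0 && (List.range 248).all fun r =>
      Nat.beq (Vec.form (vec (dualIndex r)) u) 0 || Nat.beq r t || known.any (Nat.beq r)

omit [CharP k 3] in
theorem form_lt (u v : Vec) : Vec.form u v < 3 := Nat.mod_lt _ (by norm_num)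

theorem cast_eq_zero_of_lt {n : ℕ} (h : n < 3) : (n : k) = 0 ↔ n = 0 := by
  rw [CharP.cast_eq_zero_iff k 3]
  refine ⟨fun h' => Nat.eq_zero_of_dvd_of_lt h' h, fun h' => h' ▸ dvd_zero 3⟩

theorem coord_ev_eq_zero_iff {u : Vec} (hu : u.valid) (j : ℕ) :
    coord φ j (ev φ u) = 0 ↔ Vec.form (vec (dualIndex j)) u = 0 := by
  rw [coord_eq_zero_iff, bv, kap_ev φ (valid_vec _) hu, cast_eq_zero_of_lt (form_lt _ _)]

/-- The other basis vectors that occur in u are already in S, so the relation can be solved for the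
t-th one. The first two alternatives, u = -`vec t` and u = `vec t`, spare the computation of all 248
coordinates. -/
theorem mem_of_isUnitStep {S : Submodule k (E8 k)} {known : List ℕ} {t : ℕ} {u : Vec}
    (hu : u.valid) (hS : ev φ u ∈ S) (hk : ∀ j ∈ known, bv φ j ∈ S) (ht : t < 248)
    (h : isUnitStep known t u = true) : bv φ t ∈ S := by
  simp only [isUnitStep, Bool.and_eq_true, Bool.not_eq_true', List.all_eq_true, List.mem_range,
    Bool.or_eq_true, List.any_eq_true, Nat.beq_eq] at h
  rcases h with (h | h) | ⟨h1, h2⟩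
  · have h0 := ev_eq_zero φ (append_valid hu (valid_vec t)) h
    rw [ev_append] at h0
    exact (S.add_mem_iff_right hS).1 (h0 ▸ S.zero_mem)
  · have h0 := ev_eq_zero φ (append_valid hu (smul_valid (valid_vec t) 2)) h
    rw [ev_append, ev_smul] at h0
    have h2 : ((2 : ℕ) : k) ≠ 0 := fun h2 =>
      absurd ((cast_eq_zero_of_lt (by norm_num)).1 h2) (by norm_num)
    exact (S.smul_mem_iff h2).1 ((S.add_mem_iff_right hS).1 (h0 ▸ S.zero_mem))
  have h3 : coord φ t (ev φ u) ≠ 0 := fun h0 =>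
    Nat.ne_of_beq_eq_false h1 ((coord_ev_eq_zero_iff φ hu t).1 h0)
  have h4 := sum_coord φ (ev φ u)
  rw [← Finset.add_sum_erase _ _ (Finset.mem_range.2 ht)] at h4
  have h5 : ∑ j ∈ (Finset.range 248).erase t, coord φ j (ev φ u) • bv φ j ∈ S := by
    refine S.sum_mem fun j hj => ?_
    rw [Finset.mem_erase, Finset.mem_range] at hj
    rcases h2 j hj.2 with (h | h) | ⟨r, h, h'⟩
    · rw [(coord_ev_eq_zero_iff φ hu j).2 h, zero_smul]; exact S.zero_mem
    · exact absurd h hj.1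
    · rw [h']; exact S.smul_mem _ (hk r h)
  have h6 := S.sub_mem hS h5
  rw [← eq_sub_of_add_eq h4] at h6
  exact (S.smul_mem_iff h3).1 h6

/-- The steps `(x, s, t)` of the list show in turn that the `t`-th basis vector is in the closure,
as the bracket of the basis vectors with indices `x` and `s`. -/
def closes (ok : List ℕ → ℕ → ℕ → Bool) (targets : List ℕ) :
    List (ℕ × ℕ × ℕ) → List ℕ → Bool
  | [], known => targets.all fun t => known.any (Nat.beq t)
  | (x, s, t) :: steps, known =>
    ok known x s && Nat.blt t 248 && force ((vec x).bracket (vec s)) (isUnitStep known t) &&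
      closes ok targets steps (t :: known)

/-- The predicate `ok` says which brackets stay in S, so one format of certificate serves for spaces
stable under an action, for subalgebras and for the image of ad e. -/
theorem mem_of_closes {ok : List ℕ → ℕ → ℕ → Bool} {targets : List ℕ}
    {steps : List (ℕ × ℕ × ℕ)} {S : Submodule k (E8 k)}
    (hS : ∀ known x s, (∀ j ∈ known, bv φ j ∈ S) → ok known x s = true →
      ⁅bv φ x, bv φ s⁆ ∈ S) {known : List ℕ}
    (h : closes ok targets steps known = true) (hk : ∀ j ∈ known, bv φ j ∈ S) :
    ∀ t ∈ targets, bv φ t ∈ S := by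
  induction steps generalizing known with
  | nil =>
    intro t ht
    have := List.all_eq_true.1 h t ht
    obtain ⟨r, h1, h2⟩ := List.any_eq_true.1 this
    rw [Nat.eq_of_beq_eq_true h2]
    exact hk r h1
  | cons a steps ih =>
    obtain ⟨x, s, t⟩ := a
    rw [closes] at h
    simp only [Bool.and_eq_true] at h
    obtain ⟨⟨⟨h1, h2⟩, h3⟩, h4⟩ := h
    have h5 := hS known x s hk h1
    rw [bv, bv, lie_ev φ (valid_vec _) (valid_vec _)] at h5
    obtain ⟨u, hu, hu', hu''⟩ := force_sound (k := k) φ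
      (bracket_sound k (valid_vec _) (valid_vec _)).2 h3
    rw [← hu'] at h5
    refine ih h4 fun j hj => ?_
    rcases List.mem_cons.1 hj with rfl | hj
    · exact mem_of_isUnitStep φ hu h5 hk (Nat.le_of_ble_eq_true h2) hu''
    · exact hk j hj

end Adapted

end E8

namespace E8

/-! ### Generation -/

/-- From `Y(0, 0)` to the orthogonal space of the normalizer, by the action of the normalizer. -/
def perpSteps : List (ℕ × ℕ × ℕ) :=
  [(0, 96, 8), (1, 96, 9), (2, 96, 10), (3, 96, 11), (4, 96, 12), (5, 96, 13), (6, 96, 14),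
    (7, 96, 15), (17, 96, 141), (18, 96, 142), (19, 96, 143), (20, 96, 144), (21, 96, 145),
    (22, 96, 146), (23, 96, 147), (24, 96, 148), (25, 96, 149), (26, 96, 132), (27, 96, 133),
    (28, 96, 134), (29, 96, 135), (30, 96, 136), (31, 96, 137), (32, 96, 138), (33, 96, 139),
    (34, 96, 140), (35, 96, 150), (63, 96, 97), (64, 96, 98), (65, 96, 99), (66, 96, 100),
    (67, 96, 101), (68, 96, 102), (69, 96, 103), (70, 96, 104), (73, 96, 114), (74, 96, 105),
    (17, 8, 53), (18, 8, 54), (19, 8, 55), (20, 8, 56), (21, 8, 57), (22, 8, 58), (23, 8, 59),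
    (24, 8, 60), (25, 8, 61), (26, 8, 44), (27, 8, 45), (28, 8, 46), (29, 8, 47), (30, 8, 48),
    (31, 8, 49), (32, 8, 50), (33, 8, 51), (34, 8, 52), (35, 8, 62), (36, 8, 63), (37, 8, 64),
    (38, 8, 65), (39, 8, 66), (40, 8, 67), (41, 8, 68), (42, 8, 69), (43, 8, 70), (70, 8, 16),
    (73, 8, 26), (74, 8, 17), (38, 9, 0), (39, 9, 1), (40, 9, 2), (41, 9, 3), (42, 9, 4),
    (43, 9, 5), (73, 9, 27), (74, 9, 18), (73, 10, 28), (74, 10, 19), (42, 11, 6), (43, 11, 7),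
    (73, 11, 29), (74, 11, 20), (73, 12, 30), (74, 12, 21), (73, 13, 31), (74, 13, 22),
    (73, 14, 32), (74, 14, 23), (73, 15, 33), (74, 15, 24), (35, 97, 151), (37, 97, 80),
    (40, 97, 83), (43, 97, 86), (73, 97, 115), (74, 97, 106), (35, 98, 152), (73, 98, 116),
    (74, 98, 107), (35, 99, 153), (41, 99, 93), (42, 99, 94), (43, 99, 95), (73, 99, 117),
    (74, 99, 108), (35, 100, 154), (73, 100, 118), (74, 100, 109), (35, 101, 155), (73, 101, 119),
    (74, 101, 110), (35, 102, 156), (73, 102, 120), (74, 102, 111), (35, 103, 157), (73, 103, 121),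
    (74, 103, 112), (35, 104, 158), (73, 104, 122), (74, 104, 113), (26, 105, 123), (27, 105, 124),
    (28, 105, 125), (29, 105, 126), (30, 105, 127), (31, 105, 128), (32, 105, 129), (33, 105, 130),
    (34, 105, 131), (45, 105, 78), (46, 105, 79), (47, 105, 87), (50, 105, 90), (20, 133, 88),
    (23, 133, 91), (20, 134, 89), (23, 134, 92), (18, 135, 81), (19, 135, 82), (21, 135, 84),
    (22, 135, 85), (73, 16, 34), (74, 16, 25), (26, 17, 35), (27, 17, 36), (28, 17, 37),
    (29, 17, 38), (30, 17, 39), (31, 17, 40), (32, 17, 41), (33, 17, 42), (34, 17, 43)]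

/-- From the orthogonal space of the normalizer and `Z(0, 0)` to all of the first `240` vectors but
those of the abelian ideal. -/
def radicalSteps : List (ℕ × ℕ × ℕ) :=
  [(17, 159, 204), (18, 159, 205), (19, 159, 206), (20, 159, 207), (21, 159, 208), (22, 159, 209),
    (23, 159, 210), (24, 159, 211), (25, 159, 212), (26, 159, 195), (27, 159, 196), (28, 159, 197),
    (29, 159, 198), (30, 159, 199), (31, 159, 200), (32, 159, 201), (33, 159, 202), (34, 159, 203),
    (35, 159, 213), (52, 159, 71), (61, 159, 76), (63, 159, 160), (64, 159, 161), (65, 159, 162),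
    (66, 159, 163), (67, 159, 164), (68, 159, 165), (69, 159, 166), (70, 159, 167), (73, 159, 177),
    (74, 159, 168), (73, 71, 75), (74, 71, 77), (74, 76, 72), (35, 160, 214), (37, 160, 237),
    (40, 160, 234), (43, 160, 231), (73, 160, 178), (74, 160, 169), (35, 161, 215), (73, 161, 179),
    (74, 161, 170), (35, 162, 216), (41, 162, 224), (42, 162, 223), (43, 162, 222), (73, 162, 180),
    (74, 162, 171), (35, 163, 217), (73, 163, 181), (74, 163, 172), (35, 164, 218), (73, 164, 182),
    (74, 164, 173), (35, 165, 219), (73, 165, 183), (74, 165, 174), (35, 166, 220), (73, 166, 184),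
    (74, 166, 175), (35, 167, 221), (73, 167, 185), (74, 167, 176), (26, 168, 186), (27, 168, 187),
    (28, 168, 188), (29, 168, 189), (30, 168, 190), (31, 168, 191), (32, 168, 192), (33, 168, 193),
    (34, 168, 194), (43, 168, 74), (45, 168, 239), (46, 168, 238), (47, 168, 230), (50, 168, 227),
    (43, 177, 73), (20, 196, 229), (23, 196, 226), (20, 197, 228), (23, 197, 225), (18, 198, 236),
    (19, 198, 235), (21, 198, 233), (22, 198, 232)]

/-- Brackets with the nilpotent element. -/
def rangeSteps : List (ℕ × ℕ × ℕ) :=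
  [(0, 81, 0), (0, 82, 1), (0, 83, 2), (0, 84, 3), (0, 85, 4), (0, 86, 5), (0, 94, 6), (0, 95, 7),
    (0, 96, 8), (0, 97, 9), (0, 98, 10), (0, 99, 11), (0, 100, 12), (0, 101, 13), (0, 102, 14),
    (0, 103, 15), (0, 104, 16), (0, 105, 17), (0, 106, 18), (0, 107, 19), (0, 108, 20),
    (0, 109, 21), (0, 110, 22), (0, 111, 23), (0, 112, 24), (0, 113, 25), (0, 114, 26),
    (0, 115, 27), (0, 116, 28), (0, 117, 29), (0, 118, 30), (0, 119, 31), (0, 120, 32),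
    (0, 121, 33), (0, 122, 34), (0, 123, 35), (0, 124, 36), (0, 125, 37), (0, 126, 38),
    (0, 127, 39), (0, 128, 40), (0, 129, 41), (0, 130, 42), (0, 131, 43), (0, 132, 44),
    (0, 133, 45), (0, 134, 46), (0, 135, 47), (0, 136, 48), (0, 137, 49), (0, 138, 50),
    (0, 139, 51), (0, 140, 52), (0, 141, 53), (0, 142, 54), (0, 143, 55), (0, 144, 56),
    (0, 145, 57), (0, 146, 58), (0, 147, 59), (0, 148, 60), (0, 149, 61), (0, 150, 62),
    (0, 151, 63), (0, 152, 64), (0, 153, 65), (0, 154, 66), (0, 155, 67), (0, 156, 68),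
    (0, 157, 69), (0, 158, 70), (0, 159, 96), (0, 160, 97), (0, 161, 98), (0, 162, 99),
    (0, 163, 100), (0, 164, 101), (0, 165, 102), (0, 166, 103), (0, 167, 104), (0, 168, 105),
    (0, 169, 106), (0, 170, 107), (0, 171, 108), (0, 172, 109), (0, 173, 110), (0, 174, 111),
    (0, 175, 112), (0, 176, 113), (0, 177, 114), (0, 178, 115), (0, 179, 116), (0, 180, 117),
    (0, 181, 118), (0, 182, 119), (0, 183, 120), (0, 184, 121), (0, 185, 122), (0, 186, 123),
    (0, 187, 124), (0, 188, 125), (0, 189, 126), (0, 190, 127), (0, 191, 128), (0, 192, 129),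
    (0, 193, 130), (0, 194, 131), (0, 195, 132), (0, 196, 133), (0, 197, 134), (0, 198, 135),
    (0, 199, 136), (0, 200, 137), (0, 201, 138), (0, 202, 139), (0, 203, 140), (0, 204, 141),
    (0, 205, 142), (0, 206, 143), (0, 207, 144), (0, 208, 145), (0, 209, 146), (0, 210, 147),
    (0, 211, 148), (0, 212, 149), (0, 213, 150), (0, 214, 151), (0, 215, 152), (0, 216, 153),
    (0, 217, 154), (0, 218, 155), (0, 219, 156), (0, 220, 157), (0, 221, 158), (0, 222, 95),
    (0, 223, 94), (0, 224, 93), (0, 225, 92), (0, 226, 91), (0, 227, 90), (0, 228, 89),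
    (0, 229, 88), (0, 230, 87), (0, 231, 86), (0, 232, 85), (0, 233, 84), (0, 234, 83),
    (0, 235, 82), (0, 236, 81), (0, 237, 80), (0, 238, 79), (0, 239, 78)]

/-- From `U(3, 0)` to the ideal spanned by the `U(a, m)`, modulo the abelian ideal. -/
def idealSteps : List (ℕ × ℕ × ℕ) :=
  [(8, 35, 62), (9, 35, 63), (10, 35, 64), (11, 35, 65), (12, 35, 66), (13, 35, 67), (14, 35, 68),
    (15, 35, 69), (16, 35, 70), (44, 35, 26), (45, 35, 27), (46, 35, 28), (47, 35, 29),
    (48, 35, 30), (49, 35, 31), (50, 35, 32), (51, 35, 33), (52, 35, 34), (53, 35, 17),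
    (54, 35, 18), (55, 35, 19), (56, 35, 20), (57, 35, 21), (58, 35, 22), (59, 35, 23),
    (60, 35, 24), (61, 35, 25), (63, 35, 36), (64, 35, 37), (65, 35, 38), (66, 35, 39),
    (67, 35, 40), (68, 35, 41), (69, 35, 42), (70, 35, 43), (71, 35, 44), (76, 35, 53), (9, 17, 54),
    (10, 17, 55), (11, 17, 56), (12, 17, 57), (13, 17, 58), (14, 17, 59), (15, 17, 60),
    (16, 17, 61), (71, 17, 8), (71, 18, 9), (71, 19, 10), (71, 20, 11), (71, 21, 12), (71, 22, 13),
    (71, 23, 14), (71, 24, 15), (71, 25, 16), (9, 26, 45), (10, 26, 46), (11, 26, 47), (12, 26, 48),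
    (13, 26, 49), (14, 26, 50), (15, 26, 51), (16, 26, 52)]

/-- From the normalizer and `Y(3, 0)` to the whole algebra. -/
def topSteps : List (ℕ × ℕ × ℕ) :=
  [(123, 8, 150), (123, 9, 151), (150, 9, 97), (123, 10, 152), (150, 10, 98), (123, 11, 153),
    (150, 11, 99), (151, 11, 100), (152, 11, 101), (123, 12, 154), (153, 12, 103), (123, 13, 155),
    (153, 13, 104), (123, 14, 156), (150, 14, 102), (123, 15, 157), (123, 16, 158), (97, 17, 142),
    (98, 17, 143), (99, 17, 144), (100, 17, 145), (101, 17, 146), (102, 17, 147), (103, 17, 148),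
    (104, 17, 149), (150, 17, 105), (151, 17, 106), (152, 17, 107), (153, 17, 108), (154, 17, 109),
    (155, 17, 110), (156, 17, 111), (157, 17, 112), (158, 17, 113), (97, 26, 133), (98, 26, 134),
    (99, 26, 135), (100, 26, 136), (101, 26, 137), (102, 26, 138), (103, 26, 139), (104, 26, 140),
    (106, 26, 124), (107, 26, 125), (108, 26, 126), (109, 26, 127), (110, 26, 128), (111, 26, 129),
    (112, 26, 130), (113, 26, 131), (150, 26, 114), (151, 26, 115), (152, 26, 116), (153, 26, 117),
    (154, 26, 118), (155, 26, 119), (156, 26, 120), (157, 26, 121), (158, 26, 122), (150, 44, 132),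
    (132, 53, 96), (150, 53, 141), (96, 123, 213), (132, 123, 177), (133, 123, 178),
    (134, 123, 179), (135, 123, 180), (136, 123, 181), (137, 123, 182), (138, 123, 183),
    (139, 123, 184), (140, 123, 185), (141, 123, 168), (142, 123, 169), (143, 123, 170),
    (144, 123, 171), (145, 123, 172), (146, 123, 173), (147, 123, 174), (148, 123, 175),
    (149, 123, 176), (150, 123, 186), (151, 123, 187), (152, 123, 188), (153, 123, 189),
    (154, 123, 190), (155, 123, 191), (156, 123, 192), (157, 123, 193), (158, 123, 194),
    (168, 8, 204), (169, 8, 205), (170, 8, 206), (171, 8, 207), (172, 8, 208), (173, 8, 209),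
    (174, 8, 210), (175, 8, 211), (176, 8, 212), (177, 8, 195), (178, 8, 196), (179, 8, 197),
    (180, 8, 198), (181, 8, 199), (182, 8, 200), (183, 8, 201), (184, 8, 202), (185, 8, 203),
    (187, 8, 214), (188, 8, 215), (189, 8, 216), (190, 8, 217), (191, 8, 218), (192, 8, 219),
    (193, 8, 220), (194, 8, 221), (213, 8, 159), (186, 9, 239), (187, 9, 238), (188, 9, 237),
    (189, 9, 236), (190, 9, 235), (191, 9, 234), (192, 9, 233), (193, 9, 232), (194, 9, 231),
    (213, 9, 160), (214, 9, 161), (216, 9, 163), (217, 9, 164), (219, 9, 166), (220, 9, 167),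
    (186, 11, 230), (187, 11, 229), (188, 11, 228), (189, 11, 227), (190, 11, 226), (191, 11, 225),
    (192, 11, 224), (193, 11, 223), (194, 11, 222), (213, 11, 162), (216, 11, 165), (187, 96, 247),
    (188, 96, 246), (189, 96, 245), (190, 96, 244), (191, 96, 243), (192, 96, 242), (193, 96, 241),
    (194, 96, 240)]

/-- Brackets of one of the first `n` basis vectors with a known one. -/
def actionBy (n : ℕ) (known : List ℕ) (x s : ℕ) : Bool := Nat.blt x n && known.any (Nat.beq s)

/-- Brackets of known basis vectors. -/
def bothKnown (known : List ℕ) (x s : ℕ) : Bool := known.any (Nat.beq x) && known.any (Nat.beq s)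

/-- Brackets with the nilpotent element. -/
def withNilpotent (_ : List ℕ) (x _ : ℕ) : Bool := Nat.beq x 0

/-- The indices of the orthogonal space of the normalizer. -/
def perpIndices : List ℕ := List.range 71 ++ List.range' 78 81

-- `perpIndices` lists the indices 0–70 and 78–158, those whose dual index is at least 96; they span
-- the orthogonal space of `low φ 96`, which Y(0, 0) therefore generates under 𝔴.
set_option maxRecDepth 100000 in
theorem perpSteps_closes : closes (actionBy 96) perpIndices perpSteps [96] = true := by
  decide +kernel

-- Only the first 78 vectors act here, so that the argument applies to every algebra that contains
-- the centraliser of e.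
set_option maxRecDepth 100000 in
theorem radicalSteps_closes :
    closes (actionBy 78) (List.range' 8 232) radicalSteps (159 :: perpIndices) = true := by
  decide +kernel

-- The list of known vectors starts empty: each step uses [e, z] for a basis vector z, so [e, 𝔤]
-- contains the orthogonal space of `low φ 96`.
set_option maxRecDepth 100000 in
theorem rangeSteps_closes : closes withNilpotent perpIndices rangeSteps [] = true := by
  decide +kernel

set_option maxRecDepth 100000 in
theorem idealSteps_closes :
    closes (actionBy 78) (List.range' 8 63) idealSteps (35 :: List.range 8) = true := by
  decide +kernel

set_option maxRecDepth 100000 in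
theorem topSteps_closes :
    closes bothKnown (List.range 248) topSteps (123 :: List.range 96) = true := by
  decide +kernel

end E8

/-! ### Monomials in truncated polynomials -/

namespace TruncPoly

variable (k : Type*) [Field k]

/-- The exponent with index `m`. -/
def expo (m : ℕ) : Fin 2 →₀ ℕ := Finsupp.single 0 (m / 3) + Finsupp.single 1 (m % 3)

theorem expo_zero (m : ℕ) : expo m 0 = m / 3 := by simp [expo]

theorem expo_one (m : ℕ) : expo m 1 = m % 3 := by simp [expo]

/-- The ideal is generated by monomials, so membership is read off from the exponents; this makes
coefficients of low monomials well defined on the quotient. -/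
theorem mem_truncIdeal {f : MvPolynomial (Fin 2) k} :
    f ∈ truncIdeal k ↔ ∀ s ∈ f.support, 3 ≤ s 0 ∨ 3 ≤ s 1 := by
  have h : truncIdeal k = Ideal.span ((fun s => MvPolynomial.monomial s (1 : k)) ''
      Set.range fun i : Fin 2 => Finsupp.single i 3) := by
    rw [truncIdeal, ← Set.range_comp]
    congr 1
    ext i
    simp [MvPolynomial.X_pow_eq_monomial]
  rw [h, MvPolynomial.mem_ideal_span_monomial_image]
  simp [Fin.exists_fin_two]

/-- The coefficient of the monomial with index `m < 9`. -/
def tcoef (m : ℕ) : TruncPoly k →ₗ[k] k :=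
  -- Reduction modulo 9 keeps both exponents below 3, so the functional descends to the quotient for
  -- every natural number m.
  Submodule.liftQ ((truncIdeal k).restrictScalars k) (MvPolynomial.lcoeff k (expo (m % 9)))
    (fun f hf => by
      rw [LinearMap.mem_ker, MvPolynomial.lcoeff_apply]
      by_contra h
      have := (mem_truncIdeal k).1 hf _ (MvPolynomial.mem_support_iff.2 h)
      rw [expo_zero, expo_one] at this
      omega)

theorem tcoef_mk (m : ℕ) (f : MvPolynomial (Fin 2) k) :
    tcoef k m (Ideal.Quotient.mk (truncIdeal k) f) = f.coeff (expo (m % 9)) := rfl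

/-- The monomial with index `m`. -/
def mono (m : ℕ) : TruncPoly k := x k 0 ^ (m / 3) * x k 1 ^ (m % 3)

theorem mk_monomial (s : Fin 2 →₀ ℕ) (a : k) :
    Ideal.Quotient.mk (truncIdeal k) (MvPolynomial.monomial s a) =
      a • (x k 0 ^ s 0 * x k 1 ^ s 1) := by
  have h : MvPolynomial.monomial s a =
      a • ((MvPolynomial.X 0 : MvPolynomial (Fin 2) k) ^ s 0 * MvPolynomial.X 1 ^ s 1) := by
    rw [MvPolynomial.monomial_eq, Finsupp.prod_fintype _ _ (by simp), Fin.prod_univ_two,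
      MvPolynomial.smul_eq_C_mul]
  rw [h, x, x, ← map_pow, ← map_pow, ← map_mul]
  rfl

theorem mono_eq_mk (m : ℕ) :
    mono k m = Ideal.Quotient.mk (truncIdeal k) (MvPolynomial.monomial (expo m) 1) := by
  rw [mk_monomial, one_smul, expo_zero, expo_one, mono]

theorem x_pow_three (i : Fin 2) : x k i ^ 3 = 0 := by
  rw [x, ← map_pow, Ideal.Quotient.eq_zero_iff_mem]
  exact Ideal.subset_span ⟨i, rfl⟩

theorem expo_injective {m n : ℕ} (h : expo m = expo n) : m = n := by
  have h0 := congrArg (fun f => f 0) h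
  have h1 := congrArg (fun f => f 1) h
  simp only [expo_zero, expo_one] at h0 h1
  omega

theorem tcoef_mono {m n : ℕ} (hm : m < 9) :
    tcoef k m (mono k n) = if m = n then 1 else 0 := by
  rw [mono_eq_mk, tcoef_mk, MvPolynomial.coeff_monomial, Nat.mod_eq_of_lt hm]
  by_cases h : m = n
  · simp [h]
  · rw [if_neg h, if_neg fun h' => h (expo_injective h').symm]

theorem sum_tcoef (f : TruncPoly k) : ∑ m ∈ Finset.range 9, tcoef k m f • mono k m = f := by
  obtain ⟨f, rfl⟩ := Ideal.Quotient.mk_surjective f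
  induction f using MvPolynomial.induction_on' with
  | monomial s a =>
    by_cases h : s 0 < 3 ∧ s 1 < 3
    · have hs : s = expo (3 * s 0 + s 1) := by
        refine Finsupp.ext fun i => ?_
        fin_cases i
        · exact (show s 0 = expo (3 * s 0 + s 1) 0 by rw [expo_zero]; omega)
        · exact (show s 1 = expo (3 * s 0 + s 1) 1 by rw [expo_one]; omega)
      have h1 : Ideal.Quotient.mk (truncIdeal k) (MvPolynomial.monomial s a) =
          a • mono k (3 * s 0 + s 1) := by
        rw [mk_monomial, mono]
        congr 3 <;> omega
      rw [h1, Finset.sum_eq_single (3 * s 0 + s 1)]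
      · rw [map_smul, tcoef_mono k (by omega), if_pos rfl, smul_eq_mul, mul_one]
      · intro m hm hne
        rw [map_smul, tcoef_mono k (Finset.mem_range.1 hm), if_neg hne, smul_zero, zero_smul]
      · intro h2
        exact absurd (Finset.mem_range.2 (by omega)) h2
    · have h1 : Ideal.Quotient.mk (truncIdeal k) (MvPolynomial.monomial s a) = 0 := by
        rw [mk_monomial]
        have h2 : ∀ i n, 3 ≤ n → x k i ^ n = 0 := fun i n hn =>
          pow_eq_zero_of_le hn (x_pow_three k i)
        by_cases h3 : s 0 < 3
        · rw [h2 1 (s 1) (by omega), mul_zero, smul_zero]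
        · rw [h2 0 (s 0) (by omega), zero_mul, smul_zero]
      rw [h1]; simp
  | add f g hf hg =>
    simp only [map_add, add_smul, Finset.sum_add_distrib]
    rw [hf, hg]

theorem ext_tcoef {f g : TruncPoly k} (h : ∀ m < 9, tcoef k m f = tcoef k m g) : f = g := by
  rw [← sum_tcoef k f, ← sum_tcoef k g]
  exact Finset.sum_congr rfl fun m hm => by rw [h m (Finset.mem_range.1 hm)]

theorem mono_mul (m n : ℕ) : mono k m * mono k n =
    if m / 3 + n / 3 < 3 ∧ m % 3 + n % 3 < 3 then mono k (m + n) else 0 := by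
  have h1 : mono k m * mono k n = x k 0 ^ (m / 3 + n / 3) * x k 1 ^ (m % 3 + n % 3) := by
    rw [mono, mono, pow_add, pow_add]; ring
  have h2 : ∀ i n, 3 ≤ n → x k i ^ n = 0 := fun i n hn => pow_eq_zero_of_le hn (x_pow_three k i)
  rw [h1]
  split_ifs with h
  · rw [mono]
    congr 2 <;> omega
  · by_cases h3 : m / 3 + n / 3 < 3
    · rw [h2 1 _ (by omega), mul_zero]
    · rw [h2 0 _ (by omega), zero_mul]

theorem mono_zero : mono k 0 = 1 := by simp [mono]

theorem mono_three : mono k 3 = x k 0 := by simp [mono]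

theorem mono_one : mono k 1 = x k 1 := by simp [mono]

variable [CharP k 3]

theorem partialDeriv_mono (i : Fin 2) (m : ℕ) : partialDeriv k i (mono k m) =
    ((if i = 0 then m / 3 else m % 3 : ℕ) : k) • mono k (m - if i = 0 then 3 else 1) := by
  obtain rfl | rfl : i = 0 ∨ i = 1 := by fin_cases i <;> simp
  · rcases Nat.eq_zero_or_pos (m / 3) with h | h
    · simp [mono, Derivation.leibniz_pow, partialDeriv_x, h]
    · have h1 : (m - 3) / 3 = m / 3 - 1 := by omega
      have h2 : (m - 3) % 3 = m % 3 := by omega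
      simp [mono, Derivation.leibniz, Derivation.leibniz_pow, partialDeriv_x, h1, h2,
        Nat.cast_smul_eq_nsmul]
      ring
  · rcases Nat.eq_zero_or_pos (m % 3) with h | h
    · simp [mono, Derivation.leibniz_pow, partialDeriv_x, h]
    · have h1 : (m - 1) / 3 = m / 3 := by omega
      have h2 : (m - 1) % 3 = m % 3 - 1 := by omega
      simp [mono, Derivation.leibniz, Derivation.leibniz_pow, partialDeriv_x, h1, h2,
        Nat.cast_smul_eq_nsmul]
      ring

/-- An antiderivative of x₁²x₂² would need an exponent 3, which is truncated (and differentiates to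
0 in characteristic 3). -/
theorem tcoef_eight_partialDeriv (i : Fin 2) (f : TruncPoly k) :
    tcoef k 8 (partialDeriv k i f) = 0 := by
  rw [← sum_tcoef k f, map_sum, map_sum]
  refine Finset.sum_eq_zero fun m hm => ?_
  rw [Finset.mem_range] at hm
  have h8 : ¬8 = m - if i = 0 then 3 else 1 := by split_ifs <;> omega
  rw [(partialDeriv k i).map_smul, map_smul, partialDeriv_mono, map_smul,
    tcoef_mono k (by norm_num), if_neg h8, smul_zero, smul_zero]

theorem tcoef_eight_divergence (D : Witt k) : tcoef k 8 (Witt.divergence k D) = 0 := by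
  rw [Witt.divergence_apply, map_sum]
  exact Finset.sum_eq_zero fun i _ => tcoef_eight_partialDeriv k i _

theorem cast_ne_zero {n : ℕ} (h0 : 0 < n) (h : n < 3) : (n : k) ≠ 0 := fun h' => by
  have := Nat.le_of_dvd h0 ((CharP.cast_eq_zero_iff k 3 n).1 h')
  omega

/-- Every monomial other than x₁²x₂² has an exponent below 2 and can be integrated in that variable,
dividing by 1 or 2 only. -/
theorem exists_divergence {f : TruncPoly k} (hf : tcoef k 8 f = 0) :
    ∃ D : Witt k, Witt.divergence k D = f := by
  change f ∈ LinearMap.range (Witt.divergence k)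
  have hd : ∀ (i : Fin 2) (g : TruncPoly k), partialDeriv k i g ∈ LinearMap.range
      (Witt.divergence k) := by
    intro i g
    refine ⟨g • partialDeriv k i, ?_⟩
    rw [Witt.divergence_apply, Fin.sum_univ_two]
    fin_cases i <;> simp [partialDeriv_x]
  rw [← sum_tcoef k f]
  refine Submodule.sum_mem _ fun m hm => ?_
  rw [Finset.mem_range] at hm
  by_cases h8 : m = 8
  · rw [h8, hf, zero_smul]; exact Submodule.zero_mem _
  refine Submodule.smul_mem _ _ ?_
  by_cases h : m % 3 < 2
  · have h1 := hd 1 (mono k (m + 1))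
    rw [partialDeriv_mono, if_neg one_ne_zero, if_neg one_ne_zero] at h1
    exact (Submodule.smul_mem_iff _ (cast_ne_zero k (by omega) (by omega))).1 h1
  · have h1 := hd 0 (mono k (m + 3))
    rw [partialDeriv_mono, if_pos rfl, if_pos rfl] at h1
    exact (Submodule.smul_mem_iff _ (cast_ne_zero k (by omega) (by omega))).1 h1

end TruncPoly

/-! ### The action of W(2; 1) on volume forms. -/

namespace Witt

open TruncPoly

variable {k : Type*} [Field k] [CharP k 3]

/-- The action on volume forms. -/
def star (D : Witt k) (f : TruncPoly k) : TruncPoly k := D f + divergence k D * f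

/-- `star D` is the Lie derivative of f dx₁ ∧ dx₂; algebraically, the cocycle identity
`divergence_lie` makes it a representation. -/
theorem star_lie (D E : Witt k) (f : TruncPoly k) :
    star ⁅D, E⁆ f = star D (star E f) - star E (star D f) := by
  simp only [star, divergence_lie, Derivation.commutator_apply, map_add, Derivation.leibniz,
    smul_eq_mul]
  ring

/-- Written as a divergence, the Lie derivative visibly has no top term, so the forms without top
term are a subrepresentation. -/
theorem star_eq_sum (D : Witt k) (f : TruncPoly k) :
    star D f = ∑ i, partialDeriv k i (D (x k i) * f) := by
  rw [star, apply_eq_sum k D f, divergence_apply, Finset.sum_mul, ← Finset.sum_add_distrib]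
  refine Finset.sum_congr rfl fun i _ => ?_
  rw [Derivation.leibniz, smul_eq_mul, smul_eq_mul]; ring

theorem tcoef_eight_star (D : Witt k) (f : TruncPoly k) : tcoef k 8 (star D f) = 0 := by
  rw [star_eq_sum, map_sum]
  exact Finset.sum_eq_zero fun i _ => tcoef_eight_partialDeriv k i _

theorem star_one (D : Witt k) : star D 1 = divergence k D := by
  simp [star]

/-- `star D 1` is the divergence, and once this vanishes `star D` of a generator is D of that
generator. This faithfulness is what makes `toWitt` a homomorphism. -/
theorem eq_zero_of_star {D : Witt k} (h : ∀ f, tcoef k 8 f = 0 → star D f = 0) : D = 0 := by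
  have h0 : divergence k D = 0 := by
    rw [← star_one]
    exact h 1 (by rw [← mono_zero, tcoef_mono k (by norm_num), if_neg (by norm_num)])
  refine ext_x k fun i => ?_
  have h1 := h (x k i) (by
    fin_cases i
    · exact (congrArg _ (mono_three k).symm).trans (by
        rw [tcoef_mono k (by norm_num), if_neg (by norm_num)])
    · exact (congrArg _ (mono_one k).symm).trans (by
        rw [tcoef_mono k (by norm_num), if_neg (by norm_num)]))
  rw [star, h0, zero_mul, add_zero] at h1
  rw [h1]; rfl

end Witt

namespace E8

open TruncPoly

/-! ### The normalizer of the abelian ideal -/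

/-- The first `78` basis vectors centralize the first `8`. -/
def centralCheck : Bool :=
  (List.range 78).all fun i => (List.range 8).all fun n => ((vec i).bracket (vec n)).isZero

set_option maxRecDepth 100000 in
theorem centralCheck_eq : centralCheck = true := by decide +kernel

/-- The action of the Witt algebra on the abelian ideal. -/
def wittTerm (i m n : ℕ) : Vec :=
  bif Nat.blt (m / 3 + n / 3) 3 && Nat.blt (m % 3 + n % 3) 3 then
    (vec (m + n - bif Nat.beq i 0 then 3 else 1)).smul
      (bif Nat.beq i 0 then (m + n) / 3 else (m + n) % 3)
  else []

/-- The action of the Witt algebra on the abelian ideal. -/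
def wittCheck : Bool :=
  (List.range 2).all fun i => (List.range 9).all fun m => (List.range 8).all fun n =>
    Vec.isZero ((vec (78 + 9 * i + m)).bracket (vec n) ++ (wittTerm i m n).smul 2)

set_option maxRecDepth 100000 in
theorem wittCheck_eq : wittCheck = true := by decide +kernel

/-- The lift of the Witt algebra is closed under brackets modulo the abelian ideal. -/
def sectionCheck : Bool :=
  (List.range' 78 18).all fun i => (List.range' 78 18).all fun j => Nat.ble j i ||
    force ((vec i).bracket (vec j)) fun u => (List.range' 8 70).all fun r =>
      Nat.beq (Vec.form (vec (dualIndex r)) u) 0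

set_option maxRecDepth 100000 in
theorem sectionCheck_eq : sectionCheck = true := by decide +kernel

variable {k : Type*} [Field k] [CharP k 3] (φ : E8 k ≃ₗ⁅k⁆ E8 k)

/-- The embedding of truncated polynomials without top term as the abelian ideal. -/
def abel : TruncPoly k →ₗ[k] E8 k :=
  ∑ m ∈ Finset.range 8, (tcoef k m).smulRight (bv φ m)

omit [CharP k 3] in
theorem abel_apply (f : TruncPoly k) :
    abel φ f = ∑ m ∈ Finset.range 8, tcoef k m f • bv φ m := by
  simp [abel]

omit [CharP k 3] in
theorem abel_mono {m : ℕ} (hm : m < 8) : abel φ (mono k m) = bv φ m := by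
  rw [abel_apply, Finset.sum_eq_single m]
  · rw [tcoef_mono k (by omega), if_pos rfl, one_smul]
  · intro j hj hne
    rw [tcoef_mono k (by have := Finset.mem_range.1 hj; omega), if_neg hne, zero_smul]
  · intro h; exact absurd (Finset.mem_range.2 hm) h

theorem coord_sum_range {n i : ℕ} (hn : n ≤ 248) (hi : i < 248) (c : ℕ → k) :
    coord φ i (∑ j ∈ Finset.range n, c j • bv φ j) = if i < n then c i else 0 := by
  rw [map_sum]
  split_ifs with h
  · rw [Finset.sum_eq_single i]
    · rw [map_smul, coord_bv φ hi hi, if_pos rfl, smul_eq_mul, mul_one]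
    · intro j hj hne
      rw [map_smul, coord_bv φ hi (by have := Finset.mem_range.1 hj; omega), if_neg hne.symm,
        smul_zero]
    · intro h'; exact absurd (Finset.mem_range.2 h) h'
  · refine Finset.sum_eq_zero fun j hj => ?_
    rw [Finset.mem_range] at hj
    rw [map_smul, coord_bv φ hi (by omega), if_neg (by omega), smul_zero]

theorem abel_mem (f : TruncPoly k) : abel φ f ∈ low φ 8 := fun j h1 h2 => by
  rw [abel_apply, coord_sum_range φ (by norm_num) h2, if_neg (by omega)]

theorem exists_abel {x : E8 k} (hx : x ∈ low φ 8) : ∃ f, tcoef k 8 f = 0 ∧ abel φ f = x := by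
  refine ⟨∑ m ∈ Finset.range 8, coord φ m x • mono k m, ?_, ?_⟩
  · rw [map_sum]
    refine Finset.sum_eq_zero fun m hm => ?_
    rw [Finset.mem_range] at hm
    rw [map_smul, tcoef_mono k (by norm_num), if_neg (by omega), smul_zero]
  · rw [map_sum]
    conv_rhs => rw [← sum_coord_low φ (by norm_num) hx]
    refine Finset.sum_congr rfl fun m hm => ?_
    rw [map_smul, abel_mono φ (Finset.mem_range.1 hm)]

theorem abel_injective {f : TruncPoly k} (h8 : tcoef k 8 f = 0) (h : abel φ f = 0) : f = 0 := by
  refine ext_tcoef k fun m hm => ?_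
  rw [map_zero]
  by_cases h' : m = 8
  · rw [h', h8]
  · have := congrArg (coord φ m) h
    rwa [abel_apply, coord_sum_range φ (by norm_num) (by omega), if_pos (by omega), map_zero]
      at this

/-- The projection to the Witt algebra. -/
def toWitt : E8 k →ₗ[k] Witt k :=
  ∑ i : Fin 2, ∑ m ∈ Finset.range 9, (coord φ (78 + 9 * i + m)).smulRight
    (mono k m • partialDeriv k i)

theorem tcoef_toWitt (y : E8 k) (i : Fin 2) {m : ℕ} (hm : m < 9) :
    tcoef k m (toWitt φ y (x k i)) = coord φ (78 + 9 * i + m) y := by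
  have h : toWitt φ y (x k i) =
      ∑ m ∈ Finset.range 9, coord φ (78 + 9 * i + m) y • mono k m := by
    simp only [toWitt, LinearMap.sum_apply, LinearMap.smulRight_apply]
    have : ∀ (D E : Witt k) (f : TruncPoly k), (D + E) f = D f + E f := fun _ _ _ => rfl
    have hs : ∀ (n : ℕ) (c : ℕ → Witt k) (f : TruncPoly k),
        (∑ m ∈ Finset.range n, c m) f = ∑ m ∈ Finset.range n, c m f := fun n c f => by
      induction n with
      | zero => rfl
      | succ n ih => rw [Finset.sum_range_succ, this, ih, Finset.sum_range_succ]
    rw [Fin.sum_univ_two, this, hs, hs]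
    fin_cases i <;> simp [partialDeriv_x]
  rw [h, map_sum, Finset.sum_eq_single m]
  · rw [map_smul, tcoef_mono k hm, if_pos rfl, smul_eq_mul, mul_one]
  · intro j hj hne
    rw [map_smul, tcoef_mono k hm, if_neg hne.symm, smul_zero]
  · intro h; exact absurd (Finset.mem_range.2 hm) h

omit [CharP k 3] in
theorem ext_witt {D E : Witt k} (h : ∀ i, ∀ m < 9, tcoef k m (D (x k i)) = tcoef k m (E (x k i))) :
    D = E :=
  Witt.ext_x k fun i => ext_tcoef k fun m hm => h i m hm

theorem witt_index {j : ℕ} (h1 : 78 ≤ j) (h2 : j < 96) :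
    ∃ (i : Fin 2) (m : ℕ), m < 9 ∧ j = 78 + 9 * i + m :=
  ⟨⟨(j - 78) / 9, by omega⟩, (j - 78) % 9, by omega, by simp only; omega⟩

theorem toWitt_eq_zero_iff (x : E8 k) :
    toWitt φ x = 0 ↔ ∀ j, 78 ≤ j → j < 96 → coord φ j x = 0 := by
  constructor
  · intro h j h1 h2
    obtain ⟨i, m, hm, rfl⟩ := witt_index h1 h2
    rw [← tcoef_toWitt φ x i hm, h, Derivation.zero_apply, map_zero]
  · intro h
    refine ext_witt fun i m hm => ?_
    rw [tcoef_toWitt φ x i hm, h _ (by omega) (by omega), Derivation.zero_apply, map_zero]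

theorem toWitt_bv {i : Fin 2} {m : ℕ} (hm : m < 9) :
    toWitt φ (bv φ (78 + 9 * i + m)) = mono k m • partialDeriv k i := by
  refine ext_witt fun j n hn => ?_
  rw [tcoef_toWitt φ _ j hn, coord_bv φ (by omega) (by omega), Derivation.smul_apply,
    partialDeriv_x]
  by_cases h : i = j
  · subst h
    rw [if_pos rfl, smul_eq_mul, mul_one, tcoef_mono k hn]
    simp
  · rw [if_neg h, smul_zero, map_zero, if_neg]
    have : (i : ℕ) ≠ j := fun h' => h (Fin.ext h')
    omega

/-- The lift of the Witt algebra. -/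
def ofWitt (D : Witt k) : E8 k :=
  ∑ i : Fin 2, ∑ m ∈ Finset.range 9, tcoef k m (D (x k i)) • bv φ (78 + 9 * i + m)

theorem coord_ofWitt_of (D : Witt k) {j : ℕ} (hj : j < 248) (h : j < 78 ∨ 96 ≤ j) :
    coord φ j (ofWitt φ D) = 0 := by
  simp only [ofWitt, map_sum]
  refine Finset.sum_eq_zero fun i _ => Finset.sum_eq_zero fun m hm => ?_
  rw [Finset.mem_range] at hm
  rw [map_smul, coord_bv φ hj (by omega), if_neg (by omega), smul_zero]

theorem toWitt_ofWitt (D : Witt k) : toWitt φ (ofWitt φ D) = D := by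
  have hs : ∀ m i, tcoef k m (D (x k i)) • mono k m • partialDeriv k i =
      (tcoef k m (D (x k i)) • mono k m) • partialDeriv k i := fun m i => by
    rw [smul_assoc]
  simp only [ofWitt, map_sum, map_smul]
  conv_rhs => rw [Witt.eq_sum k D]
  refine Finset.sum_congr rfl fun i _ => ?_
  conv_rhs => rw [← sum_tcoef k (D (x k i)), Finset.sum_smul]
  refine Finset.sum_congr rfl fun m hm => ?_
  rw [toWitt_bv φ (Finset.mem_range.1 hm), hs]

theorem ofWitt_mem (D : Witt k) : ofWitt φ D ∈ low φ 96 := fun _ h1 h2 =>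
  coord_ofWitt_of φ D h2 (Or.inr h1)

theorem mem_low_iff_toWitt {x : E8 k} : x ∈ low φ 78 ↔ x ∈ low φ 96 ∧ toWitt φ x = 0 := by
  rw [toWitt_eq_zero_iff]
  constructor
  · exact fun h => ⟨low_mono φ (by norm_num) h, fun j h1 h2 => h j h1 (by omega)⟩
  · intro h j h1 h2
    by_cases h3 : j < 96
    · exact h.2 j h1 h3
    · exact h.1 j (by omega) h2

theorem star_basis (i : Fin 2) (m n : ℕ) : Witt.star (mono k m • partialDeriv k i) (mono k n) =
    partialDeriv k i (mono k m * mono k n) := by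
  rw [Witt.star_eq_sum, Fin.sum_univ_two]
  fin_cases i <;> simp [partialDeriv_x]

theorem lie_bv_bv {i j : ℕ} : ⁅bv φ i, bv φ j⁆ = ev φ ((vec i).bracket (vec j)) :=
  lie_ev φ (valid_vec i) (valid_vec j)

theorem valid_bracket_vec (i j : ℕ) : ((vec i).bracket (vec j)).valid :=
  (bracket_sound (ZMod 3) (valid_vec i) (valid_vec j)).2

theorem lie_low_abel {x y : E8 k} (hx : x ∈ low φ 78) (hy : y ∈ low φ 8) : ⁅x, y⁆ = 0 := by
  rw [← sum_coord_low φ (by norm_num) hx, ← sum_coord_low φ (by norm_num) hy]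
  simp only [sum_lie_sum, smul_lie, lie_smul]
  refine Finset.sum_eq_zero fun i hi => Finset.sum_eq_zero fun j hj => ?_
  have h := List.all_eq_true.1 (List.all_eq_true.1 centralCheck_eq i
    (List.mem_range.2 (Finset.mem_range.1 hi))) j (List.mem_range.2 (Finset.mem_range.1 hj))
  rw [lie_bv_bv, ev_eq_zero φ (valid_bracket_vec i j) h, smul_zero, smul_zero]

/-- `smul 2` encodes subtraction in the check. As long as no exponent exceeds 2, indices of
monomials add under multiplication, and the two partial derivatives lower the index by 3 and by 1.
-/
theorem lie_witt_abel (i : Fin 2) {m n : ℕ} (hm : m < 9) (hn : n < 8) :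
    ⁅bv φ (78 + 9 * i + m), bv φ n⁆ = abel φ (partialDeriv k i (mono k m * mono k n)) := by
  have h := List.all_eq_true.1 (List.all_eq_true.1 (List.all_eq_true.1 wittCheck_eq i
    (List.mem_range.2 i.2)) m (List.mem_range.2 hm)) n (List.mem_range.2 hn)
  have hv : (wittTerm i m n).valid := by
    unfold wittTerm
    cases Nat.blt (m / 3 + n / 3) 3 && Nat.blt (m % 3 + n % 3) 3
    · exact fun t ht => absurd ht (by simp)
    · exact smul_valid (valid_vec _) _
  have h0 := ev_eq_zero φ (append_valid (valid_bracket_vec _ n) (smul_valid hv 2)) h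
  rw [ev_append, ev_smul, ← lie_bv_bv] at h0
  have h1 : ev φ (wittTerm i m n) = abel φ (partialDeriv k i (mono k m * mono k n)) := by
    rw [mono_mul, wittTerm]
    by_cases h2 : m / 3 + n / 3 < 3 ∧ m % 3 + n % 3 < 3
    · have h3 : (Nat.blt (m / 3 + n / 3) 3 && Nat.blt (m % 3 + n % 3) 3) = true := by
        simp [h2]
      rw [if_pos h2, h3, cond_true, ev_smul, partialDeriv_mono, map_smul]
      have h4 : (bif Nat.beq i 0 then 3 else 1) = if i = 0 then 3 else 1 := by
        fin_cases i <;> rfl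
      have h5 : (bif Nat.beq i 0 then (m + n) / 3 else (m + n) % 3) =
        if i = 0 then (m + n) / 3 else (m + n) % 3 := by fin_cases i <;> rfl
      rw [h4, h5, abel_mono φ (by split_ifs <;> omega)]
      rfl
    · have h3 : (Nat.blt (m / 3 + n / 3) 3 && Nat.blt (m % 3 + n % 3) 3) = false := by
        rw [Bool.eq_false_iff]
        intro h3
        simp only [Bool.and_eq_true, Nat.blt_eq] at h3
        exact h2 h3
      rw [if_neg h2, h3, cond_false, map_zero, map_zero]
      simp [ev]
  rw [← h1]
  have h6 : ((2 : ℕ) : k) = -1 := by push_cast; linear_combination three_eq_zero k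
  rw [h6, neg_one_smul] at h0
  exact eq_of_sub_eq_zero (by rw [sub_eq_add_neg]; exact h0)

/-- The first 78 vectors act by zero and the next 18 as Lie derivatives; the rest is linearity. The
condition on f is needed because `abel` forgets the coefficient of x₁²x₂², while `star` need not
vanish on this monomial. -/
theorem lie_abel {x : E8 k} (hx : x ∈ low φ 96) {f : TruncPoly k} (hf : tcoef k 8 f = 0) :
    ⁅x, abel φ f⁆ = abel φ (Witt.star (toWitt φ x) f) := by
  have hadd : ∀ (D E : Witt k) f, Witt.star (D + E) f = Witt.star D f + Witt.star E f :=
    fun D E f => by simp only [Witt.star, map_add, Derivation.add_apply]; ring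
  have hsmul : ∀ (c : k) (D : Witt k) f, Witt.star (c • D) f = c • Witt.star D f :=
    fun c D f => by simp only [Witt.star, map_smul, Derivation.smul_apply, smul_mul_assoc, smul_add]
  let S : Submodule k (E8 k) :=
    { carrier := {x | ⁅x, abel φ f⁆ = abel φ (Witt.star (toWitt φ x) f)}
      zero_mem' := by
        have : Witt.star (0 : Witt k) f = 0 := by simp [Witt.star]
        change ⁅(0 : E8 k), _⁆ = abel φ (Witt.star (toWitt φ 0) f)
        rw [map_zero, this, map_zero, zero_lie]
      add_mem' := fun {x y} hx hy => by
        change ⁅x + y, _⁆ = abel φ (Witt.star (toWitt φ (x + y)) f)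
        rw [map_add, hadd, map_add, add_lie, ← hx, ← hy]
      smul_mem' := fun c x hx => by
        change ⁅c • x, _⁆ = abel φ (Witt.star (toWitt φ (c • x)) f)
        rw [map_smul, hsmul, map_smul, smul_lie, ← hx] }
  refine (low_le_iff φ (S := S)).2 (fun j hj => ?_) hx
  change ⁅bv φ j, abel φ f⁆ = abel φ (Witt.star (toWitt φ (bv φ j)) f)
  by_cases h : j < 78
  · have h0 := bv_mem_low φ h
    rw [lie_low_abel φ h0 (abel_mem φ f), ((mem_low_iff_toWitt φ).1 h0).2]
    simp [Witt.star]
  · obtain ⟨i, m, hm, rfl⟩ := witt_index (by omega) hj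
    rw [toWitt_bv φ hm]
    have hf' : f = ∑ n ∈ Finset.range 8, tcoef k n f • mono k n := by
      conv_lhs => rw [← sum_tcoef k f, Finset.sum_range_succ, hf, zero_smul, add_zero]
    have hl : ∀ D : Witt k, Witt.star D f = ∑ n ∈ Finset.range 8, tcoef k n f • Witt.star D (mono k n) := by
      intro D
      conv_lhs => rw [hf']
      simp only [Witt.star, map_sum, Finset.mul_sum, ← Finset.sum_add_distrib, smul_add,
        mul_smul_comm, D.map_smul]
    rw [hl, abel_apply, map_sum, lie_sum]
    refine Finset.sum_congr rfl fun n hn => ?_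
    rw [lie_smul, map_smul, lie_witt_abel φ i hm (Finset.mem_range.1 hn), star_basis]

omit [CharP k 3] in
theorem abel_one : abel φ 1 = bv φ 0 := by
  rw [← mono_zero, abel_mono φ (by norm_num)]

omit [CharP k 3] in
theorem tcoef_eight_one : tcoef k 8 (1 : TruncPoly k) = 0 := by
  rw [← mono_zero, tcoef_mono k (by norm_num), if_neg (by norm_num)]

/-- The nilpotent element is the volume form 1, whose Lie derivative is the divergence. -/
theorem lie_nilpotent {x : E8 k} (hx : x ∈ low φ 96) :
    ⁅x, bv φ 0⁆ = abel φ (Witt.divergence k (toWitt φ x)) := by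
  rw [← abel_one, lie_abel φ hx tcoef_eight_one, Witt.star_one]

/-- The dual indices of 96, …, 247 all belong to `perpIndices`, so orthogonality to these vectors
kills the corresponding coordinates. -/
theorem bv_mem_perp {S : Submodule k (E8 k)} (hS : ∀ t ∈ perpIndices, bv φ t ∈ S) {x : E8 k}
    (hx : ∀ y ∈ S, kap φ y x = 0) : x ∈ low φ 96 := fun j h1 h2 => by
  have hc : ((List.range' 96 152).all fun j => perpIndices.any (Nat.beq (dualIndex j))) = true := by
    decide +kernel
  have h := List.all_eq_true.1 hc j (by simp; omega)
  obtain ⟨r, h3, h4⟩ := List.any_eq_true.1 h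
  rw [coord_eq_zero_iff, Nat.eq_of_beq_eq_true h4]
  exact hx _ (hS r h3)

/-- By invariance the centraliser of e is orthogonal to [e, 𝔤], and `rangeSteps` shows that this
image contains the orthogonal space of `low φ 96`. No linear system for the centraliser has to be
solved. -/
theorem centralizer_le {x : E8 k} (hx : ⁅x, bv φ 0⁆ = 0) : x ∈ low φ 96 := by
  refine bv_mem_perp φ (S := LinearMap.range (LieAlgebra.ad k (E8 k) (bv φ 0))) ?_ ?_
  · refine mem_of_closes φ ?_ rangeSteps_closes (by simp)
    intro known x s _ h
    rw [Nat.eq_of_beq_eq_true h]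
    exact ⟨bv φ s, rfl⟩
  · rintro _ ⟨z, rfl⟩
    change kap φ ⁅bv φ 0, z⁆ x = 0
    rw [← lie_skew, map_neg, LinearMap.neg_apply, kap_lie, ← lie_skew, hx, neg_zero, map_zero,
      neg_zero]

/-- If [x, e] ∈ A, it is the divergence of some D, since all functions without top term are
divergences; subtracting the lift of D from x leaves an element of the centraliser. -/
theorem mem_low_iff_lie_nilpotent {x : E8 k} : x ∈ low φ 96 ↔ ⁅x, bv φ 0⁆ ∈ low φ 8 := by
  constructor
  · intro h
    rw [lie_nilpotent φ h]
    exact abel_mem φ _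
  · intro h
    obtain ⟨f, hf, hf'⟩ := exists_abel φ h
    obtain ⟨D, rfl⟩ := exists_divergence k hf
    have h1 := lie_nilpotent φ (ofWitt_mem φ D)
    rw [toWitt_ofWitt] at h1
    have h2 : x - ofWitt φ D ∈ low φ 96 := centralizer_le φ (by
      rw [sub_lie, h1, hf', sub_self])
    have := Submodule.add_mem _ h2 (ofWitt_mem φ D)
    rwa [sub_add_cancel] at this

theorem lie_mem_abel {x y : E8 k} (hx : x ∈ low φ 96) (hy : y ∈ low φ 8) : ⁅x, y⁆ ∈ low φ 8 := by
  obtain ⟨f, hf, rfl⟩ := exists_abel φ hy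
  rw [lie_abel φ hx hf]
  exact abel_mem φ _

/-- Since `low φ 96` is characterised by [x, e] ∈ A and preserves A, closure under brackets is the
Jacobi identity, without any computation of brackets. -/
theorem lie_mem_normalizer {x y : E8 k} (hx : x ∈ low φ 96) (hy : y ∈ low φ 96) :
    ⁅x, y⁆ ∈ low φ 96 := by
  have h0 : bv φ 0 ∈ low φ 8 := bv_mem_low φ (by norm_num)
  rw [mem_low_iff_lie_nilpotent, lie_lie]
  exact Submodule.sub_mem _ (lie_mem_abel φ hx (lie_mem_abel φ hy h0))
    (lie_mem_abel φ hy (lie_mem_abel φ hx h0))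

/-- Both sides act in the same way on A, by `lie_abel` and the Jacobi identity, and the action of
W(2; 1) there is faithful. -/
theorem toWitt_lie {x y : E8 k} (hx : x ∈ low φ 96) (hy : y ∈ low φ 96) :
    toWitt φ ⁅x, y⁆ = ⁅toWitt φ x, toWitt φ y⁆ := by
  rw [← sub_eq_zero]
  refine Witt.eq_zero_of_star fun f hf => abel_injective φ (Witt.tcoef_eight_star _ _) ?_
  have h1 := lie_abel φ (lie_mem_normalizer φ hx hy) hf
  rw [lie_lie, lie_abel φ hy hf, lie_abel φ hx hf, lie_abel φ hx (Witt.tcoef_eight_star _ _),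
    lie_abel φ hy (Witt.tcoef_eight_star _ _), ← map_sub, ← Witt.star_lie] at h1
  have h2 : Witt.star (toWitt φ ⁅x, y⁆ - ⁅toWitt φ x, toWitt φ y⁆) f =
      Witt.star (toWitt φ ⁅x, y⁆) f - Witt.star ⁅toWitt φ x, toWitt φ y⁆ f := by
    simp only [Witt.star, Witt.divergence_apply, Derivation.sub_apply, map_sub,
      Finset.sum_sub_distrib]
    ring
  rw [h2, map_sub, h1, sub_self]

/-- J is the kernel of `toWitt` on 𝔴. -/
theorem lie_mem_ideal {x y : E8 k} (hx : x ∈ low φ 96) (hy : y ∈ low φ 78) :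
    ⁅x, y⁆ ∈ low φ 78 := by
  obtain ⟨h1, h2⟩ := (mem_low_iff_toWitt φ).1 hy
  exact (mem_low_iff_toWitt φ).2 ⟨lie_mem_normalizer φ hx h1, by
    rw [toWitt_lie φ hx h1, h2]; exact lie_zero (M := Witt k) (toWitt φ x)⟩

theorem coord_lie_witt {i j r : ℕ} (hi : 78 ≤ i) (hi' : i < 96) (hj : 78 ≤ j) (hj' : j < 96)
    (hr : 8 ≤ r) (hr' : r < 78) : coord φ r ⁅bv φ i, bv φ j⁆ = 0 := by
  have key : ∀ i j, 78 ≤ i → i < 96 → 78 ≤ j → j < 96 → i < j → coord φ r ⁅bv φ i, bv φ j⁆ = 0 := by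
    intro i j hi hi' hj hj' hij
    have h := List.all_eq_true.1 (List.all_eq_true.1 sectionCheck_eq i (by simp; omega)) j
      (by simp; omega)
    have h := (Bool.or_eq_true_iff.1 h).resolve_left fun h' => by
      have := Nat.le_of_ble_eq_true h'
      omega
    obtain ⟨u, hu, hu', hu''⟩ := force_sound (k := k) φ (valid_bracket_vec i j) h
    have := List.all_eq_true.1 hu'' r (by simp; omega)
    rw [lie_bv_bv, ← hu', coord_ev_eq_zero_iff φ hu, Nat.eq_of_beq_eq_true this]
  rcases lt_trichotomy i j with h | h | h
  · exact key i j hi hi' hj hj' h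
  · rw [h, lie_self, map_zero]
  · rw [← lie_skew, map_neg, key j i hj hj' hi hi' h, neg_zero]

/-- The difference lies in J because `toWitt` is a homomorphism; `sectionCheck` shows that its
coordinates 8, …, 77 vanish too, which leaves A. -/
theorem ofWitt_lie (D E : Witt k) : ⁅ofWitt φ D, ofWitt φ E⁆ - ofWitt φ ⁅D, E⁆ ∈ low φ 8 := by
  have h1 : ⁅ofWitt φ D, ofWitt φ E⁆ - ofWitt φ ⁅D, E⁆ ∈ low φ 78 := by
    rw [mem_low_iff_toWitt]
    refine ⟨Submodule.sub_mem _ (lie_mem_normalizer φ (ofWitt_mem φ D) (ofWitt_mem φ E))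
      (ofWitt_mem φ _), ?_⟩
    rw [map_sub, toWitt_lie φ (ofWitt_mem φ D) (ofWitt_mem φ E), toWitt_ofWitt, toWitt_ofWitt,
      toWitt_ofWitt, sub_self]
  intro r hr hr'
  by_cases h : r < 78
  · rw [map_sub, coord_ofWitt_of φ _ hr' (Or.inl h), sub_zero]
    have h2 : ∀ i, 78 ≤ i → i < 96 → coord φ r ⁅bv φ i, ofWitt φ E⁆ = 0 := fun i hi hi' => by
      simp only [ofWitt, lie_sum, map_sum, lie_smul, map_smul]
      refine Finset.sum_eq_zero fun j _ => Finset.sum_eq_zero fun n hn => ?_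
      rw [Finset.mem_range] at hn
      rw [coord_lie_witt φ hi hi' (by omega) (by omega) hr h, smul_zero]
    generalize ofWitt φ E = y at h2
    simp only [ofWitt, sum_lie, map_sum, smul_lie, map_smul]
    refine Finset.sum_eq_zero fun j _ => Finset.sum_eq_zero fun n hn => ?_
    rw [Finset.mem_range] at hn
    rw [h2 _ (by omega) (by omega), smul_zero]
  · exact h1 r (by omega) hr'

end E8

namespace E8

open TruncPoly

/-! ### Weight projections -/

/-- The weight of a generator. -/
def weight (n : ℕ) : Gen → ℕ
  | .h _ => 0
  | .p b => formMod n b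
  | .m b => 2 * formMod n b

/-- The terms of a given weight. -/
def weightFilter (n c : ℕ) (u : Vec) : Vec :=
  u.filter fun t => Nat.beq ((weight n t.2 + 2 * c) % 3) 0

/-- Successive restrictions to weight spaces. -/
def weightFilters (ws : List (ℕ × ℕ)) (u : Vec) : Vec :=
  match ws with
  | [] => u
  | (n, c) :: ws => weightFilter n c (weightFilters ws u)

/-- Two double brackets with lifts of partial derivatives, followed by weight projections. -/
def thetaVec (ws : List (ℕ × ℕ)) (i : ℕ) : Vec :=
  weightFilters ws ((vec 78).bracket ((vec 78).bracket ((vec 87).bracket ((vec 87).bracket (vec i)))))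

/-- Only the basis vector with index `s` survives, and it is mapped to the one with index `t`. -/
def thetaCheck (ws : List (ℕ × ℕ)) (n s t : ℕ) : Bool :=
  (List.range n).all fun i => bif Nat.beq i s then
    force (thetaVec ws i) fun u => Vec.isZero (u ++ (vec t).smul 2)
  else force (thetaVec ws i) Vec.isZero

/-- Weights for the torus of the ideal. -/
def idealWeights : List (ℕ × ℕ) := [(20102100, 1), (20102102, 0)]

/-- Weights for the torus of the normalizer. -/
def torusWeights : List (ℕ × ℕ) := (2202000, 2) :: (22000200, 2) :: idealWeights

-- ∂₁²∂₂² takes x₁²x₂² to 4 = 1, and so U(3, 8), of index 43, to U(3, 0), of index 35. The weights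
-- for the toral elements U(6, 0) and B₆, which centralise e, remove what else survives on `low φ
-- 96`.
set_option maxRecDepth 100000 in
theorem thetaCheck_ideal : thetaCheck idealWeights 96 43 35 = true := by decide +kernel

-- On all of the algebra two further weights are imposed, for the lifts of x₁∂₁ and x₂∂₂; these lie
-- in 𝔴 but not in the centraliser of e. They single out Y(3, 8) ↦ Y(3, 0), of indices 131 and 123.
set_option maxRecDepth 100000 in
theorem thetaCheck_torus : thetaCheck torusWeights 248 131 123 = true := by decide +kernel

variable {k : Type*} [Field k] [CharP k 3] (φ : E8 k ≃ₗ⁅k⁆ E8 k)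

/-- The element of the torus attached to a coweight. -/
def torus (n : ℕ) : E8 k := ev φ [(1, .h n)]

/-- The projection to a weight space. -/
def weightProj (n c : ℕ) : Module.End k (E8 k) :=
  1 - (LieAlgebra.ad k (E8 k) (torus φ n) - (c : k) • 1) ^ 2

theorem lie_torus (n : ℕ) {g : Gen} (hg : g.valid = true) :
    ⁅torus φ n, φ (genEval k g)⁆ = (weight n g : k) • φ (genEval k g) := by
  have h1 : (Gen.h n).valid = true := rfl
  have h := (genBracket_sound k h1 hg).1
  have h2 : torus φ n = φ (genEval k (.h n)) := by simp [torus, ev]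
  rw [h2, ← LieEquiv.map_lie, h, ← map_smul]
  congr 1
  rcases g with b | b | b <;> simp [genBracket, weight]

/-- The eigenvalues lie in 𝔽₃, where 1 - r² is the indicator function of r = 0. -/
theorem weightProj_gen (n c : ℕ) {g : Gen} (hg : g.valid = true) :
    weightProj φ n c (φ (genEval k g)) =
      if (weight n g + 2 * c) % 3 = 0 then φ (genEval k g) else 0 := by
  have h := lie_torus φ n hg
  have h1 : weightProj φ n c (φ (genEval k g)) =
      (1 - ((weight n g : k) - c) ^ 2) • φ (genEval k g) := by
    simp only [weightProj, pow_two, LinearMap.sub_apply, Module.End.one_apply,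
      Module.End.mul_apply, LieAlgebra.ad_apply, LinearMap.smul_apply, map_sub, map_smul, h]
    module
  have h2 : (weight n g : k) - c = ((weight n g + 2 * c) % 3 : ℕ) := by
    rw [cast_mod_three]
    push_cast
    linear_combination -(c : k) * three_eq_zero k
  rw [h1, h2]
  have h3 : (weight n g + 2 * c) % 3 < 3 := Nat.mod_lt _ (by norm_num)
  generalize (weight n g + 2 * c) % 3 = r at h3
  split_ifs with h4
  · simp [h4]
  · have h5 : (1 - (r : k) ^ 2) = 0 := by
      obtain rfl | rfl : r = 1 ∨ r = 2 := by omega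
      · simp
      · push_cast; linear_combination -three_eq_zero k
    rw [h5, zero_smul]

omit [CharP k 3] in
theorem ev_cons (t : ℕ × Gen) (u : Vec) :
    ev φ (t :: u) = (t.1 : k) • φ (genEval k t.2) + ev φ u := by
  rw [ev, eval_cons, map_add, map_smul]; rfl

theorem weightProj_ev (n c : ℕ) {u : Vec} (hu : u.valid) :
    weightProj φ n c (ev φ u) = ev φ (weightFilter n c u) := by
  induction u with
  | nil =>
    have : ev φ [] = 0 := by simp [ev]
    rw [weightFilter, List.filter_nil, this, map_zero]
  | cons t u ih =>
    rw [ev_cons, map_add, map_smul, weightProj_gen φ n c (hu t (by simp)),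
      ih fun t ht => hu t (by simp [ht])]
    unfold weightFilter
    rw [List.filter_cons]
    simp only [Nat.beq_eq]
    split_ifs with h
    · rw [ev_cons]
    · rw [smul_zero, zero_add]

theorem weightFilters_valid (ws : List (ℕ × ℕ)) {u : Vec} (hu : u.valid) :
    (weightFilters ws u).valid := by
  induction ws with
  | nil => exact hu
  | cons w ws ih => exact fun t ht => ih t (List.mem_filter.1 ht).1

/-- Successive weight projections. -/
def weightProjs (ws : List (ℕ × ℕ)) : Module.End k (E8 k) :=
  match ws with
  | [] => 1
  | (n, c) :: ws => weightProj φ n c * weightProjs ws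

theorem weightProjs_ev (ws : List (ℕ × ℕ)) {u : Vec} (hu : u.valid) :
    weightProjs φ ws (ev φ u) = ev φ (weightFilters ws u) := by
  induction ws with
  | nil => rfl
  | cons w ws ih =>
    rw [weightProjs, Module.End.mul_apply, ih, weightProj_ev φ _ _ (weightFilters_valid ws hu)]
    rfl

/-- Two double brackets with lifts of partial derivatives, followed by weight projections. -/
def theta (ws : List (ℕ × ℕ)) : Module.End k (E8 k) :=
  weightProjs φ ws * LieAlgebra.ad k (E8 k) (bv φ 78) * LieAlgebra.ad k (E8 k) (bv φ 78) *
    LieAlgebra.ad k (E8 k) (bv φ 87) * LieAlgebra.ad k (E8 k) (bv φ 87)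

theorem thetaVec_valid (ws : List (ℕ × ℕ)) (i : ℕ) : (thetaVec ws i).valid :=
  have h {u v : Vec} := @bracket_sound (ZMod 3) _ _ u v
  have v := valid_vec
  weightFilters_valid ws (h (v _) (h (v _) (h (v _) (h (v _) (v i)).2).2).2).2

theorem theta_bv (ws : List (ℕ × ℕ)) (i : ℕ) : theta φ ws (bv φ i) = ev φ (thetaVec ws i) := by
  have h {u v : Vec} := @bracket_sound (ZMod 3) _ _ u v
  have v := valid_vec
  simp only [theta, Module.End.mul_apply, LieAlgebra.ad_apply]
  rw [bv, bv, bv, lie_ev φ (v _) (v i), lie_ev φ (v _) (h (v _) (v i)).2,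
    lie_ev φ (v _) (h (v _) (h (v _) (v i)).2).2,
    lie_ev φ (v _) (h (v _) (h (v _) (h (v _) (v i)).2).2).2,
    weightProjs_ev φ ws (h (v _) (h (v _) (h (v _) (h (v _) (v i)).2).2).2).2]
  rfl

/-- As `theta` has rank one on `low φ n`, a single element with one nonzero coordinate forces a
definite basis vector into every subspace stable under `theta`. -/
theorem theta_apply {ws : List (ℕ × ℕ)} {n s t : ℕ} (h : thetaCheck ws n s t = true) (hs : s < n)
    (hn : n ≤ 248) {x : E8 k} (hx : x ∈ low φ n) : theta φ ws x = coord φ s x • bv φ t := by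
  have h1 : ∀ i < n, theta φ ws (bv φ i) = if i = s then bv φ t else 0 := by
    intro i hi
    have h2 := List.all_eq_true.1 h i (List.mem_range.2 hi)
    rw [theta_bv]
    cases h3 : Nat.beq i s
    · rw [h3, cond_false] at h2
      obtain ⟨u, hu, hu', hu''⟩ := force_sound (k := k) φ (thetaVec_valid ws i) h2
      rw [if_neg (Nat.ne_of_beq_eq_false h3), ← hu', ev_eq_zero φ hu hu'']
    · rw [h3, cond_true] at h2
      obtain ⟨u, hu, hu', hu''⟩ := force_sound (k := k) φ (thetaVec_valid ws i) h2
      have h4 := ev_eq_zero φ (append_valid hu (smul_valid (valid_vec t) 2)) hu''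
      rw [ev_append, ev_smul, hu'] at h4
      have h6 : ((2 : ℕ) : k) = -1 := by push_cast; linear_combination three_eq_zero k
      rw [h6, neg_one_smul, ← sub_eq_add_neg, sub_eq_zero] at h4
      rw [if_pos (Nat.eq_of_beq_eq_true h3), h4]
      rfl
  conv_lhs => rw [← sum_coord_low φ hn hx]
  rw [map_sum, Finset.sum_eq_single s]
  · rw [map_smul, h1 s hs, if_pos rfl]
  · intro i hi hne
    rw [map_smul, h1 i (Finset.mem_range.1 hi), if_neg hne, smul_zero]
  · intro h2; exact absurd (Finset.mem_range.2 hs) h2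

omit [CharP k 3] in
theorem theta_mem {ws : List (ℕ × ℕ)} {S : Submodule k (E8 k)}
    (hw : ∀ w ∈ ws, ∀ z ∈ S, ⁅torus φ w.1, z⁆ ∈ S) (h78 : ∀ z ∈ S, ⁅bv φ 78, z⁆ ∈ S)
    (h87 : ∀ z ∈ S, ⁅bv φ 87, z⁆ ∈ S) {x : E8 k} (hx : x ∈ S) : theta φ ws x ∈ S := by
  have h : ∀ z ∈ S, weightProjs φ ws z ∈ S := by
    induction ws with
    | nil => exact fun z hz => hz
    | cons w ws ih =>
      intro z hz
      have h1 := ih (fun w hw' => hw w (List.mem_cons_of_mem _ hw')) z hz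
      have h2 := hw w (by simp)
      have h3 : ∀ z ∈ S, (LieAlgebra.ad k (E8 k) (torus φ w.1) - (w.2 : k) • 1) z ∈ S :=
        fun z hz => S.sub_mem (h2 z hz) (S.smul_mem _ hz)
      exact S.sub_mem h1 (h3 _ (h3 _ h1))
  exact h _ (h78 _ (h78 _ (h87 _ (h87 _ hx))))

omit [CharP k 3] in
theorem torus_eq {n j : ℕ} (h : vec j = [(1, .h n)]) : torus φ n = bv φ j := by
  rw [bv, h]; rfl

/-! ### The radicals -/

/-- The orthogonal space. -/
def perp (S : Submodule k (E8 k)) : Submodule k (E8 k) where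
  carrier := {z | ∀ y ∈ S, kap φ y z = 0}
  zero_mem' _ _ := map_zero _
  add_mem' h1 h2 y hy := by rw [map_add, h1 y hy, h2 y hy, add_zero]
  smul_mem' c _ h y hy := by rw [map_smul, h y hy, smul_zero]

omit [CharP k 3] in
theorem lie_mem_perp {S : Submodule k (E8 k)} {x : E8 k} (hx : ∀ y ∈ S, ⁅x, y⁆ ∈ S) {z : E8 k}
    (hz : z ∈ perp φ S) : ⁅x, z⁆ ∈ perp φ S := fun y hy => by
  rw [← kap_lie, ← lie_skew, map_neg, LinearMap.neg_apply, hz _ (hx y hy), neg_zero]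

/-- The indices `8, …, 70` are reached from brackets among themselves. -/
def perfectCheck : Bool :=
  (List.range 7).all fun c => (List.range 9).all fun m =>
    let a := [5, 3, 4, 1, 2, 0, 0].getD c 0
    let b := [4, 5, 3, 2, 0, 1, 3].getD c 0
    force ((vec (8 + 9 * a)).bracket (vec (8 + 9 * b + m)))
      (isUnitStep (List.range 8) (8 + 9 * c + m))

set_option maxRecDepth 100000 in
theorem perfectCheck_eq : perfectCheck = true := by decide +kernel

/-- Modulo A each U(c, m) comes from a bracket of some U(a, 0) with some U(b, m). Since J
centralises A, changing the factors by elements of A does not change such a bracket. -/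
theorem perfect_step {V W : Submodule k (E8 k)} (hV : ∀ j, 8 ≤ j → j < 71 → bv φ j ∈ V ⊔ low φ 8)
    (hVW : ∀ x ∈ V, ∀ y ∈ V, ⁅x, y⁆ ∈ W) {j : ℕ} (h1 : 8 ≤ j) (h2 : j < 71) :
    bv φ j ∈ W ⊔ low φ 8 := by
  have key : ∀ i j, 8 ≤ i → i < 71 → 8 ≤ j → j < 71 → ⁅bv φ i, bv φ j⁆ ∈ W := by
    intro i j hi hi' hj hj'
    obtain ⟨x, hx, a, ha, hxa⟩ := Submodule.mem_sup.1 (hV i hi hi')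
    obtain ⟨y, hy, b, hb, hyb⟩ := Submodule.mem_sup.1 (hV j hj hj')
    have e1 : x = bv φ i - a := by rw [← hxa, add_sub_cancel_right]
    have e2 : ⁅bv φ i, b⁆ = 0 := lie_low_abel φ (bv_mem_low φ (by omega)) hb
    have e3 : ⁅a, bv φ j⁆ = 0 := by
      rw [← lie_skew, lie_low_abel φ (bv_mem_low φ (by omega)) ha, neg_zero]
    have e4 : ⁅a, b⁆ = 0 := lie_low_abel φ (low_mono φ (by norm_num) ha) hb
    have : ⁅bv φ i, bv φ j⁆ = ⁅x, y⁆ := by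
      have e5 : y = bv φ j - b := by rw [← hyb, add_sub_cancel_right]
      rw [e1, e5]
      simp only [sub_lie, lie_sub, e2, e3, e4, sub_zero]
    rw [this]
    exact hVW x hx y hy
  obtain ⟨c, m, hc, hm, rfl⟩ : ∃ c m, c < 7 ∧ m < 9 ∧ j = 8 + 9 * c + m :=
    ⟨(j - 8) / 9, (j - 8) % 9, by omega, by omega, by omega⟩
  have h := List.all_eq_true.1 (List.all_eq_true.1 perfectCheck_eq c (List.mem_range.2 hc)) m
    (List.mem_range.2 hm)
  obtain ⟨u, hu, hu', hu''⟩ := force_sound (k := k) φ (valid_bracket_vec _ _) h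
  refine mem_of_isUnitStep φ hu ?_ (fun j hj => ?_) (by omega) hu''
  · rw [hu', ← lie_bv_bv]
    refine Submodule.mem_sup_left (key _ _ (by omega) ?_ (by omega) ?_)
    · interval_cases c <;> simp
    · interval_cases c <;> simp <;> omega
  · exact Submodule.mem_sup_right (bv_mem_low φ (List.mem_range.1 hj))

section Radical

variable {K : LieSubalgebra k (E8 k)}

theorem bv_mem_of_centralizer (hK : ∀ x : E8 k, ⁅x, bv φ 0⁆ = 0 → x ∈ K) {j : ℕ} (hj : j < 78) :
    bv φ j ∈ K :=
  hK _ (lie_low_abel φ (bv_mem_low φ hj) (bv_mem_low φ (by norm_num)))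

/-- The partial derivatives have divergence zero. -/
theorem deriv_mem_of_centralizer (hK : ∀ x : E8 k, ⁅x, bv φ 0⁆ = 0 → x ∈ K) (i : Fin 2) :
    bv φ (78 + 9 * i) ∈ K := by
  refine hK _ ?_
  have h := lie_witt_abel φ i (m := 0) (n := 0) (by norm_num) (by norm_num)
  rw [mono_zero, mul_one, ← mono_zero, partialDeriv_mono] at h
  refine h.trans ?_
  fin_cases i <;> simp

/-- An ideal that is not inside the abelian ideal contains all `U(a, m)` modulo the latter. -/
theorem large_of_not_le (hK : ∀ x : E8 k, ⁅x, bv φ 0⁆ = 0 → x ∈ K) {V : Submodule k (E8 k)}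
    (hV : ∀ x ∈ K, ∀ y ∈ V, ⁅x, y⁆ ∈ V) (hV' : V ≤ low φ 96) (h : ¬V ≤ low φ 8) {j : ℕ}
    (h1 : 8 ≤ j) (h2 : j < 71) : bv φ j ∈ V ⊔ low φ 8 := by
  -- Were Z(0, 0) orthogonal to V, the orthogonal space, being stable under K, would contain the
  -- vectors 8, …, 239. These include the duals of 8, …, 95, so V would lie in `low φ 8`.
  have hz : bv φ 159 ∉ perp φ V := by
    intro hz
    refine h fun x hx => ?_
    have hp : ∀ j ∈ 159 :: perpIndices, bv φ j ∈ perp φ V := by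
      intro j hj
      rcases List.mem_cons.1 hj with rfl | hj
      · exact hz
      · intro y hy
        have hc : (perpIndices.all fun j => Nat.ble 96 (dualIndex j) && Nat.blt (dualIndex j) 248 &&
          Nat.beq (dualIndex (dualIndex j)) j) = true := by decide +kernel
        have h := List.all_eq_true.1 hc j hj
        simp only [Bool.and_eq_true, Nat.beq_eq, Nat.ble_eq, Nat.blt_eq] at h
        have h3 := hV' hy (dualIndex j) h.1.1 h.1.2
        rw [coord_eq_zero_iff, h.2] at h3
        rw [kap_comm, h3]
    have h3 := mem_of_closes φ (S := perp φ V) (fun known x s hk hok => by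
      simp only [actionBy, Bool.and_eq_true, Nat.blt_eq, List.any_eq_true, Nat.beq_eq] at hok
      obtain ⟨hx, r, hr, rfl⟩ := hok
      exact lie_mem_perp φ (hV _ (bv_mem_of_centralizer φ hK hx)) (hk _ hr))
      radicalSteps_closes hp
    intro j hj hj'
    by_cases h4 : j < 96
    · have hc : ((List.range' 8 88).all fun j => Nat.ble 8 (dualIndex j) &&
        Nat.blt (dualIndex j) 240) = true := by decide +kernel
      have h := List.all_eq_true.1 hc j (by simp; omega)
      simp only [Bool.and_eq_true, Nat.ble_eq, Nat.blt_eq] at h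
      rw [coord_eq_zero_iff, kap_comm]
      exact h3 _ (by simp; omega) x hx
    · exact hV' hx j (by omega) hj'
  have hz' : ∃ x ∈ V, kap φ x (bv φ 159) ≠ 0 := by
    by_contra h0
    push Not at h0
    exact hz h0
  obtain ⟨x, hx, hx0⟩ := hz'
  -- The vector dual to Z(0, 0) is U(3, 8), of index 43.
  have hθ := theta_apply φ thetaCheck_ideal (by norm_num) (by norm_num) (hV' hx)
  have hc : coord φ 43 x ≠ 0 := by
    rw [Ne, coord_eq_zero_iff, kap_comm]
    exact hx0
  have hm : theta φ idealWeights x ∈ V := by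
    refine theta_mem φ (fun w hw => ?_) (hV _ ?_) (hV _ ?_) hx
    · simp only [idealWeights, List.mem_cons, List.not_mem_nil, or_false] at hw
      rcases hw with rfl | rfl
      · exact (torus_eq φ (j := 62) (n := 20102100) rfl) ▸
          hV _ (bv_mem_of_centralizer φ hK (by norm_num))
      · exact (torus_eq φ (j := 77) (n := 20102102) rfl) ▸
          hV _ (bv_mem_of_centralizer φ hK (by norm_num))
    · exact deriv_mem_of_centralizer φ hK 0
    · exact deriv_mem_of_centralizer φ hK 1
  rw [hθ, V.smul_mem_iff hc] at hm
  -- J centralises A, so brackets of J with V + A already lie in V; the A-parts of the steps do no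
  -- harm.
  refine mem_of_closes φ (S := V ⊔ low φ 8) (fun known x s hk hok => ?_) idealSteps_closes
    (fun j hj => ?_) j (by simp; omega)
  · simp only [actionBy, Bool.and_eq_true, Nat.blt_eq, List.any_eq_true, Nat.beq_eq] at hok
    obtain ⟨hx, r, hr, rfl⟩ := hok
    obtain ⟨y, hy, a, ha, hya⟩ := Submodule.mem_sup.1 (hk _ hr)
    rw [← hya, lie_add, lie_low_abel φ (bv_mem_low φ hx) ha, add_zero]
    exact Submodule.mem_sup_left (hV _ (bv_mem_of_centralizer φ hK hx) y hy)
  · rcases List.mem_cons.1 hj with rfl | hj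
    · exact Submodule.mem_sup_left hm
    · exact Submodule.mem_sup_right (bv_mem_low φ (List.mem_range.1 hj))

theorem low_le_of_centralizer (hK : ∀ x : E8 k, ⁅x, bv φ 0⁆ = 0 → x ∈ K) {x : E8 k}
    (hx : x ∈ low φ 78) : x ∈ K :=
  hK _ (lie_low_abel φ hx (bv_mem_low φ (by norm_num)))

/-- The radical of an algebra between the centralizer of the nilpotent element and the
normalizer of the abelian ideal. -/
theorem mem_rad_iff (hK : ∀ x : E8 k, ⁅x, bv φ 0⁆ = 0 → x ∈ K) (hK' : ∀ x ∈ K, x ∈ low φ 96)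
    (x : E8 k) : x ∈ K.rad ↔ x ∈ low φ 8 := by
  have hr : x ∈ K.rad ↔ ∃ y ∈ LieAlgebra.radical k K, (y : E8 k) = x := Iff.rfl
  rw [hr]
  constructor
  · rintro ⟨y, hy, rfl⟩
    by_contra hy0
    -- These are the terms of the derived series of the radical. If the radical is not inside A,
    -- each of them contains every U(a, m) modulo A, so the series never reaches zero.
    let V (n : ℕ) : Submodule k (E8 k) :=
      (LieAlgebra.derivedSeriesOfIdeal k K n (LieAlgebra.radical k K)).toSubmodule.map
        K.toSubmodule.subtype
    have hV0 : ∀ x ∈ K, ∀ y ∈ V 0, ⁅x, y⁆ ∈ V 0 := by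
      rintro x hx _ ⟨y, hy, rfl⟩
      exact ⟨⁅(⟨x, hx⟩ : K), y⁆, LieSubmodule.lie_mem _ hy, rfl⟩
    have hV : ∀ n, ∀ j, 8 ≤ j → j < 71 → bv φ j ∈ V n ⊔ low φ 8 := by
      intro n
      induction n with
      | zero =>
        refine fun j => large_of_not_le φ hK hV0 ?_ fun h => hy0 (h ⟨y, hy, rfl⟩)
        rintro _ ⟨y, _, rfl⟩
        exact hK' _ y.2
      | succ n ih =>
        refine fun j => perfect_step φ ih ?_
        rintro _ ⟨x, hx, rfl⟩ _ ⟨y, hy, rfl⟩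
        refine ⟨(Bracket.bracket (L := K) (M := K) x y : K), ?_, rfl⟩
        rw [LieAlgebra.derivedSeriesOfIdeal_succ]
        exact LieSubmodule.lie_mem_lie hx hy
    obtain ⟨n, hn⟩ := (LieAlgebra.isSolvable_iff k (LieAlgebra.radical k K)).1 inferInstance
    rw [LieIdeal.derivedSeries_eq_bot_iff] at hn
    have h8 := hV n 8 le_rfl (by norm_num)
    have hb : V n = ⊥ := by
      simp only [V, hn]
      exact Submodule.map_bot _
    rw [hb, bot_sup_eq] at h8
    have := h8 8 le_rfl (by norm_num)
    rw [coord_bv φ (by norm_num) (by norm_num), if_pos rfl] at this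
    exact one_ne_zero this
  · intro hx
    have hx' := low_le_of_centralizer φ hK (low_mono φ (by norm_num) hx)
    refine ⟨⟨x, hx'⟩, ?_, rfl⟩
    -- Conversely, A is an abelian ideal of K.
    let I : LieIdeal k K :=
      { toSubmodule := (low φ 8).comap K.toSubmodule.subtype
        lie_mem := fun {x y} hy => lie_mem_abel φ (hK' _ x.2) hy }
    have hI : IsLieAbelian I := ⟨fun a b => Subtype.ext (Subtype.ext
      (lie_low_abel φ (low_mono φ (by norm_num) a.2) b.2))⟩
    exact (LieAlgebra.LieIdeal.solvable_iff_le_radical k K I).1 inferInstance hx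

end Radical

/-! ### Maximality -/

/-- The orthogonal space of M is stable under 𝔴. If it contained Y(0, 0), it would contain the
orthogonal space of 𝔴, and M would lie in 𝔴. So some element of M has a nonzero coordinate at Y(3,
8), the vector dual to Y(0, 0); `theta` turns it into Y(3, 0), which together with 𝔴 generates the
whole algebra. -/
theorem eq_top_of_normalizer_lt {M : LieSubalgebra k (E8 k)} (hM : low φ 96 ≤ M.toSubmodule)
    (hM' : ¬M.toSubmodule ≤ low φ 96) : M = ⊤ := by
  have hy : bv φ 96 ∉ perp φ M.toSubmodule := by
    intro hy
    refine hM' fun x hx => bv_mem_perp φ (S := perp φ M.toSubmodule) ?_ fun y hy => ?_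
    · refine mem_of_closes φ (fun known x s hk hok => ?_) perpSteps_closes (by simpa using hy)
      simp only [actionBy, Bool.and_eq_true, Nat.blt_eq, List.any_eq_true, Nat.beq_eq] at hok
      obtain ⟨hx, r, hr, rfl⟩ := hok
      exact lie_mem_perp φ (fun y hy => M.lie_mem (hM (bv_mem_low φ hx)) hy) (hk _ hr)
    · rw [kap_comm]; exact hy x hx
  have hy' : ∃ x ∈ M.toSubmodule, kap φ x (bv φ 96) ≠ 0 := by
    by_contra h0
    push Not at h0
    exact hy h0
  obtain ⟨x, hx, hx0⟩ := hy'
  have hl : x ∈ low φ 248 := fun j h1 h2 => absurd h2 (by omega)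
  have hθ := theta_apply φ thetaCheck_torus (by norm_num) (by norm_num) hl
  have hc : coord φ 131 x ≠ 0 := by
    rw [Ne, coord_eq_zero_iff, kap_comm]
    exact hx0
  have hb : ∀ j < 96, bv φ j ∈ M := fun j hj => hM (bv_mem_low φ hj)
  have hm : theta φ torusWeights x ∈ M.toSubmodule := by
    refine theta_mem φ (fun w hw z hz => ?_) (fun z => M.lie_mem (hb _ (by norm_num)))
      (fun z => M.lie_mem (hb _ (by norm_num))) hx
    have ht : torus φ w.1 ∈ M := by
      simp only [torusWeights, idealWeights, List.mem_cons, List.not_mem_nil, or_false] at hw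
      rcases hw with rfl | rfl | rfl | rfl
      · exact torus_eq φ (j := 81) (n := 2202000) rfl ▸ hb _ (by norm_num)
      · exact torus_eq φ (j := 88) (n := 22000200) rfl ▸ hb _ (by norm_num)
      · exact torus_eq φ (j := 62) (n := 20102100) rfl ▸ hb _ (by norm_num)
      · exact torus_eq φ (j := 77) (n := 20102102) rfl ▸ hb _ (by norm_num)
    exact M.lie_mem ht hz
  rw [hθ, M.toSubmodule.smul_mem_iff hc] at hm
  have htop := mem_of_closes φ (S := M.toSubmodule) (fun known x s hk hok => by
    simp only [bothKnown, Bool.and_eq_true, List.any_eq_true, Nat.beq_eq] at hok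
    obtain ⟨⟨r, hr, rfl⟩, q, hq, rfl⟩ := hok
    exact M.lie_mem (hk _ hr) (hk _ hq)) topSteps_closes (fun j hj => by
    rcases List.mem_cons.1 hj with rfl | hj
    · exact hm
    · exact hb _ (List.mem_range.1 hj))
  rw [eq_top_iff]
  intro z _
  exact mem_of_coord φ (S := M.toSubmodule) fun j hj _ => htop j (List.mem_range.2 hj)

end E8

/-! ### Quotients and split extensions -/

namespace LieAlgebra

variable {k : Type*} [Field k]
  {L : Type*} [LieRing L] [LieAlgebra k L] {M : Type*} [LieRing M] [LieAlgebra k M]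
  {N : Type*} [LieRing N] [LieAlgebra k N]

/-- The projection to a quotient by an ideal. -/
def quotientMk (I : LieIdeal k L) : L →ₗ⁅k⁆ L ⧸ I :=
  { (LieSubmodule.Quotient.mk' I : L →ₗ[k] L ⧸ I) with
    map_lie' := rfl }

theorem quotientMk_surjective (I : LieIdeal k L) : Function.Surjective (quotientMk I) :=
  LieSubmodule.Quotient.surjective_mk' I

theorem quotientMk_eq_zero {I : LieIdeal k L} {x : L} : quotientMk I x = 0 ↔ x ∈ I :=
  LieSubmodule.Quotient.mk_eq_zero'

theorem quotientMk_eq {I : LieIdeal k L} {x y : L} (h : x - y ∈ I) :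
    quotientMk I x = quotientMk I y := by
  rw [← sub_eq_zero, ← map_sub, quotientMk_eq_zero.2 h]

/-- The homomorphism induced on a quotient by an ideal. -/
def quotientLift (I : LieIdeal k L) (f : L →ₗ⁅k⁆ M) (h : ∀ x ∈ I, f x = 0) : L ⧸ I →ₗ⁅k⁆ M :=
  { Submodule.liftQ I.toSubmodule (f : L →ₗ[k] M) h with
    map_lie' := fun {x y} => by
      obtain ⟨x, rfl⟩ := quotientMk_surjective I x
      obtain ⟨y, rfl⟩ := quotientMk_surjective I y
      exact f.map_lie x y }

theorem quotientLift_injective (I : LieIdeal k L) (f : L →ₗ⁅k⁆ M) (h : ∀ x, x ∈ I ↔ f x = 0) :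
    Function.Injective (quotientLift I f fun x => (h x).1) := by
  rw [injective_iff_map_eq_zero]
  intro x hx
  obtain ⟨x, rfl⟩ := quotientMk_surjective I x
  exact quotientMk_eq_zero.2 ((h x).2 hx)

/-- The first isomorphism theorem. -/
theorem nonempty_quotientEquiv (I : LieIdeal k L) (f : L →ₗ⁅k⁆ M) (h : ∀ x, x ∈ I ↔ f x = 0)
    (hf : Function.Surjective f) : Nonempty ((L ⧸ I) ≃ₗ⁅k⁆ M) :=
  ⟨LieEquiv.ofBijective (quotientLift I f fun x => (h x).1) ⟨quotientLift_injective I f h, fun y => by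
    obtain ⟨x, rfl⟩ := hf y
    exact ⟨quotientMk I x, rfl⟩⟩⟩

/-- A split extension is a semidirect sum. -/
theorem exists_semiDirectSum (i : N →ₗ⁅k⁆ L) (p : L →ₗ⁅k⁆ M) (s : M →ₗ⁅k⁆ L)
    (hi : Function.Injective i) (hpi : ∀ y, p (i y) = 0) (hps : ∀ z, p (s z) = z)
    (hex : ∀ x, p x = 0 → ∃ y, i y = x) :
    ∃ (ψ : M →ₗ⁅k⁆ LieDerivation k N N) (Φ : L ≃ₗ⁅k⁆ (N ⋊⁅ψ⁆ M)),
      ∀ y, Φ (i y) = SemiDirectSum.inl ψ y := by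
  -- r is the projection of L to N along the image of s; injectivity of i makes it linear.
  have hr : ∀ x, ∃ y, i y = x - s (p x) := fun x => hex _ (by rw [map_sub, hps, sub_self])
  choose r hr using hr
  have hadd : ∀ x x', r (x + x') = r x + r x' := fun x x' => hi (by
    rw [map_add, hr, hr, hr, map_add, map_add]; abel)
  have hsmul : ∀ (c : k) x, r (c • x) = c • r x := fun c x => hi (by
    rw [map_smul, hr, hr, map_smul, map_smul, smul_sub])
  have hD : ∀ z y, i (r ⁅s z, i y⁆) = ⁅s z, i y⁆ := fun z y => by
    rw [hr, LieHom.map_lie, hpi, lie_zero, map_zero, sub_zero]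
  -- z acts on N through ad (s z), which preserves the kernel of p, that is, the image of i.
  let D (z : M) : LieDerivation k N N :=
    { toFun := fun y => r ⁅s z, i y⁆
      map_add' := fun y y' => by rw [map_add, lie_add, hadd]
      map_smul' := fun c y => by rw [map_smul, lie_smul, hsmul]; rfl
      leibniz' := fun a b => hi (by
        change i (r ⁅s z, i ⁅a, b⁆⁆) = i (⁅a, r ⁅s z, i b⁆⁆ - ⁅b, r ⁅s z, i a⁆⁆)
        rw [map_sub, hD, LieHom.map_lie i a (r _), LieHom.map_lie i b (r _), hD, hD,
          LieHom.map_lie, leibniz_lie (s z), ← lie_skew (i b) ⁅s z, i a⁆, sub_neg_eq_add,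
          add_comm]) }
  have hDi : ∀ z y, i (D z y) = ⁅s z, i y⁆ := hD
  let ψ : M →ₗ⁅k⁆ LieDerivation k N N :=
    { toFun := D
      map_add' := fun z z' => LieDerivation.ext fun y => hi (by
        rw [LieDerivation.add_apply, map_add, hDi, hDi, hDi, map_add, add_lie])
      map_smul' := fun c z => LieDerivation.ext fun y => hi (by
        rw [LieDerivation.smul_apply, map_smul, hDi]
        change _ = c • i (D z y)
        rw [hDi, map_smul, smul_lie])
      map_lie' := fun {z z'} => LieDerivation.ext fun y => hi (by
        rw [LieDerivation.lie_apply, map_sub, hDi, hDi, hDi, hDi, hDi, LieHom.map_lie, lie_lie]) }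
  refine ⟨ψ, LieEquiv.ofBijective (L₂ := N ⋊⁅ψ⁆ M)
    { toFun := fun x => ⟨r x, p x⟩
      map_add' := fun x y => by rw [hadd, map_add]; rfl
      map_smul' := fun c x => by rw [hsmul, map_smul]; rfl
      map_lie' := fun {x y} => by
        rw [SemiDirectSum.lie_eq_mk, LieHom.map_lie]
        congr 1
        refine hi ?_
        change _ = i (⁅r x, r y⁆ + D (p x) (r y) - D (p y) (r x))
        rw [map_sub, map_add, hDi, hDi, LieHom.map_lie, hr, hr, hr, LieHom.map_lie, LieHom.map_lie,
          ← lie_skew (s (p y))]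
        simp only [lie_sub, sub_lie]
        abel } ⟨?_, ?_⟩, ?_⟩
  · rw [injective_iff_map_eq_zero]
    intro x hx
    have h1 : r x = 0 := congrArg SemiDirectSum.left hx
    have h2 : p x = 0 := congrArg SemiDirectSum.right hx
    have := hr x
    rw [h1, h2, map_zero, map_zero, sub_zero] at this
    exact this.symm
  · rintro ⟨y, z⟩
    refine ⟨i y + s z, ?_⟩
    have h1 : p (i y + s z) = z := by rw [map_add, hpi, hps, zero_add]
    have h2 : r (i y + s z) = y := hi (by rw [hr, h1, add_sub_cancel_right])
    exact SemiDirectSum.ext h2 h1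
  · intro y
    have h2 : r (i y) = y := hi (by rw [hr, hpi, map_zero, sub_zero])
    exact SemiDirectSum.ext h2 (hpi y)

end LieAlgebra

/-! ### The Lie algebra `𝔭𝔰𝔩(3)` -/

namespace PSL3

open LieAlgebra LieAlgebra.SpecialLinear

/-- Basis matrices. -/
def unitMatrix : ℕ → Matrix (Fin 3) (Fin 3) ℤ
  | 0 => !![0, 1, 0; 0, 0, 0; 0, 0, 0]
  | 1 => !![0, 0, 0; 0, 0, 1; 0, 0, 0]
  | 2 => !![0, 0, 0; 0, 0, 0; 1, 0, 0]
  | 3 => !![0, 0, 0; 1, 0, 0; 0, 0, 0]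
  | 4 => !![0, 0, 0; 0, 0, 0; 0, 1, 0]
  | 5 => !![0, 0, 1; 0, 0, 0; 0, 0, 0]
  | 6 => !![1, 0, 0; 0, -1, 0; 0, 0, 0]
  | _ => 0

/-- Coordinates of traceless matrices modulo scalar matrices. -/
def matCoord {R : Type*} [Ring R] (a : ℕ) (X : Matrix (Fin 3) (Fin 3) R) : R :=
  match a with
  | 0 => X 0 1
  | 1 => X 1 2
  | 2 => X 2 0
  | 3 => X 1 0
  | 4 => X 2 1
  | 5 => X 0 2
  | 6 => X 0 0 - X 2 2
  | _ => 0

/-- The structure constants: `[E_a, E_b]` is a multiple of a basis element. -/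
def structCoeff (a b : ℕ) : ℕ × ℕ :=
  ([[(0, 0), (1, 5), (2, 4), (1, 6), (0, 0), (0, 0), (1, 0)],
    [(2, 5), (0, 0), (1, 3), (0, 0), (1, 6), (0, 0), (1, 1)],
    [(1, 4), (2, 3), (0, 0), (0, 0), (0, 0), (1, 6), (1, 2)],
    [(2, 6), (0, 0), (0, 0), (0, 0), (2, 2), (1, 1), (2, 3)],
    [(0, 0), (2, 6), (0, 0), (1, 2), (0, 0), (2, 0), (2, 4)],
    [(0, 0), (0, 0), (2, 6), (2, 1), (1, 0), (0, 0), (2, 5)],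
    [(2, 0), (2, 1), (2, 2), (1, 3), (1, 4), (1, 5), (0, 0)]].getD a []).getD b (0, 0)

/-- The comparison is modulo scalars and modulo 3: diag(0, 1, -1) and diag(1, -1, 0), for instance,
differ by a scalar matrix there, so a single toral basis element suffices. -/
theorem structCoeff_check : ∀ a < 7, ∀ b < 7, (structCoeff a b).2 < 7 ∧ ∀ c < 7,
    matCoord c (unitMatrix a * unitMatrix b - unitMatrix b * unitMatrix a) % 3 =
      (if c = (structCoeff a b).2 then ((structCoeff a b).1 : ℤ) else 0) % 3 := by
  decide +kernel

theorem trace_unitMatrix (a : ℕ) : (unitMatrix a).trace = 0 := by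
  unfold unitMatrix
  split <;> decide

theorem matCoord_unitMatrix : ∀ a < 7, ∀ b < 7,
    matCoord a (unitMatrix b) = if a = b then 1 else 0 := by decide +kernel

theorem matCoord_map (R : Type*) [CommRing R] (a : ℕ) (X : Matrix (Fin 3) (Fin 3) ℤ) :
    matCoord a (X.map (Int.cast : ℤ → R)) = ((matCoord a X : ℤ) : R) := by
  unfold matCoord
  split <;> simp

variable (k : Type*) [Field k]

/-- The coordinates on traceless matrices. -/
def slCoord (a : ℕ) : sl (Fin 3) k →ₗ[k] k where
  toFun X := matCoord a X.1
  map_add' X Y := by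
    unfold matCoord
    split <;> simp
    ring
  map_smul' c X := by
    unfold matCoord
    split <;> simp
    ring

/-- Basis matrices over `k`. -/
def slBasis (a : ℕ) : sl (Fin 3) k :=
  ⟨(unitMatrix a).map (Int.cast : ℤ → k), by
    change Matrix.trace ((unitMatrix a).map (Int.cast : ℤ → k)) = 0
    have := congrArg (Int.cast : ℤ → k) (trace_unitMatrix a)
    simpa [Matrix.trace] using this⟩

theorem slCoord_lie_slBasis (a b c : ℕ) : slCoord k c ⁅slBasis k a, slBasis k b⁆ =
    ((matCoord c (unitMatrix a * unitMatrix b - unitMatrix b * unitMatrix a) : ℤ) : k) := by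
  rw [← matCoord_map]
  change matCoord c ((unitMatrix a).map (Int.cast : ℤ → k) * (unitMatrix b).map Int.cast -
    (unitMatrix b).map Int.cast * (unitMatrix a).map Int.cast) = _
  congr 1
  ext i j
  simp [Matrix.mul_apply]

variable [CharP k 3]

/-- A central matrix commutes with three matrix units and is therefore scalar. Conversely, trace
zero and equal first and last diagonal entries give X₁₁ = -2 X₀₀ = X₀₀ in characteristic 3, where
scalar matrices are traceless. -/
theorem mem_center_iff (X : sl (Fin 3) k) :
    X ∈ center k (sl (Fin 3) k) ↔ ∀ a < 7, slCoord k a X = 0 := by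
  have h3 := E8.three_eq_zero k
  constructor
  · intro hX
    rw [LieModule.mem_maxTrivSubmodule] at hX
    have h : ∀ a i j, ((unitMatrix a).map (Int.cast : ℤ → k) * X.1 -
        X.1 * (unitMatrix a).map (Int.cast : ℤ → k)) i j = 0 := fun a i j =>
      congrFun (congrFun (congrArg Subtype.val (hX (slBasis k a))) i) j
    have h0 := h 0
    have h1 := h 1
    have h3' := h 3
    simp only [Matrix.sub_apply, Matrix.mul_apply, Fin.sum_univ_three, unitMatrix,
      Matrix.map_apply] at h0 h1 h3'
    have e1 : X.1 1 0 = 0 := by simpa using h0 0 0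
    have e2 : X.1 1 2 = 0 := by simpa using h0 0 2
    have e3 : X.1 2 0 = 0 := by simpa using h0 2 1
    have e4 : X.1 1 1 - X.1 0 0 = 0 := by simpa using h0 0 1
    have e5 : X.1 2 2 - X.1 1 1 = 0 := by simpa using h1 1 2
    have e6 : X.1 0 1 = 0 := by simpa using h3' 1 1
    have e7 : X.1 0 2 = 0 := by simpa using h3' 1 2
    have e8 : X.1 2 1 = 0 := by simpa using h3' 2 0
    intro a ha
    change matCoord a X.1 = 0
    interval_cases a <;> simp only [matCoord, e1, e2, e3, e6, e7, e8]
    linear_combination - e4 - e5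
  · intro h
    have h0 : X.1 0 1 = 0 := h 0 (by omega)
    have h1 : X.1 1 2 = 0 := h 1 (by omega)
    have h2 : X.1 2 0 = 0 := h 2 (by omega)
    have h3' : X.1 1 0 = 0 := h 3 (by omega)
    have h4 : X.1 2 1 = 0 := h 4 (by omega)
    have h5 : X.1 0 2 = 0 := h 5 (by omega)
    have h6 : X.1 0 0 - X.1 2 2 = 0 := h 6 (by omega)
    have ht : X.1 0 0 + X.1 1 1 + X.1 2 2 = 0 := by
      have : X.1.trace = 0 := X.2
      simpa [Matrix.trace, Fin.sum_univ_three] using this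
    have hs : X.1 = Matrix.scalar (Fin 3) (X.1 0 0) := by
      ext i j
      fin_cases i <;> fin_cases j <;> simp [h0, h1, h2, h3', h4, h5]
      · linear_combination ht - X.1 0 0 * h3 + h6
      · linear_combination - h6
    rw [LieModule.mem_maxTrivSubmodule]
    intro Y
    refine Subtype.ext ?_
    change Y.1 * X.1 - X.1 * Y.1 = 0
    rw [hs, sub_eq_zero, Matrix.scalar_comm]
    exact fun r => Commute.all _ _

/-- The coordinates on `𝔭𝔰𝔩(3)`. -/
def pcoord (a : Fin 7) : PSL3 k →ₗ[k] k :=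
  Submodule.liftQ _ (slCoord k a) fun X hX => (mem_center_iff k X).1 hX a a.2

/-- The basis of `𝔭𝔰𝔩(3)`. -/
def pbasis (a : ℕ) : PSL3 k := quotientMk _ (slBasis k a)

theorem pcoord_pbasis (a : Fin 7) {b : ℕ} (hb : b < 7) :
    pcoord k a (pbasis k b) = if (a : ℕ) = b then 1 else 0 := by
  change matCoord (a : ℕ) ((unitMatrix b).map (Int.cast : ℤ → k)) = _
  rw [matCoord_map, matCoord_unitMatrix _ a.2 _ hb]
  split_ifs <;> simp

theorem ext_pcoord {x y : PSL3 k} (h : ∀ a, pcoord k a x = pcoord k a y) : x = y := by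
  obtain ⟨x, rfl⟩ := quotientMk_surjective _ x
  obtain ⟨y, rfl⟩ := quotientMk_surjective _ y
  refine quotientMk_eq ((mem_center_iff k _).2 fun a ha => ?_)
  rw [map_sub, sub_eq_zero]
  exact h ⟨a, ha⟩

theorem sum_pcoord (x : PSL3 k) : ∑ a, pcoord k a x • pbasis k a = x := by
  refine ext_pcoord k fun b => ?_
  simp [pcoord_pbasis, Fin.val_inj]

theorem lie_pbasis {a b : ℕ} (ha : a < 7) (hb : b < 7) : ⁅pbasis k a, pbasis k b⁆ =
    ((structCoeff a b).1 : k) • pbasis k (structCoeff a b).2 := by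
  obtain ⟨h1, h2⟩ := structCoeff_check a ha b hb
  refine ext_pcoord k fun c => ?_
  rw [map_smul, pcoord_pbasis k c h1]
  change slCoord k c ⁅slBasis k a, slBasis k b⁆ = _
  rw [slCoord_lie_slBasis, (CharP.intCast_eq_intCast k 3).2 (h2 c c.2)]
  split_ifs <;> simp

end PSL3

namespace E8

open TruncPoly PSL3

/-! ### The ideal `J` -/

/-- The places of the basis vectors `B_a` and `U_{a, 1}`. -/
def leadIndex (t : ℕ) : ℕ := bif Nat.blt t 7 then 71 + t else 8 + 9 * (t - 7)

/-- The inverse of `leadIndex`, with value `14` outside the image. -/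
def leadPos (i : ℕ) : ℕ :=
  bif Nat.ble 71 i then i - 71 else
    bif Nat.ble 8 i && Nat.beq ((i - 8) % 9) 0 then 7 + (i - 8) / 9 else 14

/-- The action of the `B_a` on the `U_{b, f}`. -/
def leadAction (a b : ℕ) : ℕ × ℕ :=
  ([[(0, 0), (1, 0), (0, 0), (2, 4), (0, 0), (0, 0), (0, 0)],
    [(0, 0), (0, 0), (1, 1), (0, 0), (2, 5), (0, 0), (0, 0)],
    [(1, 2), (0, 0), (0, 0), (0, 0), (0, 0), (2, 3), (0, 0)],
    [(1, 1), (0, 0), (0, 0), (0, 0), (2, 3), (0, 0), (0, 0)],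
    [(0, 0), (1, 2), (0, 0), (0, 0), (0, 0), (2, 4), (0, 0)],
    [(0, 0), (0, 0), (1, 0), (2, 5), (0, 0), (0, 0), (0, 0)],
    [(0, 0), (1, 1), (2, 2), (0, 0), (2, 4), (1, 5), (0, 0)]].getD a []).getD b (0, 0)

/-- The contribution of the `U_{a, 1}` to the brackets of the `B_a`. -/
def leadCocycle (a b : ℕ) : ℕ :=
  bif Nat.beq a 0 && Nat.beq b 3 || Nat.beq a 5 && Nat.beq b 2 then 2 else
    bif Nat.beq a 3 && Nat.beq b 0 || Nat.beq a 2 && Nat.beq b 5 then 1 else 0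

/-- A structure constant given by its value and place. -/
def atPlace (p : ℕ × ℕ) (t : ℕ) : ℕ := bif Nat.beq t p.2 then p.1 else 0

/-- The structure constants for the `B_a` and `U_{a, 1}`. -/
def leadCoeff (a b t : ℕ) : ℕ :=
  bif Nat.blt a 7 then
    bif Nat.blt b 7 then
      bif Nat.blt t 7 then atPlace (structCoeff a b) t else
        bif Nat.beq t 13 then leadCocycle a b else 0
    else bif Nat.blt t 7 then 0 else atPlace (leadAction a (b - 7)) (t - 7)
  else bif Nat.blt t 7 then 0 else
    bif Nat.blt b 7 then 2 * atPlace (leadAction b (a - 7)) (t - 7)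
    else atPlace (structCoeff (a - 7) (b - 7)) (t - 7)

/-- The `B` and `U` coordinates of the brackets in `J`. -/
def leadCheck : Bool :=
  (List.range 78).all fun i => (List.range 78).all fun j =>
    force ((vec i).bracket (vec j)) fun u => (List.range 14).all fun t =>
      Nat.beq (dualSign (leadIndex t) * Vec.form (vec (dualIndex (leadIndex t))) u % 3)
        (leadCoeff (leadPos i) (leadPos j) t % 3)

-- The B_a- and U(a, 0)-coordinates of a bracket in J depend only on the same coordinates of the
-- factors: A and the U(a, m) with m > 0 span an ideal of J, with a 14-dimensional quotient.
-- Position 14 marks the basis vectors of this ideal.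
set_option maxRecDepth 100000 in
theorem leadCheck_eq : leadCheck = true := by decide +kernel

/-- The bracket of two basis vectors of the loop algebra. -/
def loopTerm (a m b n : ℕ) : Vec :=
  bif Nat.blt (m / 3 + n / 3) 3 && Nat.blt (m % 3 + n % 3) 3 then
    (vec (8 + 9 * (structCoeff a b).2 + (m + n))).smul (structCoeff a b).1
  else []

/-- The brackets in the loop algebra. -/
def loopCheck : Bool :=
  (List.range 7).all fun a => (List.range 9).all fun m =>
    (List.range 7).all fun b => (List.range 9).all fun n =>
      force ((vec (8 + 9 * a + m)).bracket (vec (8 + 9 * b + n)) ++ (loopTerm a m b n).smul 2)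
        fun u => u.isZero || (List.range' 8 240).all fun r =>
          Nat.beq (Vec.form (vec (dualIndex r)) u) 0

set_option maxRecDepth 100000 in
theorem loopCheck_eq : loopCheck = true := by decide +kernel

end E8

namespace E8

open TruncPoly PSL3

variable {k : Type*} [Field k] [CharP k 3] (φ : E8 k ≃ₗ⁅k⁆ E8 k)

theorem leadIndex_lt : ∀ {t : ℕ}, t < 14 → leadIndex t < 78 := by decide +kernel

theorem leadPos_leadIndex : ∀ t < 14, leadPos (leadIndex t) = t := by decide +kernel

theorem leadPos_spec : ∀ i < 78, leadPos i = 14 ∨ leadPos i < 14 ∧ leadIndex (leadPos i) = i := by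
  decide +kernel

theorem leadCoeff_fourteen : ∀ a ≤ 14, ∀ t < 14, leadCoeff a 14 t = 0 ∧ leadCoeff 14 a t = 0 := by
  decide +kernel

theorem leadCoeff_eq_zero : ∀ a < 14, ∀ b < 14, ∀ t < 7, 7 ≤ a ∨ 7 ≤ b → leadCoeff a b t = 0 := by
  decide +kernel

theorem leadPos_le {i : ℕ} (hi : i < 78) : leadPos i ≤ 14 := by
  have := leadPos_spec i hi
  omega

omit [CharP k 3] in
theorem sum_lead (f g : ℕ → k) (hg : g 14 = 0) :
    ∑ i ∈ Finset.range 78, f i * g (leadPos i) = ∑ a ∈ Finset.range 14, f (leadIndex a) * g a := by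
  refine (Finset.sum_of_injOn leadIndex ?_ ?_ ?_ ?_).symm
  · intro a ha b hb h
    rw [← leadPos_leadIndex a (by simpa using ha), ← leadPos_leadIndex b (by simpa using hb), h]
  · intro a ha
    simpa using leadIndex_lt (by simpa using ha)
  · intro i hi h
    rcases leadPos_spec i (by simpa using hi) with h1 | ⟨h1, h2⟩
    · rw [h1, hg, mul_zero]
    · exact absurd ⟨leadPos i, by simpa using h1, h2⟩ h
  · intro a ha
    rw [leadPos_leadIndex a (by simpa using ha)]

theorem coord_lead_bv {i j t : ℕ} (hi : i < 78) (hj : j < 78) (ht : t < 14) :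
    coord φ (leadIndex t) ⁅bv φ i, bv φ j⁆ = (leadCoeff (leadPos i) (leadPos j) t : k) := by
  have h := List.all_eq_true.1 (List.all_eq_true.1 leadCheck_eq i (List.mem_range.2 hi)) j
    (List.mem_range.2 hj)
  obtain ⟨u, hu, hu', hu''⟩ := force_sound (k := k) φ (valid_bracket_vec i j) h
  have := Nat.eq_of_beq_eq_true (List.all_eq_true.1 hu'' t (List.mem_range.2 ht))
  rw [lie_bv_bv, ← hu', coord_apply, bv, kap_ev φ (valid_vec _) hu, ← Nat.cast_mul,
    ← cast_mod_three k, this, cast_mod_three]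

/-- The `B` and `U` coordinates of a bracket in `J`. -/
theorem coord_lead_lie {x y : E8 k} (hx : x ∈ low φ 78) (hy : y ∈ low φ 78) {t : ℕ} (ht : t < 14) :
    coord φ (leadIndex t) ⁅x, y⁆ = ∑ a ∈ Finset.range 14, coord φ (leadIndex a) x *
      ∑ b ∈ Finset.range 14, coord φ (leadIndex b) y * leadCoeff a b t := by
  rw [← sum_lead (coord φ · x) (fun a => ∑ b ∈ Finset.range 14, coord φ (leadIndex b) y *
    leadCoeff a b t) (Finset.sum_eq_zero fun b hb => by
      rw [(leadCoeff_fourteen b (by have := Finset.mem_range.1 hb; omega) t ht).2, Nat.cast_zero,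
        mul_zero])]
  conv_lhs => rw [← sum_coord_low φ (by norm_num) hx, sum_lie, map_sum]
  refine Finset.sum_congr rfl fun i hi => ?_
  rw [smul_lie, map_smul, smul_eq_mul]
  congr 1
  have hi' := Finset.mem_range.1 hi
  rw [← sum_lead (coord φ · y) (fun b => (leadCoeff (leadPos i) b t : k)) (by
      rw [(leadCoeff_fourteen _ (leadPos_le hi') t ht).1, Nat.cast_zero])]
  conv_lhs => rw [← sum_coord_low φ (by norm_num) hy, lie_sum, map_sum]
  refine Finset.sum_congr rfl fun j hj => ?_
  rw [lie_smul, map_smul, smul_eq_mul, coord_lead_bv φ hi' (Finset.mem_range.1 hj) ht]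

/-! ### The projection to `𝔭𝔰𝔩(3)` -/

/-- The projection of `J` to `𝔭𝔰𝔩(3)`. -/
def toPSL : E8 k →ₗ[k] PSL3 k := ∑ a : Fin 7, (coord φ (71 + a)).smulRight (pbasis k a)

theorem pcoord_toPSL (a : Fin 7) (x : E8 k) : pcoord k a (toPSL φ x) = coord φ (71 + a) x := by
  simp [toPSL, pcoord_pbasis, Fin.val_inj]

theorem toPSL_bv {a : ℕ} (ha : a < 7) : toPSL φ (bv φ (71 + a)) = pbasis k a := by
  refine ext_pcoord k fun b => ?_
  rw [pcoord_toPSL, coord_bv φ (by omega) (by omega), pcoord_pbasis k b ha]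
  simp

theorem toPSL_eq_zero_iff {x : E8 k} (hx : x ∈ low φ 78) : toPSL φ x = 0 ↔ x ∈ low φ 71 := by
  constructor
  · intro h j h1 h2
    by_cases h3 : j < 78
    · have := pcoord_toPSL φ ⟨j - 71, by omega⟩ x
      rw [h, map_zero] at this
      rw [this, show 71 + (j - 71) = j by omega]
    · exact hx j (by omega) h2
  · intro h
    refine ext_pcoord k fun a => ?_
    rw [pcoord_toPSL, h _ (by omega) (by omega), map_zero]

/-- By `leadCoeff_eq_zero` the B-coordinates of a bracket involve only the B-coordinates of the
factors, with the structure constants of 𝔭𝔰𝔩(3). -/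
theorem toPSL_lie {x y : E8 k} (hx : x ∈ low φ 78) (hy : y ∈ low φ 78) :
    toPSL φ ⁅x, y⁆ = ⁅toPSL φ x, toPSL φ y⁆ := by
  refine ext_pcoord k fun c => ?_
  have hl : ∀ a < 7, leadIndex a = 71 + a := by decide +kernel
  have hc : ∀ a < 7, ∀ b < 7, leadCoeff a b c = atPlace (structCoeff a b) c := by
    revert c; decide +kernel
  have h1 : ∀ f : ℕ → k, (∀ a < 14, 7 ≤ a → f a = 0) →
      ∑ a ∈ Finset.range 14, f a = ∑ a : Fin 7, f a := fun f hf => by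
    rw [Fin.sum_univ_eq_sum_range f 7]
    exact (Finset.sum_subset (Finset.range_mono (by norm_num)) fun a h1 h2 =>
      hf a (Finset.mem_range.1 h1) (by simpa using h2)).symm
  rw [pcoord_toPSL, ← hl c c.2, coord_lead_lie φ hx hy (by omega), h1]
  · conv_rhs => rw [toPSL, LinearMap.sum_apply, LinearMap.sum_apply, sum_lie_sum, map_sum]
    refine Finset.sum_congr rfl fun a _ => ?_
    rw [h1, map_sum, Finset.mul_sum]
    · refine Finset.sum_congr rfl fun b _ => ?_
      simp only [LinearMap.smulRight_apply]
      rw [smul_lie, lie_smul, lie_pbasis k a.2 b.2, map_smul, map_smul, map_smul,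
        pcoord_pbasis k c (structCoeff_check a a.2 b b.2).1, hc a a.2 b b.2, hl a a.2, hl b b.2,
        atPlace]
      simp only [smul_eq_mul]
      by_cases h : (c : ℕ) = (structCoeff a b).2
      · simp [h]
      · have : Nat.beq c (structCoeff a b).2 = false := by
          rw [Bool.eq_false_iff]; exact fun h' => h (Nat.eq_of_beq_eq_true h')
        simp [h, this]
    · intro b hb hb'
      rw [leadCoeff_eq_zero a (by omega) b hb c c.2 (Or.inr hb'), Nat.cast_zero, mul_zero]
  · intro a ha ha'
    rw [Finset.sum_eq_zero, mul_zero]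
    intro b hb
    rw [leadCoeff_eq_zero a ha b (Finset.mem_range.1 hb) c c.2 (Or.inl ha'), Nat.cast_zero,
      mul_zero]

/-! ### The loop algebra -/

/-- The embedding of the loop algebra, as a bilinear map. -/
def loopMap₂ : TruncPoly k →ₗ[k] PSL3 k →ₗ[k] E8 k :=
  LinearMap.mk₂ k (fun f x => ∑ a : Fin 7, ∑ m ∈ Finset.range 9,
      (tcoef k m f * pcoord k a x) • bv φ (8 + 9 * a + m))
    (fun f g x => by simp only [map_add, add_mul, add_smul, Finset.sum_add_distrib])
    (fun c f x => by simp only [map_smul, smul_eq_mul, mul_assoc, mul_smul, Finset.smul_sum])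
    (fun f x y => by simp only [map_add, mul_add, add_smul, Finset.sum_add_distrib])
    (fun c f x => by
      simp only [map_smul, smul_eq_mul, mul_left_comm _ c, mul_smul, Finset.smul_sum])

/-- The embedding of the loop algebra. -/
def loopMap : TruncPoly k ⊗[k] PSL3 k →ₗ[k] E8 k := TensorProduct.lift (loopMap₂ φ)

theorem loopMap_tmul {a m : ℕ} (ha : a < 7) (hm : m < 9) :
    loopMap φ (mono k m ⊗ₜ pbasis k a) = bv φ (8 + 9 * a + m) := by
  change ∑ b : Fin 7, ∑ n ∈ Finset.range 9, (tcoef k n (mono k m) * pcoord k b (pbasis k a)) •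
    bv φ (8 + 9 * b + n) = _
  rw [Finset.sum_eq_single ⟨a, ha⟩, Finset.sum_eq_single m]
  · rw [tcoef_mono k hm, if_pos rfl, pcoord_pbasis k _ ha, if_pos rfl, mul_one, one_smul]
  · intro n hn h
    rw [tcoef_mono k (Finset.mem_range.1 hn), if_neg h, zero_mul, zero_smul]
  · intro h; exact absurd (Finset.mem_range.2 hm) h
  · intro b _ h
    refine Finset.sum_eq_zero fun n _ => ?_
    rw [pcoord_pbasis k b ha, if_neg fun h' => h (Fin.ext h'), mul_zero, zero_smul]
  · intro h; exact absurd (Finset.mem_univ _) h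

theorem loop_induction {S : Submodule k (TruncPoly k ⊗[k] PSL3 k)}
    (h : ∀ a < 7, ∀ m < 9, mono k m ⊗ₜ pbasis k a ∈ S) (z : TruncPoly k ⊗[k] PSL3 k) : z ∈ S := by
  induction z using TensorProduct.induction_on with
  | zero => exact S.zero_mem
  | tmul f x =>
    rw [← sum_tcoef k f, ← sum_pcoord k x, TensorProduct.sum_tmul]
    refine S.sum_mem fun m hm => ?_
    rw [TensorProduct.tmul_sum]
    refine S.sum_mem fun a _ => ?_
    rw [TensorProduct.tmul_smul, TensorProduct.smul_tmul']
    exact S.smul_mem _ (S.smul_mem _ (h a a.2 m (Finset.mem_range.1 hm)))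
  | add x y hx hy => exact S.add_mem hx hy

theorem loopMap_mem (z : TruncPoly k ⊗[k] PSL3 k) : loopMap φ z ∈ low φ 71 := by
  refine loop_induction (S := (low φ 71).comap (loopMap φ)) (fun a ha m hm => ?_) z
  rw [Submodule.mem_comap, loopMap_tmul φ ha hm]
  exact bv_mem_low φ (by omega)

/-- The left inverse of the embedding of the loop algebra. -/
def ofLoop : E8 k →ₗ[k] TruncPoly k ⊗[k] PSL3 k :=
  ∑ a : Fin 7, ∑ m ∈ Finset.range 9,
    (coord φ (8 + 9 * a + m)).smulRight (mono k m ⊗ₜ pbasis k a)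

omit [CharP k 3] in
theorem ofLoop_apply (x : E8 k) : ofLoop φ x = ∑ a : Fin 7, ∑ m ∈ Finset.range 9,
    coord φ (8 + 9 * a + m) x • (mono k m ⊗ₜ pbasis k a) := by
  simp [ofLoop]

theorem ofLoop_loopMap (z : TruncPoly k ⊗[k] PSL3 k) : ofLoop φ (loopMap φ z) = z := by
  refine loop_induction (S := LinearMap.eqLocus (ofLoop φ ∘ₗ loopMap φ) LinearMap.id)
    (fun a ha m hm => ?_) z
  change ofLoop φ (loopMap φ _) = _
  rw [loopMap_tmul φ ha hm, ofLoop_apply, Finset.sum_eq_single ⟨a, ha⟩, Finset.sum_eq_single m]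
  · rw [coord_bv φ (by simp only; omega) (by omega), if_pos rfl, one_smul]
    rfl
  · intro n hn h
    rw [Finset.mem_range] at hn
    rw [coord_bv φ (by simp only; omega) (by omega), if_neg (by simp only; omega), zero_smul]
  · intro h; exact absurd (Finset.mem_range.2 hm) h
  · intro b _ h
    have h' : (b : ℕ) ≠ a := fun h' => h (Fin.ext h')
    refine Finset.sum_eq_zero fun n hn => ?_
    rw [Finset.mem_range] at hn
    rw [coord_bv φ (by omega) (by omega), if_neg (by omega), zero_smul]
  · intro h; exact absurd (Finset.mem_univ _) h

omit [CharP k 3] in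
theorem ofLoop_eq_zero {x : E8 k} (hx : x ∈ low φ 8) : ofLoop φ x = 0 := by
  rw [ofLoop_apply]
  refine Finset.sum_eq_zero fun a _ => Finset.sum_eq_zero fun m hm => ?_
  rw [Finset.mem_range] at hm
  rw [hx _ (by omega) (by omega), zero_smul]

theorem loopMap_ofLoop {x : E8 k} (hx : x ∈ low φ 71) : loopMap φ (ofLoop φ x) - x ∈ low φ 8 := by
  suffices h : low φ 71 ≤ (low φ 8).comap (loopMap φ ∘ₗ ofLoop φ - LinearMap.id) by
    have := h hx
    rwa [Submodule.mem_comap, LinearMap.sub_apply] at this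
  rw [low_le_iff]
  intro j hj
  change loopMap φ (ofLoop φ (bv φ j)) - bv φ j ∈ low φ 8
  by_cases h : j < 8
  · rw [ofLoop_eq_zero φ (bv_mem_low φ h), map_zero, zero_sub]
    exact Submodule.neg_mem _ (bv_mem_low φ h)
  · obtain ⟨a, m, ha, hm, rfl⟩ : ∃ a m, a < 7 ∧ m < 9 ∧ j = 8 + 9 * a + m :=
      ⟨(j - 8) / 9, (j - 8) % 9, by omega, by omega, by omega⟩
    rw [← loopMap_tmul φ ha hm, ofLoop_loopMap, sub_self]
    exact Submodule.zero_mem _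

/-- The check leaves room for an error in A, so the embedding is a homomorphism modulo A, which is
all that J/A requires. -/
theorem lie_loopMap_basis {a m b n : ℕ} (ha : a < 7) (hm : m < 9) (hb : b < 7) (hn : n < 9) :
    ⁅loopMap φ (mono k m ⊗ₜ pbasis k a), loopMap φ (mono k n ⊗ₜ pbasis k b)⁆ -
      loopMap φ ⁅mono k m ⊗ₜ[k] pbasis k a, mono k n ⊗ₜ[k] pbasis k b⁆ ∈ low φ 8 := by
  have h := List.all_eq_true.1 (List.all_eq_true.1 (List.all_eq_true.1 (List.all_eq_true.1
    loopCheck_eq a (List.mem_range.2 ha)) m (List.mem_range.2 hm)) b (List.mem_range.2 hb)) n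
    (List.mem_range.2 hn)
  have hv : (loopTerm a m b n).valid := by
    unfold loopTerm
    cases Nat.blt (m / 3 + n / 3) 3 && Nat.blt (m % 3 + n % 3) 3
    · exact fun t ht => absurd ht (by simp)
    · exact smul_valid (valid_vec _) _
  have h1 : loopMap φ ⁅mono k m ⊗ₜ[k] pbasis k a, mono k n ⊗ₜ[k] pbasis k b⁆ =
      ev φ (loopTerm a m b n) := by
    rw [LieAlgebra.ExtendScalars.bracket_tmul, mono_mul, lie_pbasis k ha hb, loopTerm]
    by_cases h2 : m / 3 + n / 3 < 3 ∧ m % 3 + n % 3 < 3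
    · have h3 : (Nat.blt (m / 3 + n / 3) 3 && Nat.blt (m % 3 + n % 3) 3) = true := by
        simp [h2]
      rw [if_pos h2, h3, cond_true, ev_smul, TensorProduct.tmul_smul, map_smul,
        loopMap_tmul φ (structCoeff_check a ha b hb).1 (by omega)]
      rfl
    · have h3 : (Nat.blt (m / 3 + n / 3) 3 && Nat.blt (m % 3 + n % 3) 3) = false := by
        rw [Bool.eq_false_iff]
        intro h3
        simp only [Bool.and_eq_true, Nat.blt_eq] at h3
        exact h2 h3
      rw [if_neg h2, h3, cond_false, TensorProduct.zero_tmul, map_zero]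
      simp [ev]
  obtain ⟨u, hu, hu', hu''⟩ := force_sound (k := k) φ
    (append_valid (valid_bracket_vec _ _) (smul_valid hv 2)) h
  have h6 : ((2 : ℕ) : k) = -1 := by push_cast; linear_combination three_eq_zero k
  rw [h1, loopMap_tmul φ ha hm, loopMap_tmul φ hb hn, lie_bv_bv, sub_eq_add_neg, ← neg_one_smul k,
    ← h6, ← ev_smul, ← ev_append, ← hu']
  rcases Bool.or_eq_true_iff.1 hu'' with h7 | h7
  · rw [ev_eq_zero φ hu h7]
    exact Submodule.zero_mem _
  · intro r hr hr'
    rw [coord_ev_eq_zero_iff φ hu]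
    exact Nat.eq_of_beq_eq_true (List.all_eq_true.1 h7 r (by simp; omega))

theorem lie_loopMap (z w : TruncPoly k ⊗[k] PSL3 k) :
    ⁅loopMap φ z, loopMap φ w⁆ - loopMap φ ⁅z, w⁆ ∈ low φ 8 := by
  have hw : ∀ z : TruncPoly k ⊗[k] PSL3 k, ∀ w : TruncPoly k ⊗[k] PSL3 k,
      (LieAlgebra.ad k (E8 k) (loopMap φ z) ∘ₗ loopMap φ -
        loopMap φ ∘ₗ (LieAlgebra.ad k (TruncPoly k ⊗[k] PSL3 k) z : _ →ₗ[k] _)) w =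
      ⁅loopMap φ z, loopMap φ w⁆ - loopMap φ ⁅z, w⁆ := fun _ _ => rfl
  -- By antisymmetry the error is also linear in the first argument in the same form, so the
  -- induction over pure basis tensors can be applied to each argument in turn.
  have hz : ∀ w : TruncPoly k ⊗[k] PSL3 k, ∀ z : TruncPoly k ⊗[k] PSL3 k,
      -(LieAlgebra.ad k (E8 k) (loopMap φ w) ∘ₗ loopMap φ -
        loopMap φ ∘ₗ (LieAlgebra.ad k (TruncPoly k ⊗[k] PSL3 k) w : _ →ₗ[k] _)) z =
      ⁅loopMap φ z, loopMap φ w⁆ - loopMap φ ⁅z, w⁆ := fun w z => by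
    rw [hw, ← lie_skew z w, ← lie_skew (loopMap φ z), map_neg]
    abel
  rw [← hw]
  refine loop_induction (S := (low φ 8).comap _) (fun b hb n hn => ?_) w
  rw [Submodule.mem_comap, hw, ← hz]
  refine Submodule.neg_mem _ (loop_induction (S := (low φ 8).comap _) (fun a ha m hm => ?_) z)
  rw [Submodule.mem_comap, ← neg_mem_iff, hz]
  exact lie_loopMap_basis φ ha hm hb hn

end E8

/-! ### Polynomials with natural coefficients -/

/-- Polynomials, as lists of coefficients and monomials, which are lists of variables. -/
abbrev ListPoly : Type := List (ℕ × List ℕ)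

namespace ListPoly

/-- Insertion of a variable in a sorted monomial. -/
def insertVar (v : ℕ) : List ℕ → List ℕ
  | [] => [v]
  | w :: m => bif Nat.ble v w then v :: w :: m else w :: insertVar v m

/-- The sum with a multiple of a monomial. -/
def addTerm (c : ℕ) (m : List ℕ) : ListPoly → ListPoly
  | [] => [(c, m)]
  | t :: P => bif m == t.2 then (c + t.1, m) :: P else t :: addTerm c m P

/-- The product. -/
def mul (P Q : ListPoly) : ListPoly :=
  P.flatMap fun s => Q.map fun t => (s.1 * t.1, s.2.foldr insertVar t.2)

/-- Collects the terms with the same monomial. -/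
def normalize (P : ListPoly) : ListPoly :=
  P.foldr (fun t Q => bif Nat.beq (t.1 % 3) 0 then Q else addTerm t.1 t.2 Q) []

variable {k : Type*} [Field k] (v : ℕ → k)

/-- The value of a monomial. -/
def monEval (m : List ℕ) : k := (m.map v).prod

/-- The value of a polynomial. -/
def eval (P : ListPoly) : k := (P.map fun t => (t.1 : k) * monEval v t.2).sum

theorem eval_nil : eval v [] = 0 := rfl

theorem eval_cons (t : ℕ × List ℕ) (P : ListPoly) :
    eval v (t :: P) = t.1 * monEval v t.2 + eval v P := by
  simp [eval]

theorem eval_append (P Q : ListPoly) : eval v (P ++ Q) = eval v P + eval v Q := by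
  simp [eval]

theorem eval_flatMap {α : Type*} (l : List α) (f : α → ListPoly) :
    eval v (l.flatMap f) = (l.map fun a => eval v (f a)).sum := by
  induction l with
  | nil => rfl
  | cons a l ih => rw [List.flatMap_cons, eval_append, ih, List.map_cons, List.sum_cons]

theorem monEval_cons (w : ℕ) (m : List ℕ) : monEval v (w :: m) = v w * monEval v m := by
  simp [monEval]

theorem monEval_insertVar (w : ℕ) (m : List ℕ) :
    monEval v (insertVar w m) = v w * monEval v m := by
  induction m with
  | nil => rfl
  | cons w' m ih =>
    rw [insertVar]
    cases Nat.ble w w'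
    · rw [cond_false, monEval_cons, ih, monEval_cons, mul_left_comm]
    · rw [cond_true, monEval_cons]

theorem monEval_foldr (m n : List ℕ) :
    monEval v (m.foldr insertVar n) = monEval v m * monEval v n := by
  induction m with
  | nil => simp [monEval]
  | cons w m ih => rw [List.foldr_cons, monEval_insertVar, ih, monEval_cons, mul_assoc]

theorem eval_mul (P Q : ListPoly) : eval v (mul P Q) = eval v P * eval v Q := by
  have h : ∀ s : ℕ × List ℕ, eval v (Q.map fun t => (s.1 * t.1, s.2.foldr insertVar t.2)) =
      s.1 * monEval v s.2 * eval v Q := fun s => by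
    induction Q with
    | nil => simp [eval_nil]
    | cons t Q ih =>
      rw [List.map_cons, eval_cons, ih, eval_cons, monEval_foldr]
      push_cast
      ring
  induction P with
  | nil => simp [mul, eval_nil]
  | cons s P ih =>
    rw [mul, List.flatMap_cons, eval_append, h, eval_cons, add_mul, ← ih]
    rfl

theorem eval_addTerm (c : ℕ) (m : List ℕ) (P : ListPoly) :
    eval v (addTerm c m P) = c * monEval v m + eval v P := by
  induction P with
  | nil => rw [addTerm, eval_cons]
  | cons t P ih =>
    rw [addTerm]
    cases h : m == t.2
    · rw [cond_false, eval_cons, ih, eval_cons]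
      ring
    · rw [cond_true, eval_cons, eval_cons, beq_iff_eq.1 h]
      push_cast
      ring

theorem eval_normalize [CharP k 3] (P : ListPoly) : eval v (normalize P) = eval v P := by
  induction P with
  | nil => rfl
  | cons t P ih =>
    change eval v (bif Nat.beq (t.1 % 3) 0 then normalize P else addTerm t.1 t.2 (normalize P)) = _
    cases h : Nat.beq (t.1 % 3) 0
    · rw [cond_false, eval_addTerm, ih, eval_cons]
    · rw [cond_true, ih, eval_cons, ← E8.cast_mod_three k t.1, Nat.eq_of_beq_eq_true h]
      simp

theorem eval_eq_zero [CharP k 3] {P : ListPoly}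
    (h : (normalize P).all (fun t => Nat.beq (t.1 % 3) 0) = true) : eval v P = 0 := by
  rw [← eval_normalize, eval]
  refine List.sum_eq_zero fun c hc => ?_
  obtain ⟨t, ht, rfl⟩ := List.mem_map.1 hc
  rw [← E8.cast_mod_three k t.1, Nat.eq_of_beq_eq_true (List.all_eq_true.1 h t ht)]
  simp

end ListPoly

/-! ### The extension does not split -/

namespace E8

open TruncPoly PSL3

/-- The coordinates of the image of a basis vector under a section. -/
def sectionPoly (p a : ℕ) : ListPoly :=
  bif Nat.blt a 7 then bif Nat.beq a p then [(1, [])] else [] else [(1, [7 * p + (a - 7)])]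

/-- The coordinates of the equations for a section. -/
def sectionEquation (p q u : ℕ) : ListPoly :=
  ((List.range 14).flatMap fun a => ListPoly.mul (sectionPoly p a)
    ((List.range 14).flatMap fun b => ListPoly.mul (sectionPoly q b) [(leadCoeff a b (7 + u), [])]))
  ++ ListPoly.mul [(2 * (structCoeff p q).1, [])] (sectionPoly (structCoeff p q).2 (7 + u))

/-- A combination of the equations for a section that is equal to `1`. -/
def certificate : List (ℕ × List ℕ × ℕ × ℕ × ℕ) :=
  [(2, [32], 0, 1, 0), (1, [47], 0, 1, 0), (1, [26], 0, 1, 1), (1, [28], 0, 1, 4),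
    (2, [22], 0, 1, 5), (2, [42], 0, 1, 5), (2, [40], 0, 3, 0), (2, [12], 0, 3, 1),
    (1, [8], 0, 3, 5), (1, [35], 0, 3, 5), (2, [], 0, 3, 6), (1, [11], 0, 4, 0),
    (2, [7], 0, 4, 4), (1, [26], 0, 5, 0), (2, [21], 0, 5, 5), (2, [12], 0, 6, 0),
    (1, [7], 0, 6, 5), (1, [5], 1, 3, 1), (2, [1], 1, 3, 5), (2, [4], 1, 4, 0),
    (2, [40], 1, 4, 0), (1, [0], 1, 4, 4), (1, [35], 1, 4, 5), (1, [], 1, 4, 6),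
    (1, [33], 1, 5, 0), (2, [28], 1, 5, 5), (1, [5], 1, 6, 0), (2, [0], 1, 6, 5),
    (2, [5], 3, 5, 0), (1, [0], 3, 5, 5), (2, [12], 4, 5, 0), (1, [7], 4, 5, 5)]

/-- The combination. -/
def certificatePoly : ListPoly := certificate.flatMap fun t =>
  ListPoly.mul [(t.1, t.2.1)] (sectionEquation t.2.2.1 t.2.2.2.1 t.2.2.2.2)

-- The appended constant 2 = -1 asks that the combination minus 1 cancel identically modulo 3. It is
-- a Nullstellensatz certificate with multipliers of degree at most 1, so the equations have no
-- solution in any field of characteristic 3.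
set_option maxRecDepth 100000 in
theorem certificate_check : (ListPoly.normalize (certificatePoly ++ [(2, [])])).all
    (fun t => Nat.beq (t.1 % 3) 0) = true := by decide +kernel

theorem certificate_range : ∀ t ∈ certificate, t.2.2.1 < 7 ∧ t.2.2.2.1 < 7 ∧ t.2.2.2.2 < 7 := by
  decide +kernel

variable {k : Type*} [Field k] [CharP k 3] (φ : E8 k ≃ₗ⁅k⁆ E8 k)

/-- The unknown with number 7p + u is the U(u, 0)-coordinate of the lift of the p-th basis vector;
its B-coordinates are prescribed by the projection, and the coordinates at U(a, m) with m > 0 do not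
enter the equations. -/
theorem not_exists_section {y : ℕ → E8 k} (hy : ∀ p < 7, y p ∈ low φ 78)
    (hq : ∀ p < 7, toPSL φ (y p) = pbasis k p)
    (hlie : ∀ p < 7, ∀ q < 7,
      ⁅y p, y q⁆ - ((structCoeff p q).1 : k) • y (structCoeff p q).2 ∈ low φ 8) : False := by
  let v : ℕ → k := fun n => coord φ (8 + 9 * (n % 7)) (y (n / 7))
  have hv : ∀ p < 7, ∀ a < 14, ListPoly.eval v (sectionPoly p a) = coord φ (leadIndex a) (y p) := by
    intro p hp a ha
    by_cases h : a < 7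
    · have h1 := congrArg (pcoord k ⟨a, h⟩) (hq p hp)
      rw [pcoord_toPSL, pcoord_pbasis k _ hp] at h1
      have h2 : Nat.blt a 7 = true := by rw [Nat.blt_eq]; exact h
      rw [leadIndex, sectionPoly, h2, cond_true, cond_true, h1]
      by_cases h3 : a = p
      · simp [h3, ListPoly.eval, ListPoly.monEval]
      · have : Nat.beq a p = false := by
          rw [Bool.eq_false_iff]; exact fun h' => h3 (Nat.eq_of_beq_eq_true h')
        simp [h3, this, ListPoly.eval]
    · have h2 : Nat.blt a 7 = false := by
        rw [Bool.eq_false_iff]; exact fun h' => h (Nat.le_of_ble_eq_true h')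
      rw [leadIndex, sectionPoly, h2, cond_false, cond_false]
      have h3 : (7 * p + (a - 7)) % 7 = a - 7 := by omega
      have h4 : (7 * p + (a - 7)) / 7 = p := by omega
      simp [ListPoly.eval, ListPoly.monEval, v, h3, h4]
  have hsum : ∀ (n : ℕ) (f : ℕ → k), ((List.range n).map f).sum = ∑ i ∈ Finset.range n, f i :=
    fun n f => by
      induction n with
      | zero => rfl
      | succ n ih => simp [List.range_succ, Finset.sum_range_succ, ih]
  have heq : ∀ p < 7, ∀ q < 7, ∀ u < 7, ListPoly.eval v (sectionEquation p q u) = 0 := by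
    intro p hp q hq u hu
    -- The relations hold only modulo A, but the coordinates at indices of at least 8 do not see A.
    have h := hlie p hp q hq (leadIndex (7 + u)) (by
      revert u; decide +kernel) (by have := leadIndex_lt (t := 7 + u) (by omega); omega)
    rw [map_sub, map_smul, coord_lead_lie φ (hy p hp) (hy q hq) (by omega),
      ← hv _ (structCoeff_check p hp q hq).1 _ (by omega)] at h
    rw [← h, sectionEquation, ListPoly.eval_append, ListPoly.eval_flatMap, hsum, sub_eq_add_neg]
    congr 1
    · refine Finset.sum_congr rfl fun a ha => ?_
      rw [ListPoly.eval_mul, hv p hp a (Finset.mem_range.1 ha), ListPoly.eval_flatMap, hsum]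
      congr 1
      refine Finset.sum_congr rfl fun b hb => ?_
      rw [ListPoly.eval_mul, hv q hq b (Finset.mem_range.1 hb)]
      simp [ListPoly.eval, ListPoly.monEval]
    · rw [ListPoly.eval_mul]
      simp only [ListPoly.eval, ListPoly.monEval, List.map_cons, List.map_nil, List.sum_cons,
        List.sum_nil, List.prod_nil, smul_eq_mul]
      push_cast
      linear_combination (((structCoeff p q).1 : k) * (List.map (fun t : ℕ × List ℕ =>
        (t.1 : k) * (List.map v t.2).prod) (sectionPoly (structCoeff p q).2 (7 + u))).sum) *
          three_eq_zero k
  have h0 := ListPoly.eval_eq_zero v certificate_check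
  rw [ListPoly.eval_append, certificatePoly, ListPoly.eval_flatMap, List.sum_eq_zero, zero_add] at h0
  · have h2 : ((2 : ℕ) : k) = 0 := by simpa [ListPoly.eval, ListPoly.monEval] using h0
    exact absurd ((cast_eq_zero_of_lt (by norm_num)).1 h2) (by norm_num)
  · intro c hc
    obtain ⟨t, ht, rfl⟩ := List.mem_map.1 hc
    obtain ⟨h1, h2, h3⟩ := certificate_range t ht
    rw [ListPoly.eval_mul, heq _ h1 _ h2 _ h3, mul_zero]

end E8

/-! ### The subalgebras A, J, 𝔴, their quotients, and the theorem. -/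

namespace E8

open TruncPoly PSL3 LieAlgebra

variable {k : Type*} [Field k] [CharP k 3] (φ : E8 k ≃ₗ⁅k⁆ E8 k)

/-- The abelian radical. -/
def abelAlgebra : LieSubalgebra k (E8 k) where
  toSubmodule := low φ 8
  lie_mem' hx hy := lie_mem_abel φ (low_mono φ (by norm_num) hx) hy

/-- The ideal `J`. -/
def idealAlgebra : LieSubalgebra k (E8 k) where
  toSubmodule := low φ 78
  lie_mem' hx hy := lie_mem_ideal φ (low_mono φ (by norm_num) hx) hy

/-- The normalizer of the abelian radical. -/
def normalizerAlgebra : LieSubalgebra k (E8 k) where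
  toSubmodule := low φ 96
  lie_mem' hx hy := lie_mem_normalizer φ hx hy

theorem mem_centralizer_iff {x : E8 k} : x ∈ LieSubalgebra.elementCentralizer k (bv φ 0) ↔
    x ∈ low φ 96 ∧ Witt.divergence k (toWitt φ x) = 0 := by
  change ⁅x, bv φ 0⁆ = 0 ↔ _
  constructor
  · intro h
    have hx := centralizer_le φ h
    rw [lie_nilpotent φ hx] at h
    exact ⟨hx, abel_injective φ (tcoef_eight_divergence k _) h⟩
  · rintro ⟨hx, h⟩
    rw [lie_nilpotent φ hx, h, map_zero]

/-- [x, e] = c e lies in A, so x lies in 𝔴, where the condition reads div D = c. -/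
theorem mem_elementNormalizer_iff {x : E8 k} : x ∈ LieSubalgebra.elementNormalizer k (bv φ 0) ↔
    x ∈ low φ 96 ∧ ∃ c : k, Witt.divergence k (toWitt φ x) = c • 1 := by
  change (∃ c : k, ⁅x, bv φ 0⁆ = c • bv φ 0) ↔ _
  have h0 : bv φ 0 ∈ low φ 8 := bv_mem_low φ (by norm_num)
  constructor
  · rintro ⟨c, h⟩
    have hx : x ∈ low φ 96 := (mem_low_iff_lie_nilpotent φ).2 (h ▸ Submodule.smul_mem _ c h0)
    rw [lie_nilpotent φ hx, ← abel_one, ← map_smul, ← sub_eq_zero, ← map_sub] at h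
    refine ⟨hx, c, sub_eq_zero.1 (abel_injective φ ?_ h)⟩
    rw [map_sub, tcoef_eight_divergence, map_smul, tcoef_eight_one, smul_zero, sub_zero]
  · rintro ⟨hx, c, h⟩
    exact ⟨c, by rw [lie_nilpotent φ hx, h, map_smul, abel_one]⟩

theorem rad_eq {K : LieSubalgebra k (E8 k)} (hK : ∀ x : E8 k, ⁅x, bv φ 0⁆ = 0 → x ∈ K)
    (hK' : ∀ x ∈ K, x ∈ low φ 96) : abelAlgebra φ = K.rad :=
  LieSubalgebra.ext _ _ fun x => (mem_rad_iff φ hK hK' x).symm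

/-- As e belongs to A, an element normalising A satisfies [x, e] ∈ A, and this alone characterises
`low φ 96`. -/
theorem normalizer_eq : normalizerAlgebra φ = (abelAlgebra φ).normalizer := by
  refine LieSubalgebra.ext _ _ fun x => ?_
  rw [LieSubalgebra.mem_normalizer_iff]
  exact ⟨fun hx y hy => lie_mem_abel φ hx hy, fun h =>
    (mem_low_iff_lie_nilpotent φ).2 (h _ (bv_mem_low φ (by norm_num)))⟩

theorem isCoatom_normalizerAlgebra : IsCoatom (normalizerAlgebra φ) := by
  refine ⟨fun h => ?_, fun M hM => eq_top_of_normalizer_lt φ hM.le hM.not_ge⟩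
  have h1 : bv φ 96 ∈ normalizerAlgebra φ := h ▸ LieSubalgebra.mem_top _
  have h2 := h1 96 le_rfl (by norm_num)
  rw [coord_bv φ (by norm_num) (by norm_num), if_pos rfl] at h2
  exact one_ne_zero h2

/-- The projection to the Witt algebra of a subalgebra of the normalizer. -/
def toWittHom {K : LieSubalgebra k (E8 k)} (hK : ∀ x ∈ K, x ∈ low φ 96) : K →ₗ⁅k⁆ Witt k where
  toFun x := toWitt φ x
  map_add' x y := map_add (toWitt φ) x.1 y.1
  map_smul' c x := map_smul (toWitt φ) c x.1
  map_lie' {x y} := toWitt_lie φ (hK x.1 x.2) (hK y.1 y.2)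

/-- The projection to a subalgebra of the Witt algebra. -/
def toWittRestrict {K : LieSubalgebra k (E8 k)} (hK : ∀ x ∈ K, x ∈ low φ 96)
    {W : LieSubalgebra k (Witt k)} (hW : ∀ x ∈ K, toWitt φ x ∈ W) : K →ₗ⁅k⁆ W where
  toFun x := ⟨toWitt φ x, hW x.1 x.2⟩
  map_add' x y := Subtype.ext (map_add (toWitt φ) x.1 y.1)
  map_smul' c x := Subtype.ext (map_smul (toWitt φ) c x.1)
  map_lie' {x y} := Subtype.ext (toWitt_lie φ (hK x.1 x.2) (hK y.1 y.2))

/-- The quotient by `J` of an algebra between `J` and the normalizer. -/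
theorem nonempty_quotient_equiv {K : LieSubalgebra k (E8 k)} {W : LieSubalgebra k (Witt k)}
    (hK : ∀ x, x ∈ K ↔ x ∈ low φ 96 ∧ toWitt φ x ∈ W) (hJ : (idealAlgebra φ).IsIdealIn K) :
    Nonempty (hJ.Quotient ≃ₗ⁅k⁆ W) := by
  refine nonempty_quotientEquiv hJ.toLieIdeal
    (toWittRestrict φ (fun x hx => ((hK x).1 hx).1) fun x hx => ((hK x).1 hx).2) ?_ ?_
  · intro x
    rw [Subtype.ext_iff]
    exact (mem_low_iff_toWitt φ).trans (and_iff_right ((hK x).1 x.2).1)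
  · rintro ⟨D, hD⟩
    refine ⟨⟨ofWitt φ D, (hK _).2 ⟨ofWitt_mem φ D, ?_⟩⟩, Subtype.ext (toWitt_ofWitt φ D)⟩
    rwa [toWitt_ofWitt]

variable (k) in
theorem two_ne_zero_of_charP : (2 : k) ≠ 0 := by
  exact_mod_cast TruncPoly.cast_ne_zero k (n := 2) (by norm_num) (by norm_num)

/-- The degree derivation has divergence 2, which is invertible, so c/2 times it absorbs a constant
divergence c. -/
theorem mem_conformalHamiltonian_iff (D : Witt k) : D ∈ Witt.conformalHamiltonian k ↔
    ∃ c : k, Witt.divergence k D = c • 1 := by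
  have h2 := two_ne_zero_of_charP k
  change D ∈ (Witt.hamiltonian k).toSubmodule ⊔ Submodule.span k {Witt.euler k} ↔ _
  have he : Witt.divergence k (Witt.euler k) = (2 : k) • 1 := by
    rw [Witt.divergence_euler, ← Nat.cast_ofNat (R := k), Nat.cast_smul_eq_nsmul, nsmul_one]
    rfl
  constructor
  · intro h
    obtain ⟨D, hD, _, hc, rfl⟩ := Submodule.mem_sup.1 h
    obtain ⟨c, rfl⟩ := Submodule.mem_span_singleton.1 hc
    have hD : Witt.divergence k D = 0 := hD
    exact ⟨c * 2, by rw [map_add, hD, map_smul, he, smul_smul, zero_add]⟩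
  · rintro ⟨c, h⟩
    refine Submodule.mem_sup.2 ⟨D + (-(c / 2)) • Witt.euler k, ?_, (c / 2) • Witt.euler k,
      Submodule.smul_mem _ _ (Submodule.mem_span_singleton_self _), ?_⟩
    · change Witt.divergence k _ = 0
      rw [map_add, h, map_smul, he, smul_smul, ← add_smul, neg_mul, div_mul_cancel₀ _ h2,
        add_neg_cancel, zero_smul]
    · rw [add_assoc, ← add_smul, neg_add_cancel, zero_smul, add_zero]

/-- The section of the projection to the Witt algebra, modulo the abelian radical. -/
def wittSection (hA : (abelAlgebra φ).IsIdealIn (normalizerAlgebra φ)) :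
    Witt k →ₗ⁅k⁆ hA.Quotient where
  toFun D := quotientMk hA.toLieIdeal ⟨ofWitt φ D, ofWitt_mem φ D⟩
  map_add' D E := by
    rw [← map_add]
    congr 1
    refine Subtype.ext ?_
    change ofWitt φ (D + E) = ofWitt φ D + ofWitt φ E
    simp only [ofWitt, Derivation.add_apply, map_add, add_smul, Finset.sum_add_distrib]
  map_smul' c D := by
    rw [RingHom.id_apply, ← map_smul]
    congr 1
    refine Subtype.ext ?_
    change ofWitt φ (c • D) = c • ofWitt φ D
    simp only [ofWitt, Derivation.smul_apply, map_smul, smul_eq_mul, mul_smul, Finset.smul_sum]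
  map_lie' {D E} := by
    rw [← LieHom.map_lie, eq_comm]
    exact quotientMk_eq (ofWitt_lie φ D E)

theorem exists_normalizer_semiDirectSum (hJw : (idealAlgebra φ).IsIdealIn (normalizerAlgebra φ))
    (hAJ : (abelAlgebra φ).IsIdealIn (idealAlgebra φ))
    (hAw : (abelAlgebra φ).IsIdealIn (normalizerAlgebra φ)) :
    ∃ (ψ : Witt k →ₗ⁅k⁆ LieDerivation k hAJ.Quotient hAJ.Quotient)
      (Φ : hAw.Quotient ≃ₗ⁅k⁆ (hAJ.Quotient ⋊⁅ψ⁆ Witt k)),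
      ∀ x : idealAlgebra φ,
        Φ (hAw.mk ⟨x, hJw.1 x.2⟩) = LieAlgebra.SemiDirectSum.inl ψ (hAJ.mk x) := by
  -- J/A is the kernel of 𝔴/A → W(2; 1), and `wittSection` is a section, so the extension splits.
  let f := (quotientMk hAw.toLieIdeal).comp (LieSubalgebra.inclusion hJw.1)
  have hf : ∀ x, x ∈ hAJ.toLieIdeal ↔ f x = 0 := fun x =>
    (quotientMk_eq_zero (I := hAw.toLieIdeal) (x := LieSubalgebra.inclusion hJw.1 x)).symm
  let g := toWittHom φ (K := normalizerAlgebra φ) fun x hx => hx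
  have hg : ∀ x ∈ hAw.toLieIdeal, g x = 0 := fun x hx =>
    ((mem_low_iff_toWitt φ).1 (low_mono φ (by norm_num) hx)).2
  have hpi : ∀ y, quotientLift _ g hg (quotientLift _ f (fun x => (hf x).1) y) = 0 := by
    intro y
    obtain ⟨y, rfl⟩ := quotientMk_surjective _ y
    exact ((mem_low_iff_toWitt φ).1 y.2).2
  have hex : ∀ x, quotientLift _ g hg x = 0 →
      ∃ y, quotientLift _ f (fun x => (hf x).1) y = x := by
    intro x hx
    obtain ⟨x, rfl⟩ := quotientMk_surjective _ x
    exact ⟨quotientMk _ ⟨x, (mem_low_iff_toWitt φ).2 ⟨x.2, hx⟩⟩, rfl⟩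
  obtain ⟨ψ, Φ, h⟩ := exists_semiDirectSum _ _ (wittSection φ hAw)
    (quotientLift_injective _ f hf) hpi (fun D => toWitt_ofWitt φ D) hex
  exact ⟨ψ, Φ, fun x => h (quotientMk _ x)⟩

/-! ### The structure of `J` modulo the abelian radical -/

section Extension

variable (hA : (abelAlgebra φ).IsIdealIn (idealAlgebra φ))

/-- The embedding of the loop algebra. -/
def loopHom : TruncPoly k ⊗[k] PSL3 k →ₗ⁅k⁆ hA.Quotient where
  toFun z := quotientMk hA.toLieIdeal ⟨loopMap φ z, low_mono φ (by norm_num) (loopMap_mem φ z)⟩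
  map_add' z w := by
    rw [← map_add]
    congr 1
    exact Subtype.ext (map_add (loopMap φ) z w)
  map_smul' c z := by
    rw [RingHom.id_apply, ← map_smul]
    congr 1
    exact Subtype.ext (map_smul (loopMap φ) c z)
  map_lie' {z w} := by
    rw [← LieHom.map_lie, eq_comm]
    exact quotientMk_eq (lie_loopMap φ z w)

/-- The projection to `𝔭𝔰𝔩(3)`. -/
def toPSLHom : hA.Quotient →ₗ⁅k⁆ PSL3 k :=
  quotientLift hA.toLieIdeal
    { (toPSL φ).comp (idealAlgebra φ).toSubmodule.subtype with
      map_lie' := fun {x y} => toPSL_lie φ x.2 y.2 }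
    fun x hx => (toPSL_eq_zero_iff φ x.2).2 (low_mono φ (by norm_num) hx)

theorem toPSLHom_mk (x : idealAlgebra φ) :
    toPSLHom φ hA (quotientMk hA.toLieIdeal x) = toPSL φ x := rfl

theorem isExtension : IsExtension (loopHom φ hA) (toPSLHom φ hA) where
  ker_eq_bot := by
    rw [LieHom.ker_eq_bot, injective_iff_map_eq_zero]
    intro z hz
    rw [← ofLoop_loopMap φ z]
    exact ofLoop_eq_zero φ (quotientMk_eq_zero.1 hz)
  range_eq_top := by
    rw [LieHom.range_eq_top]
    intro y
    refine ⟨quotientMk _ ⟨∑ a : Fin 7, pcoord k a y • bv φ (71 + a), Submodule.sum_mem _ fun a _ =>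
      Submodule.smul_mem _ _ (bv_mem_low φ (by omega))⟩, ?_⟩
    rw [toPSLHom_mk, map_sum]
    conv_rhs => rw [← sum_pcoord k y]
    exact Finset.sum_congr rfl fun a _ => by rw [map_smul, toPSL_bv φ a.2]
  exact := by
    refine LieSubalgebra.ext _ _ fun x => ?_
    obtain ⟨x, rfl⟩ := quotientMk_surjective _ x
    rw [LieHom.mem_range]
    change _ ↔ toPSL φ x = 0
    rw [toPSL_eq_zero_iff φ x.2]
    constructor
    · rintro ⟨z, hz⟩
      have h1 : loopMap φ z - x ∈ low φ 8 := by
        rw [← sub_eq_zero] at hz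
        exact quotientMk_eq_zero.1 ((map_sub (quotientMk hA.toLieIdeal) _ _).trans hz)
      have := Submodule.sub_mem _ (loopMap_mem φ z) (low_mono φ (by norm_num) h1)
      rwa [sub_sub_cancel] at this
    · exact fun hx => ⟨ofLoop φ x, quotientMk_eq (loopMap_ofLoop φ hx)⟩

/-- Representatives in J of the images of the basis vectors satisfy the relations of 𝔭𝔰𝔩(3) modulo
A, which `not_exists_section` excludes. -/
theorem not_splits : ¬∃ s : PSL3 k →ₗ⁅k⁆ hA.Quotient, ∀ y, toPSLHom φ hA (s y) = y := by
  rintro ⟨s, hs⟩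
  choose y hy using fun p => quotientMk_surjective hA.toLieIdeal (s (pbasis k p))
  refine not_exists_section φ (y := fun p => (y p : E8 k)) (fun p _ => (y p).2) (fun p _ => ?_)
    fun p hp q hq => ?_
  · rw [← toPSLHom_mk φ hA, hy, hs]
  · have h : quotientMk hA.toLieIdeal
        (⁅y p, y q⁆ - ((structCoeff p q).1 : k) • y (structCoeff p q).2) = 0 := by
      rw [map_sub, LieHom.map_lie, map_smul, hy, hy, hy, ← LieHom.map_lie, lie_pbasis k hp hq,
        map_smul, sub_self]
    exact quotientMk_eq_zero.1 h

end Extension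

theorem exists_nilpotent_eq {e : E8 k} (he : e ∈ orbitA2A2A1 k) :
    ∃ φ : E8 k ≃ₗ⁅k⁆ E8 k, e = bv φ 0 := by
  obtain ⟨g, hg, rfl⟩ := he
  obtain ⟨φ, hφ⟩ := exists_lieEquiv k (two_ne_zero_of_charP k) hg
  refine ⟨φ, ?_⟩
  rw [← hφ, bv, ev]
  congr 1
  have h : ∀ (n : ℕ) (i : Fin 8), digits n = Pi.single i 1 →
      genEval k (.p n) = simpleRootVector k i := fun n i h => congrArg (rootVector k) h
  have h0 : vec 0 = [(1, .p 100), (1, .p 1000), (1, .p 100000), (1, .p 1000000), (1, .p 10000000)] :=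
    rfl
  simp only [h0, eval_cons, eval_nil, Nat.cast_one, one_smul, add_zero]
  -- The leading digit belongs to α₁: the code 10000000 is α₁ and 100 is α₆.
  rw [h 100 5 (by decide), h 1000 4 (by decide), h 100000 2 (by decide),
    h 1000000 1 (by decide), h 10000000 0 (by decide)]
  abel

end E8

end

theorem mainTheorem8 (k : Type*) [Field k] [IsAlgClosed k] [CharP k 3]
    (e : E8 k) (he : e ∈ E8.orbitA2A2A1 k)
    (A w : LieSubalgebra k (E8 k))
    (hA : A = (LieSubalgebra.elementNormalizer k e).rad) (hw : w = A.normalizer) :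
    Module.finrank k A = 8 ∧ IsLieAbelian A ∧
    A = (LieSubalgebra.elementCentralizer k e).rad ∧ A = w.rad ∧ IsCoatom w ∧
    ∃ (J : LieSubalgebra k (E8 k))
      (hJc : J.IsIdealIn (LieSubalgebra.elementCentralizer k e))
      (hJn : J.IsIdealIn (LieSubalgebra.elementNormalizer k e))
      (hJw : J.IsIdealIn w) (hAJ : A.IsIdealIn J) (hAw : A.IsIdealIn w),
      Module.finrank k J = 78 ∧
      Nonempty (hJc.Quotient ≃ₗ⁅k⁆ Witt.hamiltonian k) ∧
      Nonempty (hJn.Quotient ≃ₗ⁅k⁆ Witt.conformalHamiltonian k) ∧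
      (∃ (ψ : Witt k →ₗ⁅k⁆ LieDerivation k hAJ.Quotient hAJ.Quotient)
        (Φ : hAw.Quotient ≃ₗ⁅k⁆ (hAJ.Quotient ⋊⁅ψ⁆ Witt k)),
        ∀ x : J, Φ (hAw.mk ⟨x, hJw.1 x.2⟩) = LieAlgebra.SemiDirectSum.inl ψ (hAJ.mk x)) ∧
      (∃ (i : (TruncPoly k ⊗[k] PSL3 k) →ₗ⁅k⁆ hAJ.Quotient) (q : hAJ.Quotient →ₗ⁅k⁆ PSL3 k),
        LieAlgebra.IsExtension i q ∧
        ¬ ∃ s : PSL3 k →ₗ⁅k⁆ hAJ.Quotient, ∀ y, q (s y) = y) := by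
  obtain ⟨φ, rfl⟩ := E8.exists_nilpotent_eq he
  have hc : ∀ x ∈ LieSubalgebra.elementCentralizer k (E8.bv φ 0), x ∈ E8.low φ 96 :=
    fun x hx => ((E8.mem_centralizer_iff φ).1 hx).1
  have hn : ∀ x ∈ LieSubalgebra.elementNormalizer k (E8.bv φ 0), x ∈ E8.low φ 96 :=
    fun x hx => ((E8.mem_elementNormalizer_iff φ).1 hx).1
  have hcn : ∀ x : E8 k, ⁅x, E8.bv φ 0⁆ = 0 → x ∈ LieSubalgebra.elementNormalizer k (E8.bv φ 0) :=
    fun x hx => ⟨0, by rw [hx, zero_smul]⟩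
  rw [← E8.rad_eq φ hcn hn] at hA
  subst hA
  rw [← E8.normalizer_eq] at hw
  subst hw
  -- J is an ideal of every algebra between the centraliser of e and 𝔴, which covers the three cases
  -- at once.
  have hJ : ∀ K : LieSubalgebra k (E8 k), (∀ x : E8 k, ⁅x, E8.bv φ 0⁆ = 0 → x ∈ K) →
      (∀ x ∈ K, x ∈ E8.low φ 96) → (E8.idealAlgebra φ).IsIdealIn K := fun K hK hK' =>
    ⟨fun x hx => E8.low_le_of_centralizer φ hK hx, fun x hx y hy =>
      E8.lie_mem_ideal φ (hK' x hx) hy⟩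
  have hAw : (E8.abelAlgebra φ).IsIdealIn (E8.normalizerAlgebra φ) :=
    ⟨E8.low_mono φ (by norm_num), fun x hx y hy => E8.lie_mem_abel φ hx hy⟩
  have hAJ : (E8.abelAlgebra φ).IsIdealIn (E8.idealAlgebra φ) :=
    ⟨E8.low_mono φ (by norm_num), fun x hx y hy =>
      E8.lie_mem_abel φ (E8.low_mono φ (by norm_num) hx) hy⟩
  have hJw := hJ (E8.normalizerAlgebra φ) (fun x hx => E8.centralizer_le φ hx) fun x hx => hx
  refine ⟨E8.finrank_low φ (by norm_num), ⟨fun x y => Subtype.ext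
    (E8.lie_low_abel φ (E8.low_mono φ (by norm_num) x.2) y.2)⟩, E8.rad_eq φ (fun x hx => hx) hc,
    E8.rad_eq φ (fun x hx => E8.centralizer_le φ hx) fun x hx => hx,
    E8.isCoatom_normalizerAlgebra φ, E8.idealAlgebra φ, hJ _ (fun x hx => hx) hc, hJ _ hcn hn,
    hJw, hAJ, hAw, E8.finrank_low φ (by norm_num),
    E8.nonempty_quotient_equiv φ (fun x => E8.mem_centralizer_iff φ) _,
    E8.nonempty_quotient_equiv φ (fun x => (E8.mem_elementNormalizer_iff φ).trans
      (and_congr_right fun _ => (E8.mem_conformalHamiltonian_iff _).symm)) _,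
    E8.exists_normalizer_semiDirectSum φ hJw hAJ hAw,
    E8.loopHom φ hAJ, E8.toPSLHom φ hAJ, E8.isExtension φ hAJ, E8.not_splits φ hAJ⟩
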